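/- **Setting.** Let $\nu$ be a measure on $\mathbb{R}$, not carried by a single point, with $\int e^{\theta y}\,d\nu(y)<\infty$ for all $\theta\in\mathbb{R}$; put $\mathbf b(\theta)=\log\int e^{\theta y}d\nu(y)$ and let $p_\theta$ be the distribution with $\nu$-density $e^{y\theta-\mathbf b(\theta)}$. For every sample size $n$ let $p=p_n\ge 1$, $\phi^*=\phi^*_n\in\mathbb{R}^{p}$ with support $J^*=\{j:\phi^*_j\ne0\}$, and let $(X_{1\bullet},Y_1),\dots,(X_{n\bullet},Y_n)$ be i.i.d. with $X_{i\bullet}\in\mathbb{R}^p$ random and $Y_i\mid X_{i\bullet}\sim p_{\theta_i}$, $\theta_i=X_{i\bullet}^T\phi^*$. For $J\subset\{1,\dots,p\}$ let $\hat\phi_J$ maximize the log-likelihood $\ell(\phi)=\sum_{i=1}^n \big(Y_iX_{i\bullet}^T\phi-\mathbf b(X_{i\bullet}^T\phi)\big)$ over all $\phi$ supported in $J$, and put $$\mathrm{BIC}_\gamma(J)=-2\,\ell(\hat\phi_J)+|J|\log n+2\gamma|J|\log p .$$ Let $\kappa_n=\log p_n/\log n$ and $\kappa=\limsup\kappa_n\in[0,\infty]$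 (with $1/\kappa=0$ if $\kappa=\infty$). **Conditions.** Assume, with constants $q\in\mathbb{N}$ and $a_1,a_2,a_3>0$ not depending on $n$: (B1) $\log p=o(n)$; (B2) $|J^*|\le q$; (B3) $a_1\mathbf I_J\preceq \mathbb{E}[X_{1J}X_{1J}^T]\preceq a_2\mathbf I_J$ for all $|J|\le 2q$; (B4) $\|\phi^*\|_2\le a_3$; (B5) $\sqrt{\log(np)/n}=o\big(\min_{j\in J^*}|\phi_j^*|\big)$ (no condition when $J^*=\emptyset$). Assume in addition one of the following: (A1) there is a constant $A$, not depending on $n$, such that $|X_{1j}|\le A$ almost surely for all $j$; (A2) $K$ is an even integer with $K>2\kappa$, $\mathbb{E}|X_{1j}|^{6K}\le A_K<\infty$ for all $j$, and for each $t>0$, $\mathbb{E}\big[\sup_{|\theta|\le t|X_{1j}|}|\mathbf b'''(\theta)|^{2K}\big]\le B_K(t)<\infty$ for all $j$, where $A_K$ and $B_K(t)$ do not depend on $n$. **Theorem.** Let $\alpha,\beta,\gamma\in\mathbb{R}$. * If $\kappa>0$, suppose $\gamma>1-\frac1{2\kappa}+\beta+\frac{\alpha}{\kappa}$ and, moreover,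 that $\alpha<\frac12$ or $\kappa_n\to\kappa$; put $m_n=\log(p)\Big(\gamma-\big(1-\tfrac1{2\kappa}+\beta+\tfrac{\alpha}{\kappa}\big)\Big)$. * If $\kappa=0$, suppose $\alpha\in(0,\frac12)$ and $\beta>0$; put $m_n=\log(p)\,(\gamma-1-\beta)+(\tfrac12-\alpha)\log n$, that is, the same expression with $\kappa_n$ in place of $\kappa$. Then for all sufficiently large $n$ the event that $\hat\phi_J$ exists for all $|J|\le q$ and $$\mathrm{BIC}_\gamma(J^*)\le \mathrm{BIC}_\gamma(J)-m_n\qquad\text{for all } J\ne J^*,\ |J|\le q,$$ has probability at least $1-n^{-\alpha}p^{-\beta}$ under (A1), and at least $1-4K^{K+1}n^{-(K-2\kappa)/2}-n^{-\alpha}p^{-\beta}$ under (A2). In particular, under (A1) or (A2), for every real $\gamma>1-\frac1{2\kappa}$ (every real $\gamma$ if $\kappa=0$) the extended BIC is consistent: the probability that $\hat\phi_J$ exists for all $|J|\le q$ and $\mathrm{BIC}_\gamma(J^*)<\mathrm{BIC}_\gamma(J)$ for all $J\ne J^*$ with $|J|\le q$ tends to $1$ as $n\to\infty$. -/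

import Mathlib

open MeasureTheory ProbabilityTheory Filter Topology Set Asymptotics
open scoped ENNReal

namespace GLMSelection

/-- The log-partition (cumulant) function `b(θ) = log ∫ exp(θ y) dν(y)` of the exponential family
with densities `exp(y θ - b(θ))` with respect to `ν`. -/
noncomputable def cumulant (ν : Measure ℝ) : ℝ → ℝ := cgf id ν

/-- `ν` generates a univariate exponential family with natural parameter space `ℝ`, and the family
is not degenerate (`ν` is not carried by a single point; in particular `ν ≠ 0`). -/
structure GeneratesExpFamily (ν : Measure ℝ) : Prop where
  integrable_exp : ∀ θ : ℝ, Integrable (fun y => Real.exp (θ * y)) ν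
  nondegenerate : ∀ c : ℝ, ¬ ∀ᵐ y ∂ν, y = c

/-- The joint law of one observation `(x, y)`: the covariate vector `x` has law `μ`, and given `x`
the response `y` has density `exp(y θ - b(θ))` with respect to `ν`, where `θ = xᵀ φ`. -/
noncomputable def glmLaw {p : ℕ} (ν : Measure ℝ) (μ : Measure (Fin p → ℝ)) (φ : Fin p → ℝ) :
    Measure ((Fin p → ℝ) × ℝ) :=
  (μ.prod ν).withDensity fun z =>
    ENNReal.ofReal (Real.exp (z.2 * (z.1 ⬝ᵥ φ) - cumulant ν (z.1 ⬝ᵥ φ)))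

/-- `(X₁, Y₁), …, (Xₙ, Yₙ)` are i.i.d. observations from the generalized linear model with random
covariates of law `μ` and true parameter `φ`. -/
structure IsGLMSample {Ω : Type*} [MeasurableSpace Ω] (P : Measure Ω) {n p : ℕ} (ν : Measure ℝ)
    (μ : Measure (Fin p → ℝ)) (φ : Fin p → ℝ) (X : Fin n → Ω → Fin p → ℝ) (Y : Fin n → Ω → ℝ) :
    Prop where
  measurable_X : ∀ i, Measurable (X i)
  measurable_Y : ∀ i, Measurable (Y i)
  indep : iIndepFun (fun i ω => (X i ω, Y i ω)) P
  law : ∀ i, P.map (fun ω => (X i ω, Y i ω)) = glmLaw ν μ φ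

/-- The log-likelihood `∑ᵢ yᵢ xᵢᵀφ - b(xᵢᵀφ)` of the data `(x, y)`. -/
noncomputable def logLik {n p : ℕ} (ν : Measure ℝ) (x : Fin n → Fin p → ℝ) (y : Fin n → ℝ)
    (φ : Fin p → ℝ) : ℝ :=
  ∑ i, (y i * (x i ⬝ᵥ φ) - cumulant ν (x i ⬝ᵥ φ))

/-- The parameter space `ℝ^J` of the model `J`, seen inside `ℝ^p`. -/
def modelSpace {p : ℕ} (J : Finset (Fin p)) : Set (Fin p → ℝ) := {φ | ∀ j ∉ J, φ j = 0}

/-- A maximum likelihood estimator exists in the model `J`. -/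
def HasMLE {n p : ℕ} (ν : Measure ℝ) (x : Fin n → Fin p → ℝ) (y : Fin n → ℝ)
    (J : Finset (Fin p)) : Prop :=
  ∃ φ ∈ modelSpace J, IsMaxOn (logLik ν x y) (modelSpace J) φ

/-- The extended BIC, `-2 log L(φ̂_J) + |J| log n + 2 γ |J| log p`. The maximized log-likelihood is
written as a supremum; it is the value at the maximum likelihood estimator when `HasMLE` holds. -/
noncomputable def ebic {n p : ℕ} (ν : Measure ℝ) (x : Fin n → Fin p → ℝ) (y : Fin n → ℝ) (γ : ℝ)
    (J : Finset (Fin p)) : ℝ :=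
  -2 * sSup (logLik ν x y '' modelSpace J) + J.card * Real.log n + 2 * γ * J.card * Real.log p

/-- The smallest true model, i.e. the support of the true parameter. -/
noncomputable def trueModel {p : ℕ} (φ : Fin p → ℝ) : Finset (Fin p) :=
  Finset.univ.filter fun j => φ j ≠ 0

/-- All models with at most `q` covariates have a maximum likelihood estimator, and the extended BIC
of the model `Js` is below that of every other such model by at least `m`. -/
def SelectsWithMargin {n p : ℕ} (ν : Measure ℝ) (x : Fin n → Fin p → ℝ) (y : Fin n → ℝ)
    (γ : ℝ) (q : ℕ) (Js : Finset (Fin p)) (m : ℝ) : Prop :=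
  (∀ J : Finset (Fin p), J.card ≤ q → HasMLE ν x y J) ∧
    ∀ J : Finset (Fin p), J ≠ Js → J.card ≤ q → ebic ν x y γ Js ≤ ebic ν x y γ J - m

/-- All models with at most `q` covariates have a maximum likelihood estimator, and `Js` is the
strict minimizer of the extended BIC among the models with at most `q` covariates. -/
def Selects {n p : ℕ} (ν : Measure ℝ) (x : Fin n → Fin p → ℝ) (y : Fin n → ℝ)
    (γ : ℝ) (q : ℕ) (Js : Finset (Fin p)) : Prop :=
  (∀ J : Finset (Fin p), J.card ≤ q → HasMLE ν x y J) ∧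
    ∀ J : Finset (Fin p), J ≠ Js → J.card ≤ q → ebic ν x y γ Js < ebic ν x y γ J

/-- `κₙ = log_n(pₙ)`, as an extended nonnegative number. -/
noncomputable def kappaSeq (p : ℕ → ℕ) (n : ℕ) : ℝ≥0∞ := ENNReal.ofReal (Real.logb n (p n))

/-- `κ = limsup κₙ ∈ [0, ∞]`. -/
noncomputable def kappa (p : ℕ → ℕ) : ℝ≥0∞ := limsup (kappaSeq p) atTop

/-- `1/κ` as a real number; only used for `κ ≠ 0`, with value `0` for `κ = ∞`. -/
noncomputable def invKappa (p : ℕ → ℕ) : ℝ := ((kappa p)⁻¹).toReal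

/-- The second moment matrix `E[X_J X_Jᵀ]` of the covariates in `J`. -/
noncomputable def secondMoment {p : ℕ} (μ : Measure (Fin p → ℝ)) (J : Finset (Fin p)) :
    Matrix J J ℝ :=
  Matrix.of fun j k => ∫ x, x j * x k ∂μ

/-- The covariates are almost surely bounded by one constant. -/
def BoundedCovariates {p : ℕ → ℕ} (μ : ∀ n, Measure (Fin (p n) → ℝ)) : Prop :=
  ∃ A : ℝ, ∀ n, ∀ j : Fin (p n), ∀ᵐ x ∂μ n, |x j| ≤ A

/-- The moment conditions of order `K` on the covariates, uniform over all covariates and all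
sample sizes. -/
structure MomentCovariates (ν : Measure ℝ) {p : ℕ → ℕ} (μ : ∀ n, Measure (Fin (p n) → ℝ))
    (K : ℕ) : Prop where
  even : Even K
  two_kappa_lt : 2 * kappa p < K
  moment : ∃ A : ℝ, ∀ n, ∀ j : Fin (p n),
    ∫⁻ x, ENNReal.ofReal (|x j| ^ (6 * K)) ∂μ n ≤ ENNReal.ofReal A
  third_deriv : ∀ t : ℝ, 0 < t → ∃ B : ℝ, ∀ n, ∀ j : Fin (p n),
    ∫⁻ x, (⨆ θ ∈ {θ : ℝ | |θ| ≤ t * |x j|},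
      ENNReal.ofReal (|iteratedDeriv 3 (cumulant ν) θ| ^ (2 * K))) ∂μ n ≤ ENNReal.ofReal B

/-- The five conditions on the growth of `p`, the sparsity, the second moments of the covariates,
the size of the signal, and the smallest true coefficient. -/
structure SparseRegime (q : ℕ) {p : ℕ → ℕ} (μ : ∀ n, Measure (Fin (p n) → ℝ))
    (φ : ∀ n, Fin (p n) → ℝ) : Prop where
  growth : (fun n => Real.log (p n)) =o[atTop] fun n : ℕ => (n : ℝ)
  sparsity : ∀ n, (trueModel (φ n)).card ≤ q
  eigenvalues : ∃ a₁ a₂ : ℝ, 0 < a₁ ∧ 0 < a₂ ∧ ∀ n, ∀ J : Finset (Fin (p n)), J.card ≤ 2 * q →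
    (secondMoment (μ n) J - a₁ • (1 : Matrix J J ℝ)).PosSemidef ∧
      (a₂ • (1 : Matrix J J ℝ) - secondMoment (μ n) J).PosSemidef
  signal_bounded : ∃ a₃ : ℝ, 0 < a₃ ∧ ∀ n, ‖WithLp.toLp 2 (φ n)‖ ≤ a₃
  signal_decay : ∀ c : ℝ, 0 < c → ∀ᶠ n : ℕ in atTop, ∀ j ∈ trueModel (φ n),
    Real.sqrt (Real.log (n * p n) / n) ≤ c * |φ n j|

/-- The requirements on the scalars `α, β, γ`. -/
def AdmissibleScalars (p : ℕ → ℕ) (α β γ : ℝ) : Prop :=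
  (kappa p = 0 → 0 < α ∧ α < 1 / 2 ∧ 0 < β) ∧
    (kappa p ≠ 0 → 1 - invKappa p / 2 + β + α * invKappa p < γ ∧
      (α < 1 / 2 ∨ Tendsto (kappaSeq p) atTop (𝓝 (kappa p))))

/-- The margin `log(p) (γ - (1 - 1/(2κ) + β + α/κ))`. For `κ = 0`, where `1/κ` is infinite, `κ` is
replaced by `κₙ = log p / log n`, and `log(p) / κₙ = log n`. -/
noncomputable def margin (p : ℕ → ℕ) (α β γ : ℝ) (n : ℕ) : ℝ :=
  if kappa p = 0 then
    Real.log (p n) * (γ - (1 + β)) + (1 / 2 - α) * Real.log n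
  else
    Real.log (p n) * (γ - (1 - invKappa p / 2 + β + α * invKappa p))

end GLMSelection

namespace GLMSelection

/-! ### The cumulant function -/

section Cumulant

variable {ν : Measure ℝ}

/-! At a fixed parameter ψ the likelihood ratio exp(ℓ(ψ) - ℓ(φ*)) has expectation one, so Markov's
inequality gives P(ℓ(ψ) - ℓ(φ*) ≥ t) ≤ exp(-t) without any condition on the covariates
(`IsGLMSample.measureReal_le_logLik_sub`). All control of the responses comes from union bounds over
this inequality. The rest is convexity together with properties of the design alone, collected in
`RegularDesign`.

Let Λ = log(np) and r = √(Λ/n). The bounds at the 2p axis points φ* ± r e_j, combined with a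
quadratic upper bound of the tangent gap, show that the score is O(√(nΛ)) in every coordinate
(`RegularDesign.abs_score_le`). On a sphere of radius Rr the curvature term grows like R² and the
score term like R, so for large R the log-likelihood has dropped there by d₀Λ, and concavity extends
the drop outwards (`RegularDesign.logLik_add_le`). Hence the estimators exist, a model that misses a
true covariate loses because that coefficient exceeds Rr, and the estimator in a model containing J*
lies within Rr of φ*.

For such a model with d superfluous covariates, a grid of mesh ηr, with a number of points
independent of n, covers the relevant ball. Near a maximizer the move to a grid point costs only
O(η²Λ) (`RegularDesign.le_logLik_add`), so the maximum inherits the exponential tail of single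
points up to a small multiple of Λ. At the level d(log n / 2 + γ log p), the at most p^d models fail
with total probability about (p^(1-γ) n^(-1/2))^d. The condition on γ puts the term d = 1 below
n^(-α) p^(-β) by a power of np, even after the margin is subtracted
(`AdmissibleScalars.exists_slack`); this power absorbs the constants.

It remains to see that random designs are regular. For the curvature, truncated second moments
concentrate by Hoeffding's inequality uniformly over the roughly p^(2q) sparse models, as log p =
o(n). The averaged second derivatives are bounded outright for bounded covariates; under moment
conditions Markov's inequality handles maxima and a Chernoff bound handles truncated sums. There
only the uniform bound on all covariates pays a polynomially relevant factor p, which produces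
n^(-(K-2κ)/2). -/

lemma GeneratesExpFamily.isFiniteMeasure (hν : GeneratesExpFamily ν) : IsFiniteMeasure ν := by
  have h := hν.integrable_exp 0
  simp only [zero_mul, Real.exp_zero] at h
  have := (integrable_const_iff (μ := ν) (c := (1 : ℝ))).1 h
  simpa using this

lemma GeneratesExpFamily.ne_zero (hν : GeneratesExpFamily ν) : ν ≠ 0 := by
  rintro rfl
  exact hν.nondegenerate 0 (by simp)

lemma GeneratesExpFamily.mem_interior (hν : GeneratesExpFamily ν) (θ : ℝ) :
    θ ∈ interior (integrableExpSet id ν) := by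
  have : integrableExpSet id ν = univ :=
    eq_univ_of_forall fun t => by simpa [integrableExpSet] using hν.integrable_exp t
  simp [this]

lemma contDiff_cumulant (hν : GeneratesExpFamily ν) (k : ℕ) : ContDiff ℝ k (cumulant ν) := by
  have : AnalyticOnNhd ℝ (cumulant ν) univ := fun θ _ => analyticAt_cgf (hν.mem_interior θ)
  exact this.contDiff

lemma exp_cumulant (hν : GeneratesExpFamily ν) (θ : ℝ) :
    Real.exp (cumulant ν θ) = ∫ y, Real.exp (θ * y) ∂ν := by
  have h := exp_cgf (X := id) (μ := ν) (t := θ) (by simpa using hν.integrable_exp θ) (hμ := ⟨hν.ne_zero⟩)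
  simpa [cumulant, mgf] using h

/-- The second derivative is the variance of the exponentially tilted measure. If it vanished, the
tilted measure would sit at a point, and so would `ν`, which is absolutely continuous with respect
to its tilt. -/
lemma iteratedDeriv_two_cumulant_pos (hν : GeneratesExpFamily ν) (θ : ℝ) :
    0 < iteratedDeriv 2 (cumulant ν) θ := by
  have hi := hν.mem_interior θ
  rw [cumulant, ← variance_tilted_mul hi]
  refine lt_of_le_of_ne (variance_nonneg _ _) fun h0 => ?_
  have hint : Integrable (fun y => Real.exp (θ * id y)) ν := by simpa using hν.integrable_exp θ
  have hm : MemLp (id : ℝ → ℝ) 2 (ν.tilted (θ * id ·)) := by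
    simpa using memLp_tilted_mul (X := id) hi 2
  have : NeZero ν := ⟨hν.ne_zero⟩
  have : IsProbabilityMeasure (ν.tilted (θ * id ·)) := isProbabilityMeasure_tilted hint
  have hev : evariance id (ν.tilted (θ * id ·)) = 0 := by
    rw [← hm.ofReal_variance_eq, ← h0, ENNReal.ofReal_zero]
  have hae := (evariance_eq_zero_iff hm.aestronglyMeasurable.aemeasurable).1 hev
  exact hν.nondegenerate _ ((absolutelyContinuous_tilted hint).ae_le hae)

/-- Taylor's formula with Lagrange remainder; the non-strict bound on `ξ` lets the case `h = 0` be
included. -/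
lemma exists_cumulant_add_eq (hν : GeneratesExpFamily ν) (θ h : ℝ) :
    ∃ ξ, |ξ - θ| ≤ |h| ∧ cumulant ν (θ + h) =
      cumulant ν θ + deriv (cumulant ν) θ * h + iteratedDeriv 2 (cumulant ν) ξ * h ^ 2 / 2 := by
  rcases eq_or_ne h 0 with rfl | hh
  · exact ⟨θ, by simp⟩
  have hne : θ ≠ θ + h := by simpa using hh
  have hc : ContDiff ℝ 2 (cumulant ν) := contDiff_cumulant hν 2
  obtain ⟨ξ, hξ, he⟩ := taylor_mean_remainder_lagrange_iteratedDeriv (n := 1) hne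
    (f := cumulant ν) (by norm_num; exact hc.contDiffOn)
  refine ⟨ξ, ?_, ?_⟩
  · have := abs_sub_left_of_mem_uIcc (uIoo_subset_uIcc_self hξ)
    simpa using this
  · have hd : derivWithin (cumulant ν) (uIcc θ (θ + h)) θ = deriv (cumulant ν) θ :=
      (hc.differentiable (by norm_num)).differentiableAt.derivWithin
        (uniqueDiffOn_uIcc hne _ left_mem_uIcc)
    rw [taylorWithinEval_succ, taylor_within_zero_eval, iteratedDerivWithin_one, hd] at he
    simp at he
    linarith

lemma cumulant_add_le (hν : GeneratesExpFamily ν) {θ h F : ℝ}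
    (hF : ∀ t, |t - θ| ≤ |h| → iteratedDeriv 2 (cumulant ν) t ≤ F) :
    cumulant ν (θ + h) ≤ cumulant ν θ + deriv (cumulant ν) θ * h + F * h ^ 2 / 2 := by
  obtain ⟨ξ, h1, h2⟩ := exists_cumulant_add_eq hν θ h
  rw [h2]
  have := mul_le_mul_of_nonneg_right (hF ξ h1) (sq_nonneg h)
  linarith

lemma le_cumulant_add (hν : GeneratesExpFamily ν) {θ h m : ℝ}
    (hm : ∀ t, |t - θ| ≤ |h| → m ≤ iteratedDeriv 2 (cumulant ν) t) :
    cumulant ν θ + deriv (cumulant ν) θ * h + m * h ^ 2 / 2 ≤ cumulant ν (θ + h) := by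
  obtain ⟨ξ, h1, h2⟩ := exists_cumulant_add_eq hν θ h
  rw [h2]
  have := mul_le_mul_of_nonneg_right (hm ξ h1) (sq_nonneg h)
  linarith

lemma cumulant_tangent_le (hν : GeneratesExpFamily ν) (θ h : ℝ) :
    cumulant ν θ + deriv (cumulant ν) θ * h ≤ cumulant ν (θ + h) := by
  simpa using le_cumulant_add (m := 0) hν fun t _ => (iteratedDeriv_two_cumulant_pos hν t).le

lemma convexOn_cumulant (hν : GeneratesExpFamily ν) : ConvexOn ℝ univ (cumulant ν) := by
  have hc : ContDiff ℝ 2 (cumulant ν) := contDiff_cumulant hν 2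
  refine convexOn_univ_of_deriv2_nonneg (hc.differentiable (by norm_num)) ?_ fun t => ?_
  · have := hc.differentiable_iteratedDeriv 1 (by norm_num)
    simpa [iteratedDeriv_one] using this
  · have := (iteratedDeriv_two_cumulant_pos hν t).le
    rwa [iteratedDeriv_eq_iterate] at this

lemma continuous_cumulant (hν : GeneratesExpFamily ν) : Continuous (cumulant ν) :=
  (contDiff_cumulant hν 1).continuous

lemma continuous_iteratedDeriv_cumulant (hν : GeneratesExpFamily ν) (k : ℕ) :
    Continuous (iteratedDeriv k (cumulant ν)) :=
  (contDiff_cumulant hν k).continuous_iteratedDeriv k le_rfl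

/-- A mean value bound of the second derivative of the cumulant function by the third. -/
lemma iteratedDeriv_two_cumulant_le (hν : GeneratesExpFamily ν) {u t B : ℝ} (htu : |t| ≤ u)
    (hB : ∀ s, |s| ≤ u → |iteratedDeriv 3 (cumulant ν) s| ≤ B) :
    iteratedDeriv 2 (cumulant ν) t ≤ iteratedDeriv 2 (cumulant ν) 0 + u * B := by
  have hc : ContDiff ℝ 3 (cumulant ν) := contDiff_cumulant hν 3
  have hd : Differentiable ℝ (iteratedDeriv 2 (cumulant ν)) :=
    hc.differentiable_iteratedDeriv 2 (by norm_num)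
  have h := Convex.norm_image_sub_le_of_norm_deriv_le (s := Icc (-u) u) (x := 0) (y := t) (C := B)
    (f := iteratedDeriv 2 (cumulant ν)) (fun s _ => hd.differentiableAt)
    (fun s hs => by
      rw [← iteratedDeriv_succ]
      exact hB s (abs_le.2 hs)) (convex_Icc _ _)
    (by simpa using (abs_nonneg t).trans htu) (abs_le.1 htu)
  have hB0 : 0 ≤ B := (abs_nonneg _).trans (hB t htu)
  have h2 := (le_abs_self _).trans h
  have h3 : B * ‖t - 0‖ ≤ u * B := by
    rw [sub_zero, Real.norm_eq_abs, mul_comm]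
    exact mul_le_mul_of_nonneg_right htu hB0
  linarith

end Cumulant

/-! ### The law of the sample -/

section Law

variable {ν : Measure ℝ} {p : ℕ} {μ : Measure (Fin p → ℝ)}

lemma measurable_dotProduct_right (φ : Fin p → ℝ) :
    Measurable fun x : Fin p → ℝ => x ⬝ᵥ φ := by
  unfold dotProduct
  fun_prop

lemma lintegral_density (hν : GeneratesExpFamily ν) (θ : ℝ) :
    ∫⁻ y, ENNReal.ofReal (Real.exp (y * θ - cumulant ν θ)) ∂ν = 1 := by
  have h1 : ∀ y, Real.exp (y * θ - cumulant ν θ) =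
      Real.exp (θ * y) * Real.exp (-cumulant ν θ) := fun y => by
    rw [← Real.exp_add]; ring_nf
  simp_rw [h1]
  rw [← ofReal_integral_eq_lintegral_ofReal ((hν.integrable_exp θ).mul_const _)
    (ae_of_all _ fun y => by positivity), integral_mul_const, ← exp_cumulant hν, ← Real.exp_add]
  simp

lemma measurable_logDensity (hν : GeneratesExpFamily ν) (φ : Fin p → ℝ) :
    Measurable fun z : (Fin p → ℝ) × ℝ => z.2 * (z.1 ⬝ᵥ φ) - cumulant ν (z.1 ⬝ᵥ φ) := by
  have h1 : Measurable fun z : (Fin p → ℝ) × ℝ => z.1 ⬝ᵥ φ :=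
    (measurable_dotProduct_right φ).comp measurable_fst
  exact (measurable_snd.mul h1).sub ((continuous_cumulant hν).measurable.comp h1)

lemma measurable_density (hν : GeneratesExpFamily ν) (φ : Fin p → ℝ) :
    Measurable fun z : (Fin p → ℝ) × ℝ =>
      ENNReal.ofReal (Real.exp (z.2 * (z.1 ⬝ᵥ φ) - cumulant ν (z.1 ⬝ᵥ φ))) :=
  (measurable_logDensity hν φ).exp.ennreal_ofReal

lemma measurable_likelihoodRatio (hν : GeneratesExpFamily ν) (φ ψ : Fin p → ℝ) :
    Measurable fun z : (Fin p → ℝ) × ℝ =>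
      ENNReal.ofReal (Real.exp ((z.2 * (z.1 ⬝ᵥ ψ) - cumulant ν (z.1 ⬝ᵥ ψ)) -
      (z.2 * (z.1 ⬝ᵥ φ) - cumulant ν (z.1 ⬝ᵥ φ)))) :=
  ((measurable_logDensity hν ψ).sub (measurable_logDensity hν φ)).exp.ennreal_ofReal

lemma lintegral_glmLaw [IsProbabilityMeasure μ] (hν : GeneratesExpFamily ν) (φ : Fin p → ℝ)
    {f : (Fin p → ℝ) → ℝ≥0∞} (hf : Measurable f) :
    ∫⁻ z, f z.1 ∂(glmLaw ν μ φ) = ∫⁻ x, f x ∂μ := by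
  have := hν.isFiniteMeasure
  have hd := measurable_density hν φ
  have hf' : Measurable fun z : (Fin p → ℝ) × ℝ => f z.1 := hf.comp measurable_fst
  rw [glmLaw, lintegral_withDensity_eq_lintegral_mul _ hd hf',
    lintegral_prod _ (hd.mul hf').aemeasurable]
  refine lintegral_congr fun x => ?_
  simp only [Pi.mul_apply]
  rw [lintegral_mul_const _ (by fun_prop), lintegral_density hν, one_mul]

/-- The density at `φ` cancels, leaving the density of the model with parameter `ψ`, which
integrates to one over `y` for every `x`. -/
lemma lintegral_likelihoodRatio [IsProbabilityMeasure μ] (hν : GeneratesExpFamily ν)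
    (φ ψ : Fin p → ℝ) :
    ∫⁻ z, ENNReal.ofReal (Real.exp ((z.2 * (z.1 ⬝ᵥ ψ) - cumulant ν (z.1 ⬝ᵥ ψ)) -
      (z.2 * (z.1 ⬝ᵥ φ) - cumulant ν (z.1 ⬝ᵥ φ)))) ∂(glmLaw ν μ φ) = 1 := by
  have := hν.isFiniteMeasure
  rw [glmLaw, lintegral_withDensity_eq_lintegral_mul _ (measurable_density hν φ)
    (measurable_likelihoodRatio hν φ ψ)]
  have h2 : ∀ z : (Fin p → ℝ) × ℝ,
      ((fun z : (Fin p → ℝ) × ℝ =>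
        ENNReal.ofReal (Real.exp (z.2 * (z.1 ⬝ᵥ φ) - cumulant ν (z.1 ⬝ᵥ φ)))) *
      fun z : (Fin p → ℝ) × ℝ => ENNReal.ofReal (Real.exp ((z.2 * (z.1 ⬝ᵥ ψ) -
        cumulant ν (z.1 ⬝ᵥ ψ)) - (z.2 * (z.1 ⬝ᵥ φ) - cumulant ν (z.1 ⬝ᵥ φ))))) z =
      ENNReal.ofReal (Real.exp (z.2 * (z.1 ⬝ᵥ ψ) - cumulant ν (z.1 ⬝ᵥ ψ))) := fun z => by
    simp only [Pi.mul_apply]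
    rw [← ENNReal.ofReal_mul (Real.exp_nonneg _), ← Real.exp_add]
    congr 2
    ring
  rw [lintegral_congr h2, lintegral_prod _ (measurable_density hν ψ).aemeasurable]
  simp [lintegral_density hν]

variable {Ω : Type*} [MeasurableSpace Ω] {P : Measure Ω} {n : ℕ} {φ : Fin p → ℝ}
  {X : Fin n → Ω → Fin p → ℝ} {Y : Fin n → Ω → ℝ}

lemma IsGLMSample.measurable_XY (h : IsGLMSample P ν μ φ X Y) (i : Fin n) :
    Measurable fun ω => (X i ω, Y i ω) :=
  (h.measurable_X i).prodMk (h.measurable_Y i)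

lemma IsGLMSample.lintegral_comp_X [IsProbabilityMeasure μ] (hν : GeneratesExpFamily ν)
    (h : IsGLMSample P ν μ φ X Y) (i : Fin n) {f : (Fin p → ℝ) → ℝ≥0∞} (hf : Measurable f) :
    ∫⁻ ω, f (X i ω) ∂P = ∫⁻ x, f x ∂μ := by
  have hf' : Measurable fun z : (Fin p → ℝ) × ℝ => f z.1 := hf.comp measurable_fst
  rw [← lintegral_glmLaw hν φ hf, ← h.law i, lintegral_map hf' (h.measurable_XY i)]

lemma IsGLMSample.map_X [IsProbabilityMeasure μ] (hν : GeneratesExpFamily ν)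
    (h : IsGLMSample P ν μ φ X Y) (i : Fin n) : P.map (X i) = μ := by
  ext s hs
  rw [Measure.map_apply (h.measurable_X i) hs]
  have := h.lintegral_comp_X hν i (measurable_one.indicator hs : Measurable (s.indicator 1))
  rw [lintegral_indicator_one hs] at this
  rw [← this, ← lintegral_indicator_one (h.measurable_X i hs)]
  rfl

lemma IsGLMSample.indep_X (h : IsGLMSample P ν μ φ X Y) : iIndepFun X P :=
  h.indep.comp (fun _ z => z.1) fun _ => measurable_fst

/-- The sum in the exponent is a product of independent one-observation likelihood ratios, each of
mean one. -/
lemma IsGLMSample.lintegral_exp_logLik [IsProbabilityMeasure μ] (hν : GeneratesExpFamily ν)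
    (h : IsGLMSample P ν μ φ X Y) (ψ : Fin p → ℝ) :
    ∫⁻ ω, ENNReal.ofReal (Real.exp (logLik ν (fun i => X i ω) (fun i => Y i ω) ψ -
      logLik ν (fun i => X i ω) (fun i => Y i ω) φ)) ∂P = 1 := by
  let g : (Fin p → ℝ) × ℝ → ℝ≥0∞ := fun z =>
    ENNReal.ofReal (Real.exp ((z.2 * (z.1 ⬝ᵥ ψ) - cumulant ν (z.1 ⬝ᵥ ψ)) -
      (z.2 * (z.1 ⬝ᵥ φ) - cumulant ν (z.1 ⬝ᵥ φ))))
  have hg : Measurable g := measurable_likelihoodRatio hν φ ψ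
  have hi : iIndepFun (fun i ω => g (X i ω, Y i ω)) P := h.indep.comp (fun _ => g) fun _ => hg
  have h1 : ∀ ω, ENNReal.ofReal (Real.exp (logLik ν (fun i => X i ω) (fun i => Y i ω) ψ -
      logLik ν (fun i => X i ω) (fun i => Y i ω) φ)) = ∏ i, g (X i ω, Y i ω) := fun ω => by
    rw [logLik, logLik, ← Finset.sum_sub_distrib, Real.exp_sum,
      ENNReal.ofReal_prod_of_nonneg fun _ _ => (Real.exp_nonneg _)]
  rw [lintegral_congr h1, lintegral_prod_eq_prod_lintegral_of_indepFun _ _ hi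
    fun i => hg.comp (h.measurable_XY i)]
  refine Finset.prod_eq_one fun i _ => ?_
  rw [← lintegral_likelihoodRatio (μ := μ) hν φ ψ, ← h.law i,
    lintegral_map hg (h.measurable_XY i)]

/-- The likelihood ratio at a fixed parameter has exponential tails. -/
lemma IsGLMSample.measureReal_le_logLik_sub [IsProbabilityMeasure μ] (hν : GeneratesExpFamily ν)
    (h : IsGLMSample P ν μ φ X Y) (ψ : Fin p → ℝ) (t : ℝ) :
    P.real {ω | t ≤ logLik ν (fun i => X i ω) (fun i => Y i ω) ψ -
      logLik ν (fun i => X i ω) (fun i => Y i ω) φ} ≤ Real.exp (-t) := by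
  set D : Ω → ℝ := fun ω => logLik ν (fun i => X i ω) (fun i => Y i ω) ψ -
    logLik ν (fun i => X i ω) (fun i => Y i ω) φ with hD
  have hDm : Measurable D := by
    have hm : ∀ φ : Fin p → ℝ, Measurable fun ω =>
        logLik ν (fun i => X i ω) (fun i => Y i ω) φ := fun φ =>
      Finset.measurable_sum _ fun i _ => (measurable_logDensity hν φ).comp (h.measurable_XY i)
    exact (hm ψ).sub (hm φ)
  have h1 := meas_ge_le_lintegral_div (μ := P) (f := fun ω => ENNReal.ofReal (Real.exp (D ω)))
    hDm.exp.ennreal_ofReal.aemeasurable (ε := ENNReal.ofReal (Real.exp t))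
    (by simpa using Real.exp_pos t) ENNReal.ofReal_ne_top
  rw [h.lintegral_exp_logLik hν ψ, one_div, ← ENNReal.ofReal_inv_of_pos (Real.exp_pos t),
    ← Real.exp_neg] at h1
  refine ENNReal.toReal_le_of_le_ofReal (Real.exp_nonneg _) (le_trans (measure_mono ?_) h1)
  intro ω hω
  exact ENNReal.ofReal_le_ofReal (Real.exp_le_exp.2 hω)

end Law

/-! ### Deterministic analysis of the log-likelihood -/

section Deterministic

variable {ν : Measure ℝ} {n p : ℕ} {x : Fin n → Fin p → ℝ} {y : Fin n → ℝ} {φ δ : Fin p → ℝ}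

/-- The gradient of the log-likelihood. -/
noncomputable def score (ν : Measure ℝ) (x : Fin n → Fin p → ℝ) (y : Fin n → ℝ) (φ : Fin p → ℝ) :
    Fin p → ℝ :=
  fun j => ∑ i, (y i - deriv (cumulant ν) (x i ⬝ᵥ φ)) * x i j

/-- The error of the tangent of the cumulant function, summed over the sample. -/
noncomputable def tangentGap (ν : Measure ℝ) (x : Fin n → Fin p → ℝ) (φ δ : Fin p → ℝ) : ℝ :=
  ∑ i, (cumulant ν (x i ⬝ᵥ φ + x i ⬝ᵥ δ) - cumulant ν (x i ⬝ᵥ φ) -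
    deriv (cumulant ν) (x i ⬝ᵥ φ) * (x i ⬝ᵥ δ))

/-- A design is regular at `φ` if the covariates are bounded by `M`, the second derivatives near `φ`
are at most `C` on average, and the log-likelihood has curvature `c` in all sparse directions. -/
structure RegularDesign (ν : Measure ℝ) (x : Fin n → Fin p → ℝ) (φ : Fin p → ℝ) (q : ℕ)
    (M C c : ℝ) : Prop where
  bounded : ∀ i j, |x i j| ≤ M
  weighted : ∃ F : Fin n → ℝ,
    (∀ i t, |t - x i ⬝ᵥ φ| ≤ 1 → iteratedDeriv 2 (cumulant ν) t ≤ F i) ∧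
      ∀ j, ∑ i, F i * x i j ^ 2 ≤ C * n
  curved : ∀ J : Finset (Fin p), J.card ≤ 2 * q → ∀ δ ∈ modelSpace J, M * (2 * q) * ‖δ‖ ≤ 1 →
    c * n * ‖δ‖ ^ 2 ≤ tangentGap ν x φ δ

lemma modelSpace_mono {J J' : Finset (Fin p)} (h : J ⊆ J') : modelSpace J ⊆ modelSpace J' :=
  fun _ hφ j hj => hφ j fun hj' => hj (h hj')

lemma dotProduct_eq_sum_of_mem {J : Finset (Fin p)} (hδ : δ ∈ modelSpace J) (v : Fin p → ℝ) :
    v ⬝ᵥ δ = ∑ j ∈ J, v j * δ j := by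
  rw [dotProduct]
  exact (Finset.sum_subset (Finset.subset_univ J) fun j _ hj => by simp [hδ j hj]).symm

lemma abs_dotProduct_le {J : Finset (Fin p)} (hδ : δ ∈ modelSpace J) {v : Fin p → ℝ} {M : ℝ}
    {k : ℕ} (hM : 0 ≤ M) (hJ : J.card ≤ k) (hv : ∀ j ∈ J, |v j| ≤ M) : |v ⬝ᵥ δ| ≤ M * k * ‖δ‖ := by
  rw [dotProduct_eq_sum_of_mem hδ]
  calc |∑ j ∈ J, v j * δ j| ≤ ∑ j ∈ J, |v j * δ j| := Finset.abs_sum_le_sum_abs _ _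
    _ ≤ ∑ j ∈ J, M * ‖δ‖ := Finset.sum_le_sum fun j hj => by
        rw [abs_mul]
        exact mul_le_mul (hv j hj) (norm_le_pi_norm δ j) (abs_nonneg _) hM
    _ = M * J.card * ‖δ‖ := by rw [Finset.sum_const, nsmul_eq_mul]; ring
    _ ≤ M * k * ‖δ‖ := by gcongr

lemma sq_dotProduct_le {J : Finset (Fin p)} (hδ : δ ∈ modelSpace J) (v : Fin p → ℝ) {k : ℕ}
    (hJ : J.card ≤ k) : (v ⬝ᵥ δ) ^ 2 ≤ k * ‖δ‖ ^ 2 * ∑ j ∈ J, v j ^ 2 := by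
  rw [dotProduct_eq_sum_of_mem hδ]
  calc (∑ j ∈ J, v j * δ j) ^ 2 ≤ J.card * ∑ j ∈ J, (v j * δ j) ^ 2 := sq_sum_le_card_mul_sum_sq
    _ ≤ k * ∑ j ∈ J, ‖δ‖ ^ 2 * v j ^ 2 := by
        gcongr with j
        rw [mul_pow, mul_comm]
        refine mul_le_mul_of_nonneg_right ?_ (sq_nonneg _)
        rw [← sq_abs]
        exact pow_le_pow_left₀ (abs_nonneg _) (norm_le_pi_norm δ j) 2
    _ = _ := by rw [← Finset.mul_sum]; ring

/-- The responses enter the log-likelihood linearly, so once the score is split off the remainder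
depends on the design only. -/
lemma logLik_add (ν : Measure ℝ) (x : Fin n → Fin p → ℝ) (y : Fin n → ℝ) (φ δ : Fin p → ℝ) :
    logLik ν x y (φ + δ) = logLik ν x y φ + score ν x y φ ⬝ᵥ δ - tangentGap ν x φ δ := by
  have h : score ν x y φ ⬝ᵥ δ =
      ∑ i, (y i - deriv (cumulant ν) (x i ⬝ᵥ φ)) * (x i ⬝ᵥ δ) := by
    simp only [score, dotProduct, Finset.sum_mul, Finset.mul_sum]
    rw [Finset.sum_comm]
    simp only [mul_assoc]
  rw [h, logLik, logLik, tangentGap, ← Finset.sum_add_distrib, ← Finset.sum_sub_distrib]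
  refine Finset.sum_congr rfl fun i _ => ?_
  rw [dotProduct_add]
  ring

lemma continuous_logLik (hν : GeneratesExpFamily ν) : Continuous (logLik ν x y) := by
  refine continuous_finsetSum _ fun i _ => ?_
  have h : Continuous fun φ : Fin p → ℝ => x i ⬝ᵥ φ := by unfold dotProduct; fun_prop
  exact (h.const_mul (y i)).sub ((continuous_cumulant hν).comp h)

lemma concaveOn_logLik (hν : GeneratesExpFamily ν) : ConcaveOn ℝ univ (logLik ν x y) := by
  refine ⟨convex_univ, fun φ _ ψ _ a b ha hb hab => ?_⟩
  simp only [logLik, smul_eq_mul, Finset.mul_sum, ← Finset.sum_add_distrib]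
  refine Finset.sum_le_sum fun i _ => ?_
  have h := (convexOn_cumulant hν).2 (mem_univ (x i ⬝ᵥ φ)) (mem_univ (x i ⬝ᵥ ψ)) ha hb hab
  simp only [smul_eq_mul] at h
  rw [dotProduct_add, dotProduct_smul, dotProduct_smul, smul_eq_mul, smul_eq_mul]
  linarith

/-- By concavity a deficit on a sphere extends linearly to its exterior. -/
lemma logLik_add_le_of_sphere (hν : GeneratesExpFamily ν) {J : Finset (Fin p)} {ρ D : ℝ}
    (hρ : 0 < ρ)
    (H : ∀ δ ∈ modelSpace J, ‖δ‖ = ρ → logLik ν x y (φ + δ) ≤ logLik ν x y φ - D)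
    (hδ : δ ∈ modelSpace J) (hle : ρ ≤ ‖δ‖) :
    logLik ν x y (φ + δ) ≤ logLik ν x y φ - D * (‖δ‖ / ρ) := by
  have hδ0 : 0 < ‖δ‖ := hρ.trans_le hle
  -- The point `φ + s • δ` is where the segment from `φ` to `φ + δ` crosses the sphere.
  set s := ρ / ‖δ‖ with hs
  have hs0 : 0 < s := by positivity
  have hs1 : s ≤ 1 := (div_le_one hδ0).2 hle
  have h1 := H (s • δ) (fun j hj => by simp [hδ j hj])
    (by rw [norm_smul, Real.norm_of_nonneg hs0.le, hs]; field_simp)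
  have h2 := (concaveOn_logLik (x := x) (y := y) hν).2 (mem_univ φ) (mem_univ (φ + δ))
    (sub_nonneg.2 hs1) hs0.le (by ring)
  have h3 : (1 - s) • φ + s • (φ + δ) = φ + s • δ := by module
  rw [h3, smul_eq_mul, smul_eq_mul] at h2
  have h4 : s * (logLik ν x y (φ + δ) - logLik ν x y φ) ≤ -D := by linarith
  have h5 : logLik ν x y (φ + δ) - logLik ν x y φ ≤ -D / s := by
    rw [le_div_iff₀ hs0]; linarith
  have h6 : -D / s = -(D * (‖δ‖ / ρ)) := by rw [hs]; field_simp
  linarith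

lemma mem_modelSpace_trueModel (φ : Fin p → ℝ) : φ ∈ modelSpace (trueModel φ) := by
  intro j hj
  by_contra h
  exact hj (by simp [trueModel, h])

lemma sub_mem_modelSpace {J : Finset (Fin p)} {ψ : Fin p → ℝ} (hψ : ψ ∈ modelSpace J) :
    ψ - φ ∈ modelSpace (J ∪ trueModel φ) := by
  intro j hj
  rw [Finset.mem_union, not_or] at hj
  simp [hψ j hj.1, mem_modelSpace_trueModel φ j hj.2]

lemma isClosed_modelSpace (J : Finset (Fin p)) : IsClosed (modelSpace J) := by
  have : modelSpace J = ⋂ j, ⋂ _ : j ∉ J, {φ : Fin p → ℝ | φ j = 0} := by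
    ext; simp [modelSpace]
  rw [this]
  exact isClosed_iInter fun j => isClosed_iInter fun _ =>
    isClosed_eq (continuous_apply j) continuous_const

/-- The linear deficit makes the log-likelihood coercive on the closed set `modelSpace J`: far out
it lies below its value at 0, which belongs to every model. -/
lemma hasMLE_of_linear_deficit (hν : GeneratesExpFamily ν) {J : Finset (Fin p)} {ρ D : ℝ}
    (hρ : 0 < ρ) (hD : 0 < D)
    (H : ∀ δ ∈ modelSpace (J ∪ trueModel φ), ρ ≤ ‖δ‖ →
      logLik ν x y (φ + δ) ≤ logLik ν x y φ - D * (‖δ‖ / ρ)) : HasMLE ν x y J := by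
  refine ContinuousOn.exists_isMaxOn' (continuous_logLik hν).continuousOn (isClosed_modelSpace J)
    (x₀ := 0) (fun j _ => rfl) ?_
  refine Filter.Eventually.filter_mono inf_le_left ?_ |>.and
    (Filter.Eventually.filter_mono inf_le_right (mem_principal_self (modelSpace J))) |>.mono
    (fun ψ h => ?_) (p := fun ψ => ‖φ‖ + max ρ ((logLik ν x y φ - logLik ν x y 0) * ρ / D) ≤ ‖ψ‖ ∧
      ψ ∈ modelSpace J)
  · exact tendsto_norm_cocompact_atTop.eventually_ge_atTop _
  · obtain ⟨h1, h2⟩ := h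
    have h3 : max ρ ((logLik ν x y φ - logLik ν x y 0) * ρ / D) ≤ ‖ψ - φ‖ := by
      have := norm_sub_norm_le ψ φ
      linarith
    have h4 := H _ (sub_mem_modelSpace h2) ((le_max_left _ _).trans h3)
    have h5 := (le_max_right _ _).trans h3
    rw [add_sub_cancel] at h4
    rw [div_le_iff₀ hD] at h5
    have h6 : logLik ν x y φ - logLik ν x y 0 ≤ D * (‖ψ - φ‖ / ρ) := by
      rw [← mul_div_assoc, le_div_iff₀ hρ]; linarith
    linarith

lemma HasMLE.isGreatest {J : Finset (Fin p)} (h : HasMLE ν x y J) :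
    IsGreatest (logLik ν x y '' modelSpace J) (sSup (logLik ν x y '' modelSpace J)) := by
  obtain ⟨ψ, hψ, hmax⟩ := h
  have : IsGreatest (logLik ν x y '' modelSpace J) (logLik ν x y ψ) :=
    ⟨mem_image_of_mem _ hψ, by rintro _ ⟨χ, hχ, rfl⟩; exact hmax hχ⟩
  rwa [this.csSup_eq]

variable {q : ℕ} {M C c : ℝ}

lemma RegularDesign.weight_nonneg (hν : GeneratesExpFamily ν) {F : Fin n → ℝ}
    (hF : ∀ i t, |t - x i ⬝ᵥ φ| ≤ 1 → iteratedDeriv 2 (cumulant ν) t ≤ F i) (i : Fin n) :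
    0 ≤ F i :=
  (iteratedDeriv_two_cumulant_pos hν (x i ⬝ᵥ φ)).le.trans (hF i _ (by simp))

/-- Bounds of the likelihood ratio along the coordinate axes bound the score. -/
lemma RegularDesign.abs_score_le (hν : GeneratesExpFamily ν) (h : RegularDesign ν x φ q M C c)
    {r A : ℝ} (hr : 0 < r) (hMr : M * r ≤ 1)
    (hA : ∀ j, ∀ s : ℝ, |s| = r →
      logLik ν x y (φ + Pi.single j s) - logLik ν x y φ ≤ A) (j : Fin p) :
    |score ν x y φ j| ≤ (A + C * n * r ^ 2 / 2) / r := by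
  obtain ⟨F, hF, hFC⟩ := h.weighted
  -- The log-likelihood ratio at `φ + s e_j` is `s` times the score minus the tangent gap. As `M * r
  -- ≤ 1`, the segment stays in the window where the weights `F` bound the second derivative. Both
  -- signs of `s` give the absolute value.
  have key : ∀ s : ℝ, |s| = r → score ν x y φ j * s ≤ A + C * n * r ^ 2 / 2 := by
    intro s hs
    have h1 := hA j s hs
    rw [logLik_add, dotProduct_single] at h1
    have h2 : tangentGap ν x φ (Pi.single j s) ≤ C * n * r ^ 2 / 2 := by
      calc tangentGap ν x φ (Pi.single j s) ≤ ∑ i, (F i * x i j ^ 2) * (r ^ 2 / 2) := by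
            refine Finset.sum_le_sum fun i _ => ?_
            rw [dotProduct_single]
            have h3 : |x i j * s| ≤ 1 := by
              rw [abs_mul, hs]
              exact (mul_le_mul_of_nonneg_right (h.bounded i j) hr.le).trans hMr
            have h4 := cumulant_add_le hν (θ := x i ⬝ᵥ φ) (h := x i j * s) (F := F i)
              fun t ht => hF i t (ht.trans h3)
            have h5 : F i * x i j ^ 2 * (r ^ 2 / 2) = F i * (x i j * s) ^ 2 / 2 := by
              rw [← hs, sq_abs]; ring
            linarith
        _ = (∑ i, F i * x i j ^ 2) * (r ^ 2 / 2) := by rw [Finset.sum_mul]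
        _ ≤ C * n * (r ^ 2 / 2) := by gcongr; exact hFC j
        _ = _ := by ring
    linarith
  rw [le_div_iff₀ hr]
  rcases abs_cases (score ν x y φ j) with ⟨h1, _⟩ | ⟨h1, _⟩
  · rw [h1]
    exact key r (abs_of_pos hr)
  · rw [h1]
    have := key (-r) (by rw [abs_neg, abs_of_pos hr])
    linarith

/-- On the sphere of radius `R * r` the score contributes a term linear in `R` and the curvature one
quadratic in `R`; `hD` says that their difference leaves the deficit `D`. Norms of parameters are
sup norms, hence the factor `2 * q` for the number of active coordinates. -/
lemma RegularDesign.logLik_add_le (hν : GeneratesExpFamily ν) (h : RegularDesign ν x φ q M C c)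
    {r A R D : ℝ} (hr : 0 < r) (hR : 0 < R) (hMr : M * r ≤ 1) (hMR : M * (2 * q) * (R * r) ≤ 1)
    (hA : ∀ j, ∀ s : ℝ, |s| = r →
      logLik ν x y (φ + Pi.single j s) - logLik ν x y φ ≤ A)
    (hA0 : 0 ≤ A + C * n * r ^ 2 / 2)
    (hD : 2 * q * (A + C * n * r ^ 2 / 2) * R + D ≤ c * n * r ^ 2 * R ^ 2)
    {J : Finset (Fin p)} (hJ : J.card ≤ 2 * q) (hδ : δ ∈ modelSpace J) (hle : R * r ≤ ‖δ‖) :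
    logLik ν x y (φ + δ) ≤ logLik ν x y φ - D * (‖δ‖ / (R * r)) := by
  refine logLik_add_le_of_sphere hν (by positivity) (fun δ hδ hn => ?_) hδ hle
  have h1 := h.curved J hJ δ hδ (by rw [hn]; exact hMR)
  have h2 := abs_dotProduct_le hδ (v := score ν x y φ)
    (M := (A + C * n * r ^ 2 / 2) / r) (by positivity) hJ
    fun j _ => h.abs_score_le hν hr hMr hA j
  rw [hn] at h1 h2
  rw [logLik_add]
  have h3 := (le_abs_self _).trans h2
  have h4 : (A + C * n * r ^ 2 / 2) / r * ((2 * q : ℕ) : ℝ) * (R * r) =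
      2 * q * (A + C * n * r ^ 2 / 2) * R := by
    push_cast
    field_simp
  rw [h4] at h3
  nlinarith

/-- Near `φ` a maximizer can be moved a little at a small cost. -/
lemma RegularDesign.le_logLik_add (hν : GeneratesExpFamily ν) (h : RegularDesign ν x φ q M C c)
    (hM : 0 ≤ M) (hC : 0 ≤ C) {ρ h₀ : ℝ} (hMρ : M * q * (ρ + h₀) ≤ 1) {J : Finset (Fin p)} (hJ : J.card ≤ q)
    {ψ e : Fin p → ℝ} (hmax : IsMaxOn (logLik ν x y) (modelSpace J) ψ) (hψ : ψ ∈ modelSpace J)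
    (hφ : φ ∈ modelSpace J) (he : e ∈ modelSpace J) (hψφ : ‖ψ - φ‖ ≤ ρ) (he0 : ‖e‖ ≤ h₀) :
    logLik ν x y ψ ≤ logLik ν x y (ψ + e) + q ^ 2 * (C * n) * h₀ ^ 2 := by
  obtain ⟨F, hF, hFC⟩ := h.weighted
  have hFn := RegularDesign.weight_nonneg hν hF
  have hme : ψ - e ∈ modelSpace J := fun j hj => by simp [hψ j hj, he j hj]
  have hmd : ψ - φ ∈ modelSpace J := fun j hj => by simp [hψ j hj, hφ j hj]
  -- Maximality at the reflected point `ψ - e` replaces the vanishing of the gradient: it turns a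
  -- bound on the symmetric second difference into a bound on the one-sided loss.
  have h1 : logLik ν x y (ψ - e) ≤ logLik ν x y ψ := hmax hme
  have h2 : 2 * logLik ν x y ψ - (logLik ν x y (ψ + e) + logLik ν x y (ψ - e)) ≤
      ∑ i, F i * (x i ⬝ᵥ e) ^ 2 := by
    simp only [logLik, Finset.mul_sum, ← Finset.sum_add_distrib, ← Finset.sum_sub_distrib]
    refine Finset.sum_le_sum fun i _ => ?_
    have a1 : |x i ⬝ᵥ (ψ - φ)| ≤ M * q * ρ :=
      (abs_dotProduct_le hmd hM hJ fun j _ => h.bounded i j).trans (by gcongr)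
    have a2 : |x i ⬝ᵥ e| ≤ M * q * h₀ :=
      (abs_dotProduct_le he hM hJ fun j _ => h.bounded i j).trans (by gcongr)
    have a3 : ∀ t, |t - x i ⬝ᵥ ψ| ≤ |x i ⬝ᵥ e| → iteratedDeriv 2 (cumulant ν) t ≤ F i := by
      intro t ht
      refine hF i t ?_
      rw [dotProduct_sub] at a1
      have := abs_sub_le t (x i ⬝ᵥ ψ) (x i ⬝ᵥ φ)
      linarith
    have b1 := cumulant_add_le hν (h := x i ⬝ᵥ e) a3
    have b2 := cumulant_add_le hν (θ := x i ⬝ᵥ ψ) (h := -(x i ⬝ᵥ e)) (F := F i)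
      (by rw [abs_neg]; exact a3)
    rw [dotProduct_sub, dotProduct_add, sub_eq_add_neg (x i ⬝ᵥ ψ)]
    linarith
  have h3 : ∑ i, F i * (x i ⬝ᵥ e) ^ 2 ≤ q ^ 2 * (C * n) * h₀ ^ 2 := by
    calc ∑ i, F i * (x i ⬝ᵥ e) ^ 2 ≤ ∑ i, F i * (q * h₀ ^ 2 * ∑ j ∈ J, x i j ^ 2) := by
          gcongr with i
          · exact hFn i
          · refine (sq_dotProduct_le he (x i) hJ).trans ?_
            gcongr
      _ = q * h₀ ^ 2 * ∑ j ∈ J, ∑ i, F i * x i j ^ 2 := by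
          rw [Finset.sum_comm, Finset.mul_sum]
          refine Finset.sum_congr rfl fun i _ => ?_
          rw [Finset.mul_sum, Finset.mul_sum, Finset.mul_sum]
          refine Finset.sum_congr rfl fun j _ => ?_
          ring
      _ ≤ q * h₀ ^ 2 * ∑ j ∈ J, C * n := by
          gcongr with j
          exact hFC j
      _ = q * h₀ ^ 2 * (J.card * (C * n)) := by rw [Finset.sum_const, nsmul_eq_mul]
      _ ≤ q * h₀ ^ 2 * (q * (C * n)) := by
          gcongr
      _ = _ := by ring
  linarith

/-- The grid points of mesh `h` approximate vectors of norm at most `h * (N - 1)`. -/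
lemma exists_grid_approx {J : Finset (Fin p)} (hδ : δ ∈ modelSpace J) {h : ℝ} (hh : 0 < h) {N : ℕ}
    (hN : ‖δ‖ ≤ h * (N - 1)) :
    ∃ z : Fin p → ℤ, (∀ j ∉ J, z j = 0) ∧ (∀ j, |z j| ≤ N) ∧
      ‖(fun j => h * (z j : ℝ)) - δ‖ ≤ h := by
  -- Rounding down may lower a coordinate by one unit, which is why `N - 1` stands in the hypothesis
  -- and `N` in the conclusion.
  refine ⟨fun j => ⌊δ j / h⌋, fun j hj => by simp [hδ j hj], fun j => ?_, ?_⟩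
  · have h1 : |δ j / h| ≤ N - 1 := by
      rw [abs_div, abs_of_pos hh, div_le_iff₀ hh, mul_comm]
      exact (norm_le_pi_norm δ j).trans hN
    rw [abs_le] at h1 ⊢
    have h2 := Int.floor_le (δ j / h)
    have h3 := Int.lt_floor_add_one (δ j / h)
    constructor
    · have : (-(N : ℝ)) < ⌊δ j / h⌋ + 1 := by linarith
      have : (-(N : ℤ)) < ⌊δ j / h⌋ + 1 := by exact_mod_cast this
      exact Int.lt_add_one_iff.1 this
    · have : (⌊δ j / h⌋ : ℝ) ≤ N := by linarith
      exact_mod_cast this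
  · refine (pi_norm_le_iff_of_nonneg hh.le).2 fun j => ?_
    have h2 := Int.floor_le (δ j / h)
    have h3 := Int.lt_floor_add_one (δ j / h)
    rw [le_div_iff₀ hh] at h2
    rw [div_lt_iff₀ hh] at h3
    rw [Pi.sub_apply, Real.norm_eq_abs, abs_le]
    constructor <;> nlinarith

/-- On a regular design, bounds of the likelihood ratio at finitely many parameters entail that the
extended BIC selects the true model with margin `m`. -/
theorem RegularDesign.ebic_add_lt (hν : GeneratesExpFamily ν) (h : RegularDesign ν x φ q M C c)
    (hM : 0 ≤ M) (hC : 0 ≤ C) (hφ : (trueModel φ).card ≤ q)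
    {r A R D η m γ : ℝ} {N : ℕ} {t : ℕ → ℝ}
    (hr : 0 < r) (hR : 0 < R) (hη : 0 < η) (hMr : M * r ≤ 1) (hMR : M * (2 * q) * (R * r) ≤ 1)
    (hMη : M * q * (R * r + η * r) ≤ 1) (hN : R ≤ η * (N - 1)) (hA0 : 0 ≤ A) (hD : 0 < D)
    (hDc : 2 * q * (A + C * n * r ^ 2 / 2) * R + D ≤ c * n * r ^ 2 * R ^ 2)
    (hA : ∀ j, ∀ s : ℝ, |s| = r →
      logLik ν x y (φ + Pi.single j s) - logLik ν x y φ ≤ A)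
    (hmin : ∀ j ∈ trueModel φ, R * r ≤ |φ j|)
    (hfalse : q * |Real.log n + 2 * γ * Real.log p| + m < 2 * D)
    (hgrid : ∀ J : Finset (Fin p), trueModel φ ⊂ J → J.card ≤ q → ∀ z : Fin p → ℤ,
      (∀ j ∉ J, z j = 0) → (∀ j, |z j| ≤ N) →
        logLik ν x y (φ + fun j => η * r * (z j : ℝ)) - logLik ν x y φ ≤
          t (J.card - (trueModel φ).card))
    (htrue : ∀ d : ℕ, 1 ≤ d → d ≤ q → 2 * (t d + q ^ 2 * (C * n) * (η * r) ^ 2) + m <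
      d * (Real.log n + 2 * γ * Real.log p)) :
    (∀ J : Finset (Fin p), J.card ≤ q → HasMLE ν x y J) ∧
      ∀ J : Finset (Fin p), J ≠ trueModel φ → J.card ≤ q →
        ebic ν x y γ (trueModel φ) + m < ebic ν x y γ J := by
  have hfar : ∀ J : Finset (Fin p), J.card ≤ q → ∀ δ ∈ modelSpace (J ∪ trueModel φ),
      R * r ≤ ‖δ‖ → logLik ν x y (φ + δ) ≤ logLik ν x y φ - D * (‖δ‖ / (R * r)) :=
    fun J hJ δ hδ hle => h.logLik_add_le hν hr hR hMr hMR hA (by positivity) hDc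
      ((Finset.card_union_le _ _).trans (by omega)) hδ hle
  have hfar' : ∀ J : Finset (Fin p), J.card ≤ q → ∀ δ ∈ modelSpace (J ∪ trueModel φ),
      R * r ≤ ‖δ‖ → logLik ν x y (φ + δ) ≤ logLik ν x y φ - D := by
    intro J hJ δ hδ hle
    have h1 := hfar J hJ δ hδ hle
    have h2 : 1 ≤ ‖δ‖ / (R * r) := (one_le_div (by positivity)).2 hle
    nlinarith
  have hmle : ∀ J : Finset (Fin p), J.card ≤ q → HasMLE ν x y J := fun J hJ =>
    hasMLE_of_linear_deficit hν (by positivity) hD (hfar J hJ)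
  refine ⟨hmle, fun J hne hJ => ?_⟩
  -- Nothing more is needed about the estimator in the true model than that it does at least as well
  -- as `φ`.
  have hs : logLik ν x y φ ≤ sSup (logLik ν x y '' modelSpace (trueModel φ)) :=
    (hmle _ hφ).isGreatest.2 (mem_image_of_mem _ (mem_modelSpace_trueModel φ))
  obtain ⟨ψ, hψ, hmax⟩ := hmle J hJ
  have hsJ : sSup (logLik ν x y '' modelSpace J) = logLik ν x y ψ :=
    IsGreatest.csSup_eq ⟨mem_image_of_mem _ hψ, by rintro _ ⟨χ, hχ, rfl⟩; exact hmax hχ⟩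
  have hadd : φ + (ψ - φ) = ψ := add_sub_cancel _ _
  simp only [ebic]
  rw [hsJ]
  -- An overfitting model is compared with its nearest grid point, and the penalty outweighs the
  -- gain. A model missing a true covariate stays at distance `R * r` from `φ`, and the deficit
  -- outweighs any gain in penalty.
  by_cases hsub : trueModel φ ⊆ J
  · have hss : trueModel φ ⊂ J := hsub.ssubset_of_ne hne.symm
    have hcard := Finset.card_lt_card hss
    have hφJ : φ ∈ modelSpace J := modelSpace_mono hsub (mem_modelSpace_trueModel φ)
    have hδJ : ψ - φ ∈ modelSpace J := fun j hj => by simp [hψ j hj, hφJ j hj]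
    have hδ : ‖ψ - φ‖ ≤ R * r := by
      by_contra! hlt
      have h1 := hfar' J hJ _ (sub_mem_modelSpace hψ) hlt.le
      rw [hadd] at h1
      have h2 : logLik ν x y φ ≤ logLik ν x y ψ := hmax hφJ
      linarith
    obtain ⟨z, hzJ, hzN, hz⟩ := exists_grid_approx hδJ (h := η * r) (N := N) (by positivity)
      (by nlinarith)
    have h1 := h.le_logLik_add hν hM hC hMη hJ hmax hψ hφJ
      (e := (fun j => η * r * (z j : ℝ)) - (ψ - φ))
      (fun j hj => by simp [hzJ j hj, hψ j hj, hφJ j hj]) hδ hz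
    have h2 : ψ + ((fun j => η * r * (z j : ℝ)) - (ψ - φ)) = φ + fun j => η * r * (z j : ℝ) := by
      ring
    rw [h2] at h1
    have h3 := hgrid J hss hJ z hzJ hzN
    have h4 := htrue (J.card - (trueModel φ).card) (by omega) (by omega)
    rw [Nat.cast_sub hcard.le] at h4
    linarith
  · obtain ⟨j, hj, hjJ⟩ := Finset.not_subset.1 hsub
    have h1 : R * r ≤ ‖ψ - φ‖ := by
      refine (hmin j hj).trans ?_
      have := norm_le_pi_norm (ψ - φ) j
      rwa [Pi.sub_apply, hψ j hjJ, zero_sub, norm_neg] at this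
    have h2 := hfar' J hJ _ (sub_mem_modelSpace hψ) h1
    rw [hadd] at h2
    have h3 : ((trueModel φ).card - J.card : ℝ) * (Real.log n + 2 * γ * Real.log p) ≤
        q * |Real.log n + 2 * γ * Real.log p| := by
      refine (le_abs_self _).trans ?_
      rw [abs_mul]
      refine mul_le_mul_of_nonneg_right ?_ (abs_nonneg _)
      have a1 : ((trueModel φ).card : ℝ) ≤ q := by exact_mod_cast hφ
      have a2 : (J.card : ℝ) ≤ q := by exact_mod_cast hJ
      have a3 : (0 : ℝ) ≤ (trueModel φ).card := by positivity
      have a4 : (0 : ℝ) ≤ J.card := by positivity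
      rw [abs_le]
      constructor <;> linarith
    linarith

end Deterministic

/-! ### The probability of selecting the true model for a fixed sample size -/

section Union

/-- There are at most `p ^ m` subsets of size `m`, so each size contributes at most 1. This makes
the union bound over models cost only a constant once each failure probability carries a factor `p ^
(-d)`. -/
lemma sum_filter_card_le (p q : ℕ) (hp : 1 ≤ p) :
    ∑ D : Finset (Fin p) with D.card ≤ q, ((p : ℝ) ^ D.card)⁻¹ ≤ q + 1 := by
  have hp0 : (0 : ℝ) < p := by exact_mod_cast hp
  have h1 := Finset.sum_powerset_apply_card (x := (Finset.univ : Finset (Fin p)))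
    (fun m => if m ≤ q then ((p : ℝ) ^ m)⁻¹ else 0)
  rw [Finset.powerset_univ] at h1
  rw [Finset.sum_filter, h1, Finset.card_univ, Fintype.card_fin]
  calc ∑ m ∈ Finset.range (p + 1), p.choose m • (if m ≤ q then ((p : ℝ) ^ m)⁻¹ else 0)
      ≤ ∑ m ∈ Finset.range (p + 1), if m ∈ Finset.range (q + 1) then (1 : ℝ) else 0 := by
        refine Finset.sum_le_sum fun m _ => ?_
        by_cases hm : m ≤ q
        · rw [if_pos hm, if_pos (by simpa [Nat.lt_succ_iff] using hm), nsmul_eq_mul,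
            ← div_eq_mul_inv, div_le_one (by positivity)]
          exact_mod_cast Nat.choose_le_pow p m
        · rw [if_neg hm, if_neg (by simpa [Nat.lt_succ_iff] using hm)]
          simp
    _ = ((Finset.range (p + 1)).filter fun m => m ∈ Finset.range (q + 1)).card := by
        rw [Finset.sum_boole]
    _ ≤ ((Finset.range (q + 1)).card : ℝ) := by
        exact_mod_cast Finset.card_le_card fun m hm => (Finset.mem_filter.1 hm).2
    _ = q + 1 := by simp

/-- The integer vectors supported in `J` with entries at most `N`. -/
noncomputable def gridPoints {p : ℕ} (J : Finset (Fin p)) (N : ℕ) : Finset (Fin p → ℤ) :=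
  Fintype.piFinset fun j => if j ∈ J then Finset.Icc (-(N : ℤ)) N else {0}

lemma mem_gridPoints {p : ℕ} {J : Finset (Fin p)} {N : ℕ} {z : Fin p → ℤ}
    (h0 : ∀ j ∉ J, z j = 0) (hN : ∀ j, |z j| ≤ N) : z ∈ gridPoints J N := by
  rw [gridPoints, Fintype.mem_piFinset]
  intro j
  by_cases hj : j ∈ J
  · simpa [hj, ← abs_le] using hN j
  · simp [hj, h0 j hj]

lemma card_gridPoints {p : ℕ} (J : Finset (Fin p)) (N : ℕ) :
    (gridPoints J N).card = (2 * N + 1) ^ J.card := by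
  rw [gridPoints, Fintype.card_piFinset]
  have : ∀ j, (if j ∈ J then Finset.Icc (-(N : ℤ)) N else {0}).card =
      if j ∈ J then 2 * N + 1 else 1 := fun j => by
    split_ifs
    · simp; omega
    · simp
  simp only [this]
  rw [Finset.prod_ite_mem, Finset.univ_inter, Finset.prod_const]

variable {ν : Measure ℝ} {n p : ℕ} {μ : Measure (Fin p → ℝ)} {Ω : Type*} [MeasurableSpace Ω]
  {P : Measure Ω} {φ : Fin p → ℝ} {X : Fin n → Ω → Fin p → ℝ} {Y : Fin n → Ω → ℝ}

/-- The failure probability of selection with margin is controlled by the probability that the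
design is irregular and by union bounds over likelihood ratios. -/
theorem IsGLMSample.measureReal_not_ebic_add_lt [IsProbabilityMeasure P] [IsProbabilityMeasure μ]
    (hν : GeneratesExpFamily ν) (hXY : IsGLMSample P ν μ φ X Y) (hp : 1 ≤ p) {q : ℕ}
    (hφ : (trueModel φ).card ≤ q)
    {M C c r A R D η m γ B : ℝ} {N : ℕ} {t : ℕ → ℝ} (hM : 0 ≤ M) (hC : 0 ≤ C)
    (hr : 0 < r) (hR : 0 < R) (hη : 0 < η) (hMr : M * r ≤ 1) (hMR : M * (2 * q) * (R * r) ≤ 1)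
    (hMη : M * q * (R * r + η * r) ≤ 1) (hN : R ≤ η * (N - 1)) (hA0 : 0 ≤ A) (hD : 0 < D)
    (hDc : 2 * q * (A + C * n * r ^ 2 / 2) * R + D ≤ c * n * r ^ 2 * R ^ 2)
    (hmin : ∀ j ∈ trueModel φ, R * r ≤ |φ j|)
    (hfalse : q * |Real.log n + 2 * γ * Real.log p| + m < 2 * D)
    (htrue : ∀ d : ℕ, 1 ≤ d → d ≤ q → 2 * (t d + q ^ 2 * (C * n) * (η * r) ^ 2) + m <
      d * (Real.log n + 2 * γ * Real.log p))
    (hB : ∀ d : ℕ, 1 ≤ d → d ≤ q → (p : ℝ) ^ d * Real.exp (-t d) ≤ B) :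
    P.real {ω | ¬ ((∀ J : Finset (Fin p), J.card ≤ q →
        HasMLE ν (fun i => X i ω) (fun i => Y i ω) J) ∧
      ∀ J : Finset (Fin p), J ≠ trueModel φ → J.card ≤ q →
        ebic ν (fun i => X i ω) (fun i => Y i ω) γ (trueModel φ) + m <
          ebic ν (fun i => X i ω) (fun i => Y i ω) γ J)} ≤
      P.real {ω | ¬ RegularDesign ν (fun i => X i ω) φ q M C c} + 2 * p * Real.exp (-A) +
        (2 * N + 1) ^ q * (q + 1) * |B| := by
  let ℓ : (Fin p → ℝ) → Ω → ℝ := fun ψ ω =>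
    logLik ν (fun i => X i ω) (fun i => Y i ω) ψ - logLik ν (fun i => X i ω) (fun i => Y i ω) φ
  let S₁ : Set Ω := {ω | ¬ RegularDesign ν (fun i => X i ω) φ q M C c}
  -- The Boolean is the sign of the displacement along a coordinate axis.
  let axis : Fin p × Bool → (Fin p → ℝ) := fun a => φ + Pi.single a.1 (if a.2 then r else -r)
  let S₂ : Set Ω := ⋃ a ∈ (Finset.univ : Finset (Fin p × Bool)), {ω | A ≤ ℓ (axis a) ω}
  let 𝓙 : Finset (Finset (Fin p)) :=
    Finset.univ.filter fun J => trueModel φ ⊂ J ∧ J.card ≤ q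
  let gp : (Fin p → ℤ) → (Fin p → ℝ) := fun z => φ + fun j => η * r * (z j : ℝ)
  let S₃ : Set Ω := ⋃ J ∈ 𝓙, ⋃ z ∈ gridPoints J N,
    {ω | t (J.card - (trueModel φ).card) ≤ ℓ (gp z) ω}
  have htail : ∀ ψ s, P.real {ω | s ≤ ℓ ψ ω} ≤ Real.exp (-s) := fun ψ s =>
    hXY.measureReal_le_logLik_sub hν ψ s
  have hsub : {ω | ¬ ((∀ J : Finset (Fin p), J.card ≤ q →
        HasMLE ν (fun i => X i ω) (fun i => Y i ω) J) ∧
      ∀ J : Finset (Fin p), J ≠ trueModel φ → J.card ≤ q →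
        ebic ν (fun i => X i ω) (fun i => Y i ω) γ (trueModel φ) + m <
          ebic ν (fun i => X i ω) (fun i => Y i ω) γ J)} ⊆ (S₁ ∪ S₂) ∪ S₃ := by
    intro ω hω
    by_contra hnot
    simp only [S₁, S₂, S₃, mem_union, mem_iUnion, not_or, not_exists, mem_ofPred_eq, not_not,
      not_le, Finset.mem_univ, forall_true_left] at hnot
    obtain ⟨⟨h1, h2⟩, h3⟩ := hnot
    refine hω (h1.ebic_add_lt hν hM hC hφ hr hR hη hMr hMR hMη hN hA0 hD hDc (fun j s hs => ?_)
      hmin hfalse (t := t) (fun J hJ hJq z hz hzN => ?_) htrue)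
    · rcases eq_or_eq_neg_of_abs_eq hs with rfl | rfl
      · simpa [ℓ, axis] using (h2 (j, true)).le
      · simpa [ℓ, axis] using (h2 (j, false)).le
    · exact (h3 J (by simp [𝓙, hJ, hJq]) z (mem_gridPoints hz hzN)).le
  have h2 : P.real S₂ ≤ 2 * p * Real.exp (-A) := by
    calc P.real S₂ ≤ ∑ a : Fin p × Bool, P.real {ω | A ≤ ℓ (axis a) ω} :=
          measureReal_biUnion_finset_le _ _
      _ ≤ ∑ _a : Fin p × Bool, Real.exp (-A) := Finset.sum_le_sum fun a _ => htail _ _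
      _ = 2 * p * Real.exp (-A) := by
          simp
          ring
  have hp0 : (0 : ℝ) < p := by exact_mod_cast hp
  have h3 : P.real S₃ ≤ (2 * N + 1) ^ q * (q + 1) * |B| := by
    calc P.real S₃ ≤ ∑ J ∈ 𝓙, P.real (⋃ z ∈ gridPoints J N,
            {ω | t (J.card - (trueModel φ).card) ≤ ℓ (gp z) ω}) :=
          measureReal_biUnion_finset_le _ _
      -- The hypothesis `hB` is vacuous for `q = 0`, so `B` may be negative; `|B|` keeps the
      -- estimate meaningful.
      _ ≤ ∑ J ∈ 𝓙, (2 * N + 1) ^ q * |B| * ((p : ℝ) ^ (J \ trueModel φ).card)⁻¹ := by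
          refine Finset.sum_le_sum fun J hJ => ?_
          obtain ⟨hJ1, hJ2⟩ : trueModel φ ⊂ J ∧ J.card ≤ q := by simpa [𝓙] using hJ
          have hlt := Finset.card_lt_card hJ1
          calc P.real (⋃ z ∈ gridPoints J N,
                {ω | t (J.card - (trueModel φ).card) ≤ ℓ (gp z) ω})
              ≤ ∑ z ∈ gridPoints J N, P.real {ω | t (J.card - (trueModel φ).card) ≤ ℓ (gp z) ω} :=
                measureReal_biUnion_finset_le _ _
            _ ≤ ∑ z ∈ gridPoints J N, Real.exp (-t (J.card - (trueModel φ).card)) :=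
                Finset.sum_le_sum fun z _ => htail _ _
            _ = (2 * N + 1) ^ J.card * Real.exp (-t (J.card - (trueModel φ).card)) := by
                rw [Finset.sum_const, card_gridPoints, nsmul_eq_mul]
                push_cast
                ring
            _ ≤ (2 * N + 1) ^ q * (|B| * ((p : ℝ) ^ (J \ trueModel φ).card)⁻¹) := by
                rw [Finset.card_sdiff_of_subset hJ1.subset]
                have hBd := hB (J.card - (trueModel φ).card) (by omega) (by omega)
                have : (1 : ℝ) ≤ 2 * N + 1 := by
                  have : (0 : ℝ) ≤ N := N.cast_nonneg
                  linarith
                gcongr ?_ * ?_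
                · exact pow_le_pow_right₀ this hJ2
                · rw [← div_eq_mul_inv, le_div_iff₀ (by positivity), mul_comm]
                  exact hBd.trans (le_abs_self B)
            _ = _ := by ring
      _ = (2 * N + 1) ^ q * |B| * ∑ J ∈ 𝓙, ((p : ℝ) ^ (J \ trueModel φ).card)⁻¹ := by
          rw [Finset.mul_sum]
      -- Models containing the true one are determined by their superfluous covariates, so the sum
      -- can be reindexed by `J \ trueModel φ`.
      _ = (2 * N + 1) ^ q * |B| *
            ∑ D' ∈ 𝓙.image (· \ trueModel φ), ((p : ℝ) ^ D'.card)⁻¹ := by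
          rw [Finset.sum_image]
          intro J hJ J' hJ' he
          have e1 : trueModel φ ⊆ J := (by simpa [𝓙] using hJ : trueModel φ ⊂ J ∧ J.card ≤ q).1.subset
          have e2 : trueModel φ ⊆ J' := (by simpa [𝓙] using hJ' : trueModel φ ⊂ J' ∧ J'.card ≤ q).1.subset
          have he' : J \ trueModel φ = J' \ trueModel φ := he
          rw [← Finset.sdiff_union_of_subset e1, he', Finset.sdiff_union_of_subset e2]
      _ ≤ (2 * N + 1) ^ q * |B| *
            ∑ D' : Finset (Fin p) with D'.card ≤ q, ((p : ℝ) ^ D'.card)⁻¹ := by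
          gcongr ?_ * ?_
          refine Finset.sum_le_sum_of_subset_of_nonneg (fun D' hD' => ?_)
            fun _ _ _ => by positivity
          obtain ⟨J, hJ, rfl⟩ := Finset.mem_image.1 hD'
          have : trueModel φ ⊂ J ∧ J.card ≤ q := by simpa [𝓙] using hJ
          simpa using (Finset.card_le_card Finset.sdiff_subset).trans this.2
      _ ≤ (2 * N + 1) ^ q * |B| * (q + 1) := by
          gcongr
          exact sum_filter_card_le p q hp
      _ = _ := by ring
  calc _ ≤ P.real ((S₁ ∪ S₂) ∪ S₃) := measureReal_mono hsub
    _ ≤ P.real S₁ + P.real S₂ + P.real S₃ :=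
        (measureReal_union_le _ _).trans (by gcongr; exact measureReal_union_le _ _)
    _ ≤ _ := by gcongr

end Union

/-! ### Growth of the dimension and the margin -/

section Scalars

variable {p : ℕ → ℕ}

lemma log_natCast_nonneg (n : ℕ) : 0 ≤ Real.log n := Real.log_natCast_nonneg n

lemma eventually_log_le_of_kappa_lt {k : ℝ} (hk : kappa p < ENNReal.ofReal k) :
    ∀ᶠ n : ℕ in atTop, Real.log (p n) ≤ k * Real.log n := by
  have h := eventually_lt_of_limsup_lt hk
  filter_upwards [h, eventually_gt_atTop 1] with n hn h1
  have hl : 0 < Real.log n := Real.log_pos (by exact_mod_cast h1)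
  have h2 := (ENNReal.ofReal_lt_ofReal_iff_of_nonneg
    (div_nonneg (log_natCast_nonneg _) hl.le)).1 hn
  rw [div_lt_iff₀ hl] at h2
  exact h2.le

lemma eventually_le_log_of_lt_kappa (ht : Tendsto (kappaSeq p) atTop (𝓝 (kappa p))) {k : ℝ}
    (hk0 : 0 ≤ k) (hk : ENNReal.ofReal k < kappa p) :
    ∀ᶠ n : ℕ in atTop, k * Real.log n ≤ Real.log (p n) := by
  filter_upwards [ht.eventually_const_lt hk, eventually_gt_atTop 1] with n hn h1
  have hl : 0 < Real.log n := Real.log_pos (by exact_mod_cast h1)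
  have h2 := (ENNReal.ofReal_lt_ofReal_iff_of_nonneg hk0).1 hn
  rw [Real.logb, lt_div_iff₀ hl] at h2
  exact h2.le

lemma invKappa_nonneg (p : ℕ → ℕ) : 0 ≤ invKappa p := ENNReal.toReal_nonneg

/-- A limsup bounds `log p / log n` only from above, and this is all that is available without
convergence. For `κ = ∞` the left side is zero. -/
lemma eventually_invKappa_mul_log_le (h0 : kappa p ≠ 0) {ε : ℝ} (hε : 0 < ε) :
    ∀ᶠ n : ℕ in atTop, invKappa p * Real.log (p n) ≤ (1 + ε) * Real.log n := by
  by_cases ht : kappa p = ⊤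
  · refine Eventually.of_forall fun n => ?_
    have : invKappa p = 0 := by simp [invKappa, ht]
    rw [this, zero_mul]
    exact mul_nonneg (by linarith) (log_natCast_nonneg n)
  · have hk : 0 < (kappa p).toReal := ENNReal.toReal_pos h0 ht
    have hi : invKappa p = (kappa p).toReal⁻¹ := by rw [invKappa, ENNReal.toReal_inv]
    have hlt : kappa p < ENNReal.ofReal ((1 + ε) * (kappa p).toReal) := by
      rw [ENNReal.lt_ofReal_iff_toReal_lt ht]
      nlinarith
    filter_upwards [eventually_log_le_of_kappa_lt hlt] with n hn
    rw [hi]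
    calc (kappa p).toReal⁻¹ * Real.log (p n)
        ≤ (kappa p).toReal⁻¹ * ((1 + ε) * (kappa p).toReal * Real.log n) := by gcongr
      _ = _ := by field_simp

lemma ofReal_inv_lt_kappa (h0 : kappa p ≠ 0) {k : ℝ} (hk : invKappa p < k) :
    ENNReal.ofReal k⁻¹ < kappa p := by
  have hk0 : 0 < k := (invKappa_nonneg p).trans_lt hk
  rw [ENNReal.ofReal_inv_of_pos hk0, ENNReal.inv_lt_iff_inv_lt]
  rwa [ENNReal.lt_ofReal_iff_toReal_lt (by simpa using h0)]

/-- The margin is nonnegative, of order `log (n p)`, and leaves room for the union bound over models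
with one superfluous covariate. -/
theorem AdmissibleScalars.exists_slack {α β γ : ℝ} (h : AdmissibleScalars p α β γ) :
    ∃ δ Cm : ℝ, 0 < δ ∧ 0 ≤ Cm ∧ ∀ᶠ n : ℕ in atTop, 0 ≤ margin p α β γ n ∧
      margin p α β γ n ≤ Cm * (Real.log n + Real.log (p n)) ∧
      (1 - γ + β) * Real.log (p n) + (α - 1 / 2) * Real.log n + margin p α β γ n / 2 ≤
        -δ * (Real.log n + Real.log (p n)) := by
  by_cases h0 : kappa p = 0
  · obtain ⟨-, hα, -⟩ := h.1 h0
    set s := 1 / 2 - α with hs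
    have hs0 : 0 < s := by linarith
    set G := |γ - (1 + β)| with hG
    have hG0 : 0 ≤ G := abs_nonneg _
    -- For `κ = 0` eventually `log p ≤ k log n` for every positive `k`; this choice makes all `log
    -- p` terms at most a quarter of `s log n`.
    set k := s / (4 * (G + 1) + s) with hk
    have hk0 : 0 < k := by positivity
    have hk1 : k ≤ 1 := (div_le_one (by positivity)).2 (by linarith)
    have hGk : G * k ≤ s / 4 := by
      rw [hk, ← mul_div_assoc, div_le_div_iff₀ (by positivity) (by norm_num)]
      nlinarith
    refine ⟨s / 8, G + s, by positivity, by positivity, ?_⟩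
    filter_upwards [eventually_log_le_of_kappa_lt (k := k) (by rw [h0]; simpa using hk0)] with n hn
    have hL1 := log_natCast_nonneg n
    have hL2 := log_natCast_nonneg (p n)
    have e1 : |(γ - (1 + β)) * Real.log (p n)| ≤ s / 4 * Real.log n := by
      rw [abs_mul, abs_of_nonneg hL2]
      calc G * Real.log (p n) ≤ G * (k * Real.log n) := by gcongr
        _ = G * k * Real.log n := by ring
        _ ≤ _ := by gcongr
    have e2 := abs_le.1 e1
    have e3 : Real.log (p n) ≤ Real.log n := hn.trans (by nlinarith)
    have e4 : (γ - (1 + β)) * Real.log (p n) ≤ G * Real.log (p n) :=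
      mul_le_mul_of_nonneg_right (le_abs_self _) hL2
    simp only [margin, h0, if_true]
    rw [← hs]
    have e5 : 0 ≤ s * Real.log n := by positivity
    have e6 : 0 ≤ G * Real.log n := by positivity
    have e7 : 0 ≤ s * Real.log (p n) := by positivity
    have e8 : s * Real.log (p n) ≤ s * Real.log n := by gcongr
    have e9 : α - 1 / 2 = -s := by rw [hs]; ring
    rw [e9]
    refine ⟨by linarith, by linarith, by linarith⟩
  · obtain ⟨hγ, hα⟩ := h.2 h0
    set ι := invKappa p with hι
    have hι0 : 0 ≤ ι := invKappa_nonneg p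
    set ε := γ - (1 - ι / 2 + β + α * ι) with hε
    have hε0 : 0 < ε := by linarith
    set s := 1 / 2 - α with hs
    -- Inserting the definition of `ε` turns the required bound into this one, since `1 - γ + β = s
    -- * ι - ε`.
    suffices H : ∃ δ : ℝ, 0 < δ ∧ ∀ᶠ n : ℕ in atTop,
        s * (ι * Real.log (p n) - Real.log n) - ε / 2 * Real.log (p n) ≤
          -δ * (Real.log n + Real.log (p n)) by
      obtain ⟨δ, hδ, H⟩ := H
      refine ⟨δ, ε, hδ, hε0.le, ?_⟩
      filter_upwards [H] with n hn
      have hL1 := log_natCast_nonneg n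
      have hL2 := log_natCast_nonneg (p n)
      simp only [margin, h0, if_false]
      rw [← hι, ← hε]
      refine ⟨by positivity, by nlinarith, le_trans (le_of_eq ?_) hn⟩
      rw [hε, hs]
      ring
    -- For `s > 0` an upper bound of `ι log p` by nearly `log n` suffices. For `s ≤ 0` the sign
    -- flips and `log p` must be bounded from below, which is where convergence of `κₙ` enters.
    rcases lt_or_ge 0 s with hs0 | hs0
    · set ε' := ε / (16 * s * (ι + 1)) with hε'
      have hε'0 : 0 < ε' := by positivity
      have hsε : s * ε' * (2 * ι) ≤ ε / 8 := by
        rw [hε']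
        have : s * (ε / (16 * s * (ι + 1))) * (2 * ι) = ε / 8 * (ι / (ι + 1)) := by
          field_simp; ring
        rw [this]
        exact mul_le_of_le_one_right (by positivity) ((div_le_one (by positivity)).2 (by linarith))
      set δ := min (s / 2) (ε / (16 * (ι + 1))) with hδ
      have hδ0 : 0 < δ := by positivity
      have hδs : δ ≤ s / 2 := min_le_left _ _
      have hδι : δ * (16 * (ι + 1)) ≤ ε := by
        rw [← le_div_iff₀ (by positivity)]; exact min_le_right _ _
      refine ⟨δ, hδ0, ?_⟩
      filter_upwards [eventually_invKappa_mul_log_le h0 hε'0] with n hn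
      have hL1 := log_natCast_nonneg n
      have hL2 := log_natCast_nonneg (p n)
      rw [← hι] at hn
      generalize Real.log n = L1 at *
      generalize Real.log (p n) = L2 at *
      have hδε : δ ≤ ε / 16 := by nlinarith [mul_nonneg hδ0.le hι0]
      -- Either `log n` dominates and the term in `s` is itself negative of order `log n`, or `log
      -- n` is at most a multiple of `log p` and the term `ε / 2 * log p` pays for everything.
      rcases le_or_gt (ι * L2) (L1 / 2) with hc | hc
      · have e1 : s * (ι * L2 - L1) ≤ s * (-(L1 / 2)) := by gcongr; linarith
        have e2 : δ * L1 ≤ s / 2 * L1 := by gcongr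
        have e3 : δ * L2 ≤ ε / 16 * L2 := by gcongr
        have e4 : 0 ≤ ε * L2 := by positivity
        linarith
      · have e1 : s * (ι * L2 - L1) ≤ s * (ε' * L1) := by gcongr; linarith
        have e2 : (s * ε' + δ) * L1 ≤ (s * ε' + δ) * (2 * ι * L2) := by gcongr; linarith
        have e3 : s * ε' * (2 * ι) * L2 ≤ ε / 8 * L2 := by gcongr
        have e4 : δ * (16 * (ι + 1)) * L2 ≤ ε * L2 := by gcongr
        have e5 : 0 ≤ δ * L2 := by positivity
        have e6 : 0 ≤ ε * L2 := by positivity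
        linarith
    · have ht : Tendsto (kappaSeq p) atTop (𝓝 (kappa p)) := by
        rcases hα with hα | hα
        · linarith
        · exact hα
      set k := ι + ε / (4 * (|s| + 1)) with hk
      have hk0 : 0 < k := by positivity
      have hlt := ofReal_inv_lt_kappa h0 (k := k) (by
        have : 0 < ε / (4 * (|s| + 1)) := by positivity
        linarith)
      have hsk : |s| * (ε / (4 * (|s| + 1))) ≤ ε / 4 := by
        have : |s| * (ε / (4 * (|s| + 1))) = ε / 4 * (|s| / (|s| + 1)) := by
          field_simp
        rw [this]
        exact mul_le_of_le_one_right (by positivity) ((div_le_one (by positivity)).2 (by linarith))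
      refine ⟨ε / (4 * (k + 1)), by positivity, ?_⟩
      filter_upwards [eventually_le_log_of_lt_kappa ht (by positivity) hlt] with n hn
      have hL1 := log_natCast_nonneg n
      have hL2 := log_natCast_nonneg (p n)
      rw [inv_mul_le_iff₀ hk0] at hn
      generalize Real.log n = L1 at *
      generalize Real.log (p n) = L2 at *
      have e1 : s * (ι * L2 - L1) = |s| * (L1 - ι * L2) := by rw [abs_of_nonpos hs0]; ring
      have e2 : |s| * (L1 - ι * L2) ≤ |s| * (ε / (4 * (|s| + 1)) * L2) := by
        gcongr
        rw [hk] at hn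
        linarith
      have e3 : |s| * (ε / (4 * (|s| + 1))) * L2 ≤ ε / 4 * L2 := by gcongr
      have e4 : ε / (4 * (k + 1)) * (L1 + L2) ≤ ε / (4 * (k + 1)) * ((k + 1) * L2) := by
        gcongr; linarith
      have e5 : ε / (4 * (k + 1)) * ((k + 1) * L2) = ε / 4 * L2 := by field_simp
      rw [e1]
      linarith

end Scalars

/-! ### Selection with high probability, given regular designs -/

section Core

/-- All models with at most `q` covariates have a maximum likelihood estimator, and the extended BIC
of `Js` is below that of every other such model by more than `m`. -/
def StrictlySelects {n p : ℕ} (ν : Measure ℝ) (x : Fin n → Fin p → ℝ) (y : Fin n → ℝ)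
    (γ : ℝ) (q : ℕ) (Js : Finset (Fin p)) (m : ℝ) : Prop :=
  (∀ J : Finset (Fin p), J.card ≤ q → HasMLE ν x y J) ∧
    ∀ J : Finset (Fin p), J ≠ Js → J.card ≤ q → ebic ν x y γ Js + m < ebic ν x y γ J

lemma tendsto_const_mul_exp_neg_mul_log {b : ℝ} (hb : 0 < b) (c : ℝ) :
    Tendsto (fun n : ℕ => c * Real.exp (-(b * Real.log n))) atTop (𝓝 0) := by
  have h1 : Tendsto (fun n : ℕ => b * Real.log n) atTop atTop :=
    (Real.tendsto_log_atTop.comp tendsto_natCast_atTop_atTop).const_mul_atTop hb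
  simpa using (Real.tendsto_exp_neg_atTop_nhds_zero.comp h1).const_mul c

lemma rpow_mul_rpow_eq_exp {n p : ℕ} (hn : 0 < n) (hp : 0 < p) (α β : ℝ) :
    (n : ℝ) ^ (-α) * (p : ℝ) ^ (-β) = Real.exp (-(α * Real.log n + β * Real.log p)) := by
  rw [Real.rpow_def_of_pos (by exact_mod_cast hn), Real.rpow_def_of_pos (by exact_mod_cast hp),
    ← Real.exp_add]
  congr 1
  ring

/-- Choice of the localization radius `R`, the deficit `d₀`, the mesh `η` and the size `N` of the
grid. -/
lemma exists_localization_constants (q : ℕ) {a C c δ G : ℝ} (ha : 0 ≤ a) (hC : 0 ≤ C) (hc : 0 < c)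
    (hδ : 0 < δ) (hG : 0 ≤ G) :
    ∃ (R d₀ η : ℝ) (N : ℕ), 0 < R ∧ 0 < η ∧ G < d₀ ∧
      2 * q * (a + C / 2) * R + d₀ ≤ c * R ^ 2 ∧ (q : ℝ) ^ 2 * C * η ^ 2 ≤ δ / 4 ∧
      R ≤ η * (N - 1) := by
  set d₀ : ℝ := G + 1 with hd₀
  have hd₀0 : 0 < d₀ := by positivity
  set U : ℝ := 2 * q * (a + C / 2) + d₀ with hU
  have hU0 : 0 < U := by positivity
  -- Then `U ≤ c * R` and `R ≥ 1`, so the quadratic term dominates the linear one plus `d₀`.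
  set R : ℝ := U / c + 1 with hR
  have hR0 : 0 < R := by positivity
  have hRc : 2 * q * (a + C / 2) * R + d₀ ≤ c * R ^ 2 := by
    have h1 : U ≤ c * R := by
      rw [hR, mul_add, mul_div_cancel₀ _ hc.ne']; linarith
    have h2 : 1 ≤ R := by rw [hR]; linarith [div_pos hU0 hc]
    have h3 : U * R ≤ c * R * R := by gcongr
    have h4 : d₀ ≤ d₀ * R := le_mul_of_one_le_right hd₀0.le h2
    rw [hU] at h3
    nlinarith
  set η : ℝ := Real.sqrt (δ / (4 * ((q : ℝ) ^ 2 * C + 1))) with hη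
  have hη0 : 0 < η := by rw [hη]; positivity
  have hηδ : (q : ℝ) ^ 2 * C * η ^ 2 ≤ δ / 4 := by
    rw [hη, Real.sq_sqrt (by positivity)]
    have : (q : ℝ) ^ 2 * C * (δ / (4 * ((q : ℝ) ^ 2 * C + 1))) =
        δ / 4 * ((q : ℝ) ^ 2 * C / ((q : ℝ) ^ 2 * C + 1)) := by field_simp
    rw [this]
    exact mul_le_of_le_one_right (by positivity) ((div_le_one (by positivity)).2 (by linarith))
  refine ⟨R, d₀, η, ⌈R / η⌉₊ + 1, hR0, hη0, by rw [hd₀]; linarith, hRc, hηδ, ?_⟩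
  have := Nat.le_ceil (R / η)
  rw [div_le_iff₀ hη0] at this
  push_cast
  linarith

/-- The failure probability at the axis points: the summand 2 in the exponent pays for the factor
`p` and leaves a factor `1 / n`, and `8 ≤ n` brings `2 / n` below `1 / 4`. -/
lemma two_mul_mul_exp_le {n p : ℕ} (hn : 8 ≤ n) (hp : 1 ≤ p) (α β : ℝ) :
    2 * p * Real.exp (-((|α| + |β| + 2) * (Real.log n + Real.log p))) ≤
      1 / 4 * Real.exp (-(α * Real.log n + β * Real.log p)) := by
  have hn0 : (0 : ℝ) < n := by exact_mod_cast (by omega : 0 < n)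
  have hp0 : (0 : ℝ) < p := by exact_mod_cast hp
  set L1 := Real.log n with hL1
  set L2 := Real.log p with hL2
  have hL10 : 0 ≤ L1 := log_natCast_nonneg _
  have hL20 : 0 ≤ L2 := log_natCast_nonneg _
  set W := Real.exp (-(α * L1 + β * L2)) with hW
  have hW0 : 0 < W := Real.exp_pos _
  have e1 : (p : ℝ) * Real.exp (-((|α| + |β| + 2) * (L1 + L2))) ≤ Real.exp (-L1) * W := by
    rw [hW, ← Real.exp_add]
    nth_rewrite 1 [← Real.exp_log hp0]
    rw [← Real.exp_add]
    refine Real.exp_le_exp.2 ?_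
    have g1 : α * L1 ≤ |α| * L1 := mul_le_mul_of_nonneg_right (le_abs_self _) hL10
    have g2 : β * L2 ≤ |β| * L2 := mul_le_mul_of_nonneg_right (le_abs_self _) hL20
    have g3 : 0 ≤ |α| * L2 := by positivity
    have g4 : 0 ≤ |β| * L1 := by positivity
    linarith
  have e2 : Real.exp (-L1) ≤ 1 / 8 := by
    rw [Real.exp_neg, hL1, Real.exp_log hn0, one_div]
    exact inv_anti₀ (by norm_num) (by exact_mod_cast hn)
  nlinarith

/-- Selection fails with probability at most the probability of an irregular design plus a
polynomially small term. -/
theorem eventually_measureReal_not_strictlySelects {ν : Measure ℝ} (hν : GeneratesExpFamily ν)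
    {p : ℕ → ℕ} (hp : ∀ n, 1 ≤ p n) {q : ℕ}
    {μ : ∀ n, Measure (Fin (p n) → ℝ)} (hμ : ∀ n, IsProbabilityMeasure (μ n))
    {φ : ∀ n, Fin (p n) → ℝ} {Ω : ℕ → Type*} [∀ n, MeasurableSpace (Ω n)]
    {P : ∀ n, Measure (Ω n)} (hP : ∀ n, IsProbabilityMeasure (P n))
    {X : ∀ n, Fin n → Ω n → Fin (p n) → ℝ} {Y : ∀ n, Fin n → Ω n → ℝ}
    (hXY : ∀ n, IsGLMSample (P n) ν (μ n) (φ n) (X n) (Y n))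
    (hB : SparseRegime q μ φ) {α β γ : ℝ} (hadm : AdmissibleScalars p α β γ)
    {M : ℕ → ℝ} {C c : ℝ} (hM : ∀ n, 0 ≤ M n) (hC : 0 ≤ C) (hc : 0 < c)
    (hMr : Tendsto (fun n : ℕ => M n * Real.sqrt (Real.log (n * p n) / n)) atTop (𝓝 0)) :
    ∀ᶠ n : ℕ in atTop, 1 ≤ (n : ℝ) ^ (-α) * (p n : ℝ) ^ (-β) ∨
      (P n).real {ω | ¬ StrictlySelects ν (fun i => X n i ω) (fun i => Y n i ω) γ q
        (trueModel (φ n)) (margin p α β γ n)} ≤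
      (P n).real {ω | ¬ RegularDesign ν (fun i => X n i ω) (φ n) q (M n) C c} +
        1 / 2 * ((n : ℝ) ^ (-α) * (p n : ℝ) ^ (-β)) := by
  obtain ⟨δ, Cm, hδ, hCm, hslack⟩ := hadm.exists_slack
  set a : ℝ := |α| + |β| + 2 with ha
  have ha0 : 0 < a := by positivity
  obtain ⟨R, d₀, η, N, hR0, hη0, hd₀, hRc, hηδ, hNR⟩ := exists_localization_constants q ha0.le hC hc
    hδ (show 0 ≤ q * (1 + 2 * |γ|) + Cm by positivity)
  have hd₀0 : 0 < d₀ := lt_of_le_of_lt (by positivity) hd₀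
  -- The sum of the constants in the three locality conditions, so that the single inequality `M * r
  -- * κ₀ ≤ 1` implies each of them.
  set κ₀ : ℝ := 1 + 2 * q * R + q * (R + η) with hκ₀
  have hκ₀0 : 0 < κ₀ := by positivity
  have hev : ∀ᶠ n : ℕ in atTop, M n * Real.sqrt (Real.log (n * p n) / n) < 1 / κ₀ :=
    hMr.eventually_lt_const (by positivity)
  have hsmall : ∀ᶠ n : ℕ in atTop,
      ((2 * N + 1) ^ q * (q + 1) : ℝ) * Real.exp (-(δ / 2 * Real.log n)) < 1 / 4 :=
    (tendsto_const_mul_exp_neg_mul_log (by positivity) _).eventually_lt_const (by norm_num)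
  filter_upwards [hslack, hev, hsmall, hB.signal_decay (1 / R) (by positivity),
    eventually_ge_atTop 8] with n hsl hMn hsm hdec hn8
  have hPn := hP n
  have hμn := hμ n
  have hn0 : (0 : ℝ) < n := by exact_mod_cast (by omega : 0 < n)
  have hp0 : (0 : ℝ) < p n := by exact_mod_cast hp n
  rw [rpow_mul_rpow_eq_exp (by omega) (hp n)]
  set L1 := Real.log n with hL1
  set L2 := Real.log (p n) with hL2
  have hL10 : 0 < L1 := Real.log_pos (by exact_mod_cast (by omega : 1 < n))
  have hL20 : 0 ≤ L2 := log_natCast_nonneg _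
  have hΛ : Real.log (n * p n) = L1 + L2 := Real.log_mul hn0.ne' hp0.ne'
  rw [hΛ] at hMn hdec
  set Λ := L1 + L2 with hΛdef
  have hΛ0 : 0 < Λ := by positivity
  set r := Real.sqrt (Λ / n) with hr
  have hr0 : 0 < r := by rw [hr]; positivity
  have hr2 : n * r ^ 2 = Λ := by rw [hr, Real.sq_sqrt (by positivity)]; field_simp
  obtain ⟨hm0, hmC, hE⟩ := hsl
  set m := margin p α β γ n with hm
  -- If the allowed error probability is at least one, nothing has to be shown; otherwise the
  -- positivity is used for `hinc`.
  rcases le_or_gt (α * L1 + β * L2) 0 with htriv | hpos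
  · left
    exact Real.one_le_exp (by linarith)
  right
  have hMr1 : M n * r * κ₀ ≤ 1 := by
    rw [lt_div_iff₀ hκ₀0] at hMn; exact hMn.le
  have hMr0 : 0 ≤ M n * r := mul_nonneg (hM n) hr0.le
  have hq0 : (0 : ℝ) ≤ q := q.cast_nonneg
  have hx1 : 0 ≤ M n * r * (2 * q * R) := by positivity
  have hx2 : 0 ≤ M n * r * (q * (R + η)) := by positivity
  have hexpand : M n * r * κ₀ = M n * r + M n * r * (2 * q * R) + M n * r * (q * (R + η)) := by
    rw [hκ₀]; ring
  -- Half the penalty for `d` superfluous covariates, less half the margin and less `δ / 2 * Λ`.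
  -- Half of this last reserve is spent on the passage to the grid.
  set t : ℕ → ℝ := fun d => (d * (L1 + 2 * γ * L2) - m) / 2 - δ / 2 * Λ with ht
  -- Each further superfluous covariate multiplies the union bound by a factor at most one, so `d =
  -- 1` is the worst case.
  have hinc : (1 - γ) * L2 - L1 / 2 ≤ 0 := by
    have : 0 ≤ δ * Λ := by positivity
    linarith
  have hfail := (hXY n).measureReal_not_ebic_add_lt hν (hp n) (hB.sparsity n)
    (M := M n) (C := C) (c := c) (r := r) (A := a * Λ) (R := R) (D := d₀ * Λ) (η := η) (m := m)
    (γ := γ) (B := Real.exp (-(δ / 2 * Λ) - (α * L1 + β * L2))) (N := N) (t := t)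
    (hM n) hC hr0 hR0 hη0 (by linarith) (by linarith) (by linarith) hNR (by positivity)
    (by positivity)
    (by
      have e1 : 2 * q * (a * Λ + C * n * r ^ 2 / 2) * R + d₀ * Λ =
          (2 * q * (a + C / 2) * R + d₀) * Λ := by rw [mul_assoc C, hr2]; ring
      have e2 : c * n * r ^ 2 * R ^ 2 = c * R ^ 2 * Λ := by rw [mul_assoc c, hr2]; ring
      rw [e1, e2]
      gcongr)
    (fun j hj => by
      have := hdec j hj
      rw [one_div, ← div_eq_inv_mul, le_div_iff₀ hR0] at this
      linarith)
    (by
      have e1 : |L1 + 2 * γ * L2| ≤ (1 + 2 * |γ|) * Λ := by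
        refine (abs_add_le _ _).trans ?_
        rw [abs_mul, abs_mul, abs_of_pos hL10, abs_of_nonneg hL20, abs_two]
        have : 0 ≤ |γ| * L1 := by positivity
        rw [hΛdef]
        linarith
      have e2 : q * |L1 + 2 * γ * L2| ≤ q * ((1 + 2 * |γ|) * Λ) := by gcongr
      have e3 : 0 ≤ q * ((1 + 2 * |γ|) * Λ) := by positivity
      have e4 : 0 ≤ Cm * Λ := by positivity
      have e5 : (q * (1 + 2 * |γ|) + Cm) * Λ < d₀ * Λ := by gcongr
      linarith)
    (fun d _ _ => by
      have e1 : (q : ℝ) ^ 2 * (C * n) * (η * r) ^ 2 = q ^ 2 * C * η ^ 2 * Λ := by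
        rw [← hr2]; ring
      have e2 : (q : ℝ) ^ 2 * C * η ^ 2 * Λ ≤ δ / 4 * Λ := by gcongr
      have e3 : 0 < δ * Λ := by positivity
      rw [e1, ht]
      linarith)
    (fun d hd1 _ => by
      have e0 : (p n : ℝ) ^ d = Real.exp (d * L2) := by
        rw [Real.exp_nat_mul, hL2, Real.exp_log hp0]
      rw [e0, ← Real.exp_add]
      refine Real.exp_le_exp.2 ?_
      have hd1' : (1 : ℝ) ≤ d := by exact_mod_cast hd1
      have e1 : d * ((1 - γ) * L2 - L1 / 2) ≤ 1 * ((1 - γ) * L2 - L1 / 2) :=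
        mul_le_mul_of_nonpos_right hd1' hinc
      rw [ht]
      linarith)
  refine hfail.trans ?_
  set W := Real.exp (-(α * L1 + β * L2)) with hW
  have hW0 : 0 < W := Real.exp_pos _
  have f1 : 2 * p n * Real.exp (-(a * Λ)) ≤ 1 / 4 * W := two_mul_mul_exp_le hn8 (hp n) α β
  have f2 : (2 * N + 1) ^ q * (q + 1) * |Real.exp (-(δ / 2 * Λ) - (α * L1 + β * L2))| ≤
      1 / 4 * W := by
    rw [abs_of_pos (Real.exp_pos _), sub_eq_add_neg, Real.exp_add, ← mul_assoc]
    refine mul_le_mul_of_nonneg_right (le_trans ?_ hsm.le) hW0.le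
    gcongr
    rw [hΛdef]
    linarith
  linarith

end Core

/-! ### Curvature of random designs -/

section Curvature

variable {ν : Measure ℝ} {n p : ℕ} {μ : Measure (Fin p → ℝ)} {Ω : Type*} [MeasurableSpace Ω]
  {P : Measure Ω} {φ : Fin p → ℝ} {X : Fin n → Ω → Fin p → ℝ} {Y : Fin n → Ω → ℝ}

lemma IsGLMSample.integral_comp_X [IsProbabilityMeasure μ] (hν : GeneratesExpFamily ν)
    (h : IsGLMSample P ν μ φ X Y) (i : Fin n) {f : (Fin p → ℝ) → ℝ} (hf : Measurable f) :
    ∫ ω, f (X i ω) ∂P = ∫ x, f x ∂μ := by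
  rw [← h.map_X hν i, integral_map (h.measurable_X i).aemeasurable hf.aestronglyMeasurable]

/-- Hoeffding's inequality for a bounded function of the covariates. -/
lemma IsGLMSample.measureReal_hoeffding [IsProbabilityMeasure P] [IsProbabilityMeasure μ]
    (hν : GeneratesExpFamily ν) (h : IsGLMSample P ν μ φ X Y) {f : (Fin p → ℝ) → ℝ}
    (hf : Measurable f) {B ε : ℝ} (hB : 0 < B) (hε : 0 ≤ ε) (hfB : ∀ x, |f x| ≤ B) :
    P.real {ω | n * ε ≤ |∑ i, f (X i ω) - n * ∫ x, f x ∂μ|} ≤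
      2 * Real.exp (-(n * (ε ^ 2 / (2 * B ^ 2)))) := by
  have one : ∀ g : (Fin p → ℝ) → ℝ, Measurable g → (∀ x, |g x| ≤ B) →
      P.real {ω | n * ε ≤ ∑ i, g (X i ω) - n * ∫ x, g x ∂μ} ≤
        Real.exp (-(n * (ε ^ 2 / (2 * B ^ 2)))) := by
    intro g hg hgB
    have hind : iIndepFun (fun i ω => g (X i ω) - ∫ x, g x ∂μ) P :=
      h.indep_X.comp (fun _ x => g x - ∫ x, g x ∂μ) fun _ => hg.sub_const _
    have hsub : ∀ i ∈ (Finset.univ : Finset (Fin n)),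
        HasSubgaussianMGF (fun ω => g (X i ω) - ∫ x, g x ∂μ) ((‖B - -B‖₊ / 2) ^ 2) P := by
      intro i _
      have := hasSubgaussianMGF_of_mem_Icc (μ := P) (X := fun ω => g (X i ω)) (a := -B) (b := B)
        (hg.comp (h.measurable_X i)).aemeasurable
        (ae_of_all _ fun ω => abs_le.1 (hgB (X i ω)))
      rwa [h.integral_comp_X hν i hg] at this
    have hmain := HasSubgaussianMGF.measure_sum_ge_le_of_iIndepFun hind hsub
      (ε := n * ε) (by positivity)
    have e1 : ∀ ω, ∑ i, (g (X i ω) - ∫ x, g x ∂μ) = ∑ i, g (X i ω) - n * ∫ x, g x ∂μ := by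
      intro ω
      rw [Finset.sum_sub_distrib]
      simp
    simp only [e1] at hmain
    refine hmain.trans (le_of_eq ?_)
    congr 1
    have e2 : ((∑ _i : Fin n, (‖B - -B‖₊ / 2) ^ 2 : NNReal) : ℝ) = n * B ^ 2 := by
      rw [Finset.sum_const, Finset.card_univ, Fintype.card_fin, nsmul_eq_mul]
      push_cast
      rw [sub_neg_eq_add, Real.norm_of_nonneg (by linarith)]
      ring
    rw [e2]
    rcases Nat.eq_zero_or_pos n with rfl | hn
    · simp
    · have : (0 : ℝ) < n := by exact_mod_cast hn
      field_simp
  have hsub : {ω | n * ε ≤ |∑ i, f (X i ω) - n * ∫ x, f x ∂μ|} ⊆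
      {ω | n * ε ≤ ∑ i, f (X i ω) - n * ∫ x, f x ∂μ} ∪
        {ω | n * ε ≤ ∑ i, -f (X i ω) - n * ∫ x, -f x ∂μ} := by
    intro ω hω
    rcases le_abs'.1 (show n * ε ≤ |∑ i, f (X i ω) - n * ∫ x, f x ∂μ| from hω) with h1 | h1
    · right
      show n * ε ≤ ∑ i, -f (X i ω) - n * ∫ x, -f x ∂μ
      rw [Finset.sum_neg_distrib, integral_neg]
      linarith
    · exact Or.inl h1
  have h1 := one f hf hfB
  have h2 := one (fun x => -f x) hf.neg (by simpa using hfB)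
  calc _ ≤ _ := measureReal_mono hsub
    _ ≤ _ := measureReal_union_le _ _
    _ ≤ _ := add_le_add h1 h2
    _ = _ := by ring

open Classical in
/-- The indicator of the event that all covariates in `S` are bounded by `T`. -/
noncomputable def truncInd (S : Finset (Fin p)) (T : ℝ) (x : Fin p → ℝ) : ℝ :=
  if ∀ l ∈ S, |x l| ≤ T then 1 else 0

lemma measurable_truncInd (S : Finset (Fin p)) (T : ℝ) : Measurable (truncInd S T) := by
  classical
  refine Measurable.ite ?_ measurable_const measurable_const
  have : {x : Fin p → ℝ | ∀ l ∈ S, |x l| ≤ T} = ⋂ l ∈ S, {x | |x l| ≤ T} := by ext; simp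
  rw [this]
  exact Finset.measurableSet_biInter _ fun l _ =>
    measurableSet_le (measurable_pi_apply l).abs measurable_const

lemma truncInd_nonneg (S : Finset (Fin p)) (T : ℝ) (x : Fin p → ℝ) : 0 ≤ truncInd S T x := by
  unfold truncInd; split_ifs <;> norm_num

lemma truncInd_le_one (S : Finset (Fin p)) (T : ℝ) (x : Fin p → ℝ) : truncInd S T x ≤ 1 := by
  unfold truncInd; split_ifs <;> norm_num

lemma abs_truncInd_mul_le {S : Finset (Fin p)} {T : ℝ} (x : Fin p → ℝ) {j k : Fin p} (hj : j ∈ S)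
    (hk : k ∈ S) : |truncInd S T x * (x j * x k)| ≤ T ^ 2 := by
  unfold truncInd
  split_ifs with h
  · rw [one_mul, abs_mul, sq]
    exact mul_le_mul (h j hj) (h k hk) (abs_nonneg _) ((abs_nonneg _).trans (h j hj))
  · simpa using sq_nonneg T

lemma integrable_mul_of_pow_four [IsFiniteMeasure μ]
    (hI : ∀ j, Integrable (fun x : Fin p → ℝ => x j ^ 4) μ) (j k : Fin p) :
    Integrable (fun x : Fin p → ℝ => x j * x k) μ := by
  refine (((integrable_const (1 : ℝ)).add (hI j)).add (hI k)).mono' (by fun_prop)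
    (ae_of_all _ fun x => ?_)
  simp only [Pi.add_apply, Real.norm_eq_abs]
  rw [abs_le]
  constructor <;>
    nlinarith [sq_nonneg (x j + x k), sq_nonneg (x j - x k), sq_nonneg (x j ^ 2 - 1),
      sq_nonneg (x k ^ 2 - 1), sq_nonneg (x j ^ 2), sq_nonneg (x k ^ 2)]

lemma sq_dotProduct_eq {J : Finset (Fin p)} {δ : Fin p → ℝ} (hδ : δ ∈ modelSpace J)
    (x : Fin p → ℝ) :
    (x ⬝ᵥ δ) ^ 2 = ∑ j ∈ J, ∑ k ∈ J, δ j * δ k * (x j * x k) := by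
  rw [dotProduct_eq_sum_of_mem hδ, sq, Finset.sum_mul_sum]
  exact Finset.sum_congr rfl fun j _ => Finset.sum_congr rfl fun k _ => by ring

/-- The eigenvalue condition in terms of the sup norm. -/
lemma mul_sq_norm_le_of_posSemidef {J : Finset (Fin p)} {a : ℝ} (ha : 0 ≤ a)
    (h : (secondMoment μ J - a • (1 : Matrix J J ℝ)).PosSemidef) {δ : Fin p → ℝ}
    (hδ : δ ∈ modelSpace J) :
    a * ‖δ‖ ^ 2 ≤ ∑ j ∈ J, ∑ k ∈ J, δ j * δ k * ∫ x, x j * x k ∂μ := by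
  have h1 := h.dotProduct_mulVec_nonneg (fun j : J => δ j)
  have h2 : star (fun j : J => δ j) ⬝ᵥ
      ((secondMoment μ J - a • (1 : Matrix J J ℝ)).mulVec fun j : J => δ j) =
      ∑ j ∈ J, ∑ k ∈ J, δ j * δ k * ∫ x, x j * x k ∂μ - a * ∑ j ∈ J, δ j ^ 2 := by
    rw [Matrix.sub_mulVec, dotProduct_sub, Matrix.smul_mulVec, Matrix.one_mulVec]
    congr 1
    · simp only [dotProduct, Matrix.mulVec, secondMoment, Matrix.of_apply, Finset.mul_sum]
      rw [← Finset.sum_coe_sort J]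
      refine Finset.sum_congr rfl fun j _ => ?_
      rw [← Finset.sum_coe_sort J]
      refine Finset.sum_congr rfl fun k _ => ?_
      simp only [Pi.star_apply, star_trivial]
      ring
    · rw [dotProduct_smul, smul_eq_mul, dotProduct, ← Finset.sum_coe_sort J]
      congr 1
      refine Finset.sum_congr rfl fun j _ => ?_
      simp only [Pi.star_apply, star_trivial]
      ring
  rw [h2] at h1
  -- The eigenvalue condition concerns the Euclidean norm, which dominates the sup norm used here.
  have h3 : ‖δ‖ ^ 2 ≤ ∑ j ∈ J, δ j ^ 2 := by
    have hs : 0 ≤ ∑ j ∈ J, δ j ^ 2 := Finset.sum_nonneg fun _ _ => sq_nonneg _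
    rw [← Real.le_sqrt (norm_nonneg _) hs]
    refine (pi_norm_le_iff_of_nonneg (Real.sqrt_nonneg _)).2 fun j => ?_
    by_cases hj : j ∈ J
    · rw [Real.norm_eq_abs]
      refine Real.abs_le_sqrt ?_
      exact Finset.single_le_sum (f := fun j => δ j ^ 2) (fun _ _ => sq_nonneg _) hj
    · rw [hδ j hj, norm_zero]
      exact Real.sqrt_nonneg _
  nlinarith [mul_le_mul_of_nonneg_left h3 ha]

/-- Truncation preserves half of the second moments if the level is large. -/
lemma truncated_second_moment_ge [IsProbabilityMeasure μ] {J S : Finset (Fin p)} {q : ℕ}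
    (hJ : J.card ≤ 2 * q) (hS : S.card ≤ 3 * q) {a A T : ℝ} (ha : 0 ≤ a) (hT : 0 < T)
    (hI : ∀ j, Integrable (fun x : Fin p → ℝ => x j ^ 4) μ) (hA : ∀ j, ∫ x, x j ^ 4 ∂μ ≤ A)
    (hA0 : 0 ≤ A) (hTA : 48 * q ^ 3 * A ≤ a * T ^ 2)
    (h : (secondMoment μ J - a • (1 : Matrix J J ℝ)).PosSemidef) {δ : Fin p → ℝ}
    (hδ : δ ∈ modelSpace J) :
    a / 2 * ‖δ‖ ^ 2 ≤ ∑ j ∈ J, ∑ k ∈ J, δ j * δ k * ∫ x, truncInd S T x * (x j * x k) ∂μ := by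
  have hint := integrable_mul_of_pow_four hI
  have hintT : ∀ j k, Integrable (fun x => truncInd S T x * (x j * x k)) μ := fun j k =>
    (hint j k).bdd_mul (c := 1) (measurable_truncInd S T).aestronglyMeasurable
      (ae_of_all _ fun x => by
        rw [Real.norm_of_nonneg (truncInd_nonneg S T x)]; exact truncInd_le_one S T x)
  have e1 : ∑ j ∈ J, ∑ k ∈ J, δ j * δ k * ∫ x, x j * x k ∂μ = ∫ x, (x ⬝ᵥ δ) ^ 2 ∂μ := by
    simp_rw [sq_dotProduct_eq hδ]
    rw [integral_finsetSum _ fun j _ => integrable_finsetSum _ fun k _ => (hint j k).const_mul _]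
    refine Finset.sum_congr rfl fun j _ => ?_
    rw [integral_finsetSum _ fun k _ => (hint j k).const_mul _]
    exact Finset.sum_congr rfl fun k _ => (integral_const_mul _ _).symm
  have hexp : ∀ x, truncInd S T x * (x ⬝ᵥ δ) ^ 2 =
      ∑ j ∈ J, ∑ k ∈ J, δ j * δ k * (truncInd S T x * (x j * x k)) := fun x => by
    rw [sq_dotProduct_eq hδ, Finset.mul_sum]
    refine Finset.sum_congr rfl fun j _ => ?_
    rw [Finset.mul_sum]
    exact Finset.sum_congr rfl fun k _ => by ring
  have hintTd : Integrable (fun x => truncInd S T x * (x ⬝ᵥ δ) ^ 2) μ := by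
    simp_rw [hexp]
    exact integrable_finsetSum _ fun j _ => integrable_finsetSum _ fun k _ => (hintT j k).const_mul _
  have e2 : ∑ j ∈ J, ∑ k ∈ J, δ j * δ k * ∫ x, truncInd S T x * (x j * x k) ∂μ =
      ∫ x, truncInd S T x * (x ⬝ᵥ δ) ^ 2 ∂μ := by
    simp_rw [hexp]
    rw [integral_finsetSum _ fun j _ => integrable_finsetSum _ fun k _ => (hintT j k).const_mul _]
    refine Finset.sum_congr rfl fun j _ => ?_
    rw [integral_finsetSum _ fun k _ => (hintT j k).const_mul _]
    exact Finset.sum_congr rfl fun k _ => (integral_const_mul _ _).symm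
  -- Where truncation discards `x`, some `|x l|` exceeds `T`, so `T² x_j² ≤ x_l² x_j² ≤ x_j⁴ +
  -- x_l⁴`. Hence fourth moments control the loss, which is of order `T ^ (-2)`.
  let g : (Fin p → ℝ) → ℝ := fun x => ∑ j ∈ J, ∑ l ∈ S, (x j ^ 4 + x l ^ 4)
  have hI2 : ∀ j l, Integrable (fun x : Fin p → ℝ => x j ^ 4 + x l ^ 4) μ := fun j l =>
    (hI j).add (hI l)
  have hg : Integrable g μ :=
    integrable_finsetSum _ fun j _ => integrable_finsetSum _ fun l _ => hI2 j l
  have hgA : ∫ x, g x ∂μ ≤ 12 * q ^ 2 * A := by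
    calc ∫ x, g x ∂μ = ∑ j ∈ J, ∑ l ∈ S, (∫ x, x j ^ 4 ∂μ + ∫ x, x l ^ 4 ∂μ) := by
          rw [integral_finsetSum _ fun j _ => integrable_finsetSum _ fun l _ => hI2 j l]
          refine Finset.sum_congr rfl fun j _ => ?_
          rw [integral_finsetSum _ fun l _ => hI2 j l]
          exact Finset.sum_congr rfl fun l _ => integral_add (hI j) (hI l)
      _ ≤ ∑ j ∈ J, ∑ l ∈ S, (A + A) := by
          gcongr with j _ l
          · exact hA j
          · exact hA l
      _ = J.card * (S.card * (A + A)) := by simp [Finset.sum_const, nsmul_eq_mul]; ring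
      _ ≤ (2 * q : ℕ) * ((3 * q : ℕ) * (A + A)) := by gcongr
      _ = _ := by push_cast; ring
  have hpt : ∀ x, (x ⬝ᵥ δ) ^ 2 ≤
      truncInd S T x * (x ⬝ᵥ δ) ^ 2 + 2 * q * ‖δ‖ ^ 2 / T ^ 2 * g x := by
    intro x
    have hg0 : 0 ≤ g x := Finset.sum_nonneg fun j _ => Finset.sum_nonneg fun l _ => by positivity
    by_cases hx : ∀ l ∈ S, |x l| ≤ T
    · rw [truncInd, if_pos hx, one_mul]
      have : 0 ≤ 2 * q * ‖δ‖ ^ 2 / T ^ 2 * g x := by positivity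
      linarith
    · rw [truncInd, if_neg hx, zero_mul, zero_add]
      push Not at hx
      obtain ⟨l, hl, hlT⟩ := hx
      have hlT2 : T ^ 2 ≤ x l ^ 2 := by
        rw [← sq_abs (x l)]; exact pow_le_pow_left₀ hT.le hlT.le 2
      have a1 := sq_dotProduct_le hδ x hJ
      have a2 : T ^ 2 * ∑ j ∈ J, x j ^ 2 ≤ g x := by
        rw [Finset.mul_sum]
        refine Finset.sum_le_sum fun j _ => ?_
        calc T ^ 2 * x j ^ 2 ≤ x l ^ 2 * x j ^ 2 := by gcongr
          _ ≤ x j ^ 4 + x l ^ 4 := by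
              nlinarith [sq_nonneg (x j ^ 2 - x l ^ 2), sq_nonneg (x j ^ 2), sq_nonneg (x l ^ 2)]
          _ ≤ _ := Finset.single_le_sum (f := fun l => x j ^ 4 + x l ^ 4)
              (fun _ _ => by positivity) hl
      calc (x ⬝ᵥ δ) ^ 2 ≤ (2 * q : ℕ) * ‖δ‖ ^ 2 * ∑ j ∈ J, x j ^ 2 := a1
        _ = 2 * q * ‖δ‖ ^ 2 / T ^ 2 * (T ^ 2 * ∑ j ∈ J, x j ^ 2) := by push_cast; field_simp
        _ ≤ _ := by gcongr
  have hfin := integral_mono (μ := μ) (f := fun x => (x ⬝ᵥ δ) ^ 2)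
    (g := fun x => truncInd S T x * (x ⬝ᵥ δ) ^ 2 + 2 * q * ‖δ‖ ^ 2 / T ^ 2 * g x)
    (by
      simp_rw [sq_dotProduct_eq hδ]
      exact integrable_finsetSum _ fun j _ =>
        integrable_finsetSum _ fun k _ => (hint j k).const_mul _)
    (hintTd.add (hg.const_mul _)) hpt
  rw [integral_add hintTd (hg.const_mul _), integral_const_mul, ← e1, ← e2] at hfin
  have h0 := mul_sq_norm_le_of_posSemidef ha h hδ
  have h5 : 2 * q * ‖δ‖ ^ 2 / T ^ 2 * ∫ x, g x ∂μ ≤ a / 2 * ‖δ‖ ^ 2 := by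
    calc 2 * q * ‖δ‖ ^ 2 / T ^ 2 * ∫ x, g x ∂μ
        ≤ 2 * q * ‖δ‖ ^ 2 / T ^ 2 * (12 * q ^ 2 * A) := by gcongr
      _ = (48 * q ^ 3 * A) * (‖δ‖ ^ 2 / (2 * T ^ 2)) := by field_simp; ring
      _ ≤ (a * T ^ 2) * (‖δ‖ ^ 2 / (2 * T ^ 2)) := by gcongr
      _ = _ := by field_simp
  linarith

end Curvature

/-! ### Curvature from concentration, uniformly over sparse models -/

section CurvatureProbability

lemma norm_le_norm_toLp {p : ℕ} (φ : Fin p → ℝ) : ‖φ‖ ≤ ‖WithLp.toLp 2 φ‖ :=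
  (pi_norm_le_iff_of_nonneg (norm_nonneg _)).2 fun j => PiLp.norm_apply_le (WithLp.toLp 2 φ) j

/-- Concentration of the truncated second moments gives curvature. -/
lemma mul_sq_norm_le_tangentGap {ν : Measure ℝ} (hν : GeneratesExpFamily ν) {n p : ℕ}
    {μ : Measure (Fin p → ℝ)} {x : Fin n → Fin p → ℝ} {φ δ : Fin p → ℝ} {q : ℕ}
    {J : Finset (Fin p)} (hJ : J.card ≤ 2 * q) (hδ : δ ∈ modelSpace J)
    (hφ : (trueModel φ).card ≤ q) {T b m a ε M : ℝ} (hT : 0 < T) (hb : ‖φ‖ ≤ b) (hm : 0 ≤ m)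
    (hmT : ∀ t, |t| ≤ T * q * b + 1 → m ≤ iteratedDeriv 2 (cumulant ν) t) (hM : 0 ≤ M)
    (hMx : ∀ i j, |x i j| ≤ M) (hMδ : M * (2 * q) * ‖δ‖ ≤ 1) (hε : ε * (2 * q) ^ 2 ≤ a / 4)
    (hε0 : 0 ≤ ε)
    (hmom : a / 2 * ‖δ‖ ^ 2 ≤ ∑ j ∈ J, ∑ k ∈ J,
      δ j * δ k * ∫ x, truncInd (J ∪ trueModel φ) T x * (x j * x k) ∂μ)
    (hconc : ∀ j ∈ J, ∀ k ∈ J,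
      |∑ i, truncInd (J ∪ trueModel φ) T (x i) * (x i j * x i k) -
        n * ∫ x, truncInd (J ∪ trueModel φ) T x * (x j * x k) ∂μ| ≤ n * ε) :
    m * a / 8 * n * ‖δ‖ ^ 2 ≤ tangentGap ν x φ δ := by
  set S := J ∪ trueModel φ with hS
  -- Observations outside the truncation are dropped: their tangent gap is nonnegative by convexity.
  -- For the others `x ⬝ᵥ φ` is bounded as well, because the truncation set contains the true model,
  -- so the second derivative is at least `m`.
  have h1 : ∑ i, m / 2 * (truncInd S T (x i) * (x i ⬝ᵥ δ) ^ 2) ≤ tangentGap ν x φ δ := by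
    refine Finset.sum_le_sum fun i _ => ?_
    by_cases hi : ∀ l ∈ S, |x i l| ≤ T
    · rw [truncInd, if_pos hi, one_mul]
      have a1 : |x i ⬝ᵥ φ| ≤ T * q * b :=
        (abs_dotProduct_le (mem_modelSpace_trueModel φ) hT.le hφ
          fun j hj => hi j (Finset.mem_union_right _ hj)).trans (by gcongr)
      have a2 : |x i ⬝ᵥ δ| ≤ 1 :=
        (abs_dotProduct_le hδ hM hJ fun j _ => hMx i j).trans (by push_cast; exact hMδ)
      have a3 := le_cumulant_add hν (θ := x i ⬝ᵥ φ) (h := x i ⬝ᵥ δ) (m := m) fun t ht => hmT t (by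
        have := abs_sub_abs_le_abs_sub t (x i ⬝ᵥ φ)
        linarith)
      linarith
    · rw [truncInd, if_neg hi, zero_mul, mul_zero]
      have := cumulant_tangent_le hν (x i ⬝ᵥ φ) (x i ⬝ᵥ δ)
      linarith
  have h2 : ∑ i, truncInd S T (x i) * (x i ⬝ᵥ δ) ^ 2 =
      ∑ j ∈ J, ∑ k ∈ J, δ j * δ k * ∑ i, truncInd S T (x i) * (x i j * x i k) := by
    have : ∀ i, truncInd S T (x i) * (x i ⬝ᵥ δ) ^ 2 =
        ∑ j ∈ J, ∑ k ∈ J, δ j * δ k * (truncInd S T (x i) * (x i j * x i k)) := fun i => by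
      rw [sq_dotProduct_eq hδ, Finset.mul_sum]
      refine Finset.sum_congr rfl fun j _ => ?_
      rw [Finset.mul_sum]
      exact Finset.sum_congr rfl fun k _ => by ring
    simp_rw [this]
    rw [Finset.sum_comm]
    refine Finset.sum_congr rfl fun j _ => ?_
    rw [Finset.sum_comm]
    exact Finset.sum_congr rfl fun k _ => (Finset.mul_sum _ _ _).symm
  -- Of the curvature `a / 2` left by truncation, the fluctuations of at most `(2 * q) ^ 2` matrix
  -- entries consume at most `a / 4`.
  have h3 : n * (a / 4 * ‖δ‖ ^ 2) ≤ ∑ i, truncInd S T (x i) * (x i ⬝ᵥ δ) ^ 2 := by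
    have b1 : ∑ j ∈ J, ∑ k ∈ J, (δ j * δ k * (n * ∫ x, truncInd S T x * (x j * x k) ∂μ) -
        ‖δ‖ ^ 2 * (n * ε)) ≤ ∑ i, truncInd S T (x i) * (x i ⬝ᵥ δ) ^ 2 := by
      rw [h2]
      refine Finset.sum_le_sum fun j hj => Finset.sum_le_sum fun k hk => ?_
      have c1 := hconc j hj k hk
      have c2 : |δ j * δ k * (∑ i, truncInd S T (x i) * (x i j * x i k) -
          n * ∫ x, truncInd S T x * (x j * x k) ∂μ)| ≤ ‖δ‖ ^ 2 * (n * ε) := by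
        rw [abs_mul, abs_mul, sq]
        gcongr
        · exact norm_le_pi_norm δ j
        · exact norm_le_pi_norm δ k
      have := (abs_le.1 c2).1
      linarith
    have b2 : ∑ j ∈ J, ∑ k ∈ J, (δ j * δ k * (n * ∫ x, truncInd S T x * (x j * x k) ∂μ) -
        ‖δ‖ ^ 2 * (n * ε)) =
        n * (∑ j ∈ J, ∑ k ∈ J, δ j * δ k * ∫ x, truncInd S T x * (x j * x k) ∂μ) -
        J.card * (J.card * (‖δ‖ ^ 2 * (n * ε))) := by
      simp only [Finset.sum_sub_distrib, Finset.sum_const, nsmul_eq_mul, Finset.mul_sum]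
      congr 1
      exact Finset.sum_congr rfl fun j _ => Finset.sum_congr rfl fun k _ => by ring
    rw [b2] at b1
    have b3 : (J.card : ℝ) * (J.card * (‖δ‖ ^ 2 * (n * ε))) ≤
        (2 * q : ℕ) * ((2 * q : ℕ) * (‖δ‖ ^ 2 * (n * ε))) := by gcongr
    have b4 : ((2 * q : ℕ) : ℝ) * ((2 * q : ℕ) * (‖δ‖ ^ 2 * (n * ε))) ≤
        n * (a / 4 * ‖δ‖ ^ 2) := by
      have : n * ‖δ‖ ^ 2 * (ε * (2 * q) ^ 2) ≤ n * ‖δ‖ ^ 2 * (a / 4) := by gcongr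
      push_cast
      linarith
    have b5 : (n : ℝ) * (a / 2 * ‖δ‖ ^ 2) ≤
        n * (∑ j ∈ J, ∑ k ∈ J, δ j * δ k * ∫ x, truncInd S T x * (x j * x k) ∂μ) := by gcongr
    linarith
  rw [← Finset.mul_sum] at h1
  have h4 : m / 2 * (n * (a / 4 * ‖δ‖ ^ 2)) ≤
      m / 2 * ∑ i, truncInd S T (x i) * (x i ⬝ᵥ δ) ^ 2 := by gcongr
  linarith

lemma card_filter_card_le (p q : ℕ) (hp : 1 ≤ p) :
    ((Finset.univ.filter fun D : Finset (Fin p) => D.card ≤ q).card : ℝ) ≤ p ^ q * (q + 1) := by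
  have hp1 : (1 : ℝ) ≤ p := by exact_mod_cast hp
  calc ((Finset.univ.filter fun D : Finset (Fin p) => D.card ≤ q).card : ℝ)
      = ∑ D : Finset (Fin p) with D.card ≤ q, (1 : ℝ) := by simp
    _ ≤ ∑ D : Finset (Fin p) with D.card ≤ q, (p : ℝ) ^ q * ((p : ℝ) ^ D.card)⁻¹ := by
        refine Finset.sum_le_sum fun D hD => ?_
        rw [← div_eq_mul_inv, one_le_div (by positivity)]
        exact pow_le_pow_right₀ hp1 (by simpa using hD)
    _ = p ^ q * ∑ D : Finset (Fin p) with D.card ≤ q, ((p : ℝ) ^ D.card)⁻¹ := by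
        rw [Finset.mul_sum]
    _ ≤ _ := by gcongr; exact sum_filter_card_le p q hp

/-- Simultaneous concentration of the truncated second moments. -/
lemma IsGLMSample.measureReal_not_concentrated {ν : Measure ℝ} {n p : ℕ}
    {μ : Measure (Fin p → ℝ)} {Ω : Type*} [MeasurableSpace Ω] {P : Measure Ω} {φ : Fin p → ℝ}
    {X : Fin n → Ω → Fin p → ℝ} {Y : Fin n → Ω → ℝ} [IsProbabilityMeasure P]
    [IsProbabilityMeasure μ] (hν : GeneratesExpFamily ν) (h : IsGLMSample P ν μ φ X Y)
    (hp : 1 ≤ p) (k : ℕ) {T ε : ℝ} (hT : 0 < T) (hε : 0 ≤ ε) :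
    P.real {ω | ∃ J : Finset (Fin p), J.card ≤ k ∧ ∃ j ∈ J, ∃ l ∈ J,
      n * ε < |∑ i, truncInd (J ∪ trueModel φ) T (X i ω) * (X i ω j * X i ω l) -
        n * ∫ x, truncInd (J ∪ trueModel φ) T x * (x j * x l) ∂μ|} ≤
      2 * k ^ 2 * (k + 1) * (p ^ k * Real.exp (-(n * (ε ^ 2 / (2 * (T ^ 2) ^ 2))))) := by
  set E := Real.exp (-(n * (ε ^ 2 / (2 * (T ^ 2) ^ 2)))) with hE
  have hE0 : 0 ≤ E := Real.exp_nonneg _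
  let A : Finset (Fin p) → Fin p → Fin p → Set Ω := fun J j l =>
    {ω | n * ε ≤ |∑ i, truncInd (J ∪ trueModel φ) T (X i ω) * (X i ω j * X i ω l) -
        n * ∫ x, truncInd (J ∪ trueModel φ) T x * (x j * x l) ∂μ|}
  have hA : ∀ J : Finset (Fin p), ∀ j ∈ J, ∀ l ∈ J, P.real (A J j l) ≤ 2 * E :=
    fun J j hj l hl => h.measureReal_hoeffding hν
      (f := fun x => truncInd (J ∪ trueModel φ) T x * (x j * x l))
      ((measurable_truncInd _ T).mul (by fun_prop)) (by positivity) hε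
      fun x => abs_truncInd_mul_le x (Finset.mem_union_left _ hj) (Finset.mem_union_left _ hl)
  let 𝓙 : Finset (Finset (Fin p)) := Finset.univ.filter fun J => J.card ≤ k
  have hsub : {ω | ∃ J : Finset (Fin p), J.card ≤ k ∧ ∃ j ∈ J, ∃ l ∈ J,
      n * ε < |∑ i, truncInd (J ∪ trueModel φ) T (X i ω) * (X i ω j * X i ω l) -
        n * ∫ x, truncInd (J ∪ trueModel φ) T x * (x j * x l) ∂μ|} ⊆
      ⋃ J ∈ 𝓙, ⋃ j ∈ J, ⋃ l ∈ J, A J j l := by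
    rintro ω ⟨J, hJ, j, hj, l, hl, hlt⟩
    simp only [mem_iUnion]
    exact ⟨J, by simpa [𝓙] using hJ, j, hj, l, hl, hlt.le⟩
  calc _ ≤ P.real (⋃ J ∈ 𝓙, ⋃ j ∈ J, ⋃ l ∈ J, A J j l) :=
        measureReal_mono hsub (measure_ne_top _ _)
    _ ≤ ∑ J ∈ 𝓙, P.real (⋃ j ∈ J, ⋃ l ∈ J, A J j l) := measureReal_biUnion_finset_le _ _
    _ ≤ ∑ J ∈ 𝓙, ∑ j ∈ J, ∑ l ∈ J, P.real (A J j l) :=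
        Finset.sum_le_sum fun J _ => (measureReal_biUnion_finset_le _ _).trans
          (Finset.sum_le_sum fun j _ => measureReal_biUnion_finset_le _ _)
    _ ≤ ∑ J ∈ 𝓙, ∑ j ∈ J, ∑ l ∈ J, 2 * E :=
        Finset.sum_le_sum fun J _ => Finset.sum_le_sum fun j hj => Finset.sum_le_sum fun l hl =>
          hA J j hj l hl
    _ = ∑ J ∈ 𝓙, (J.card : ℝ) * (J.card * (2 * E)) := by simp only [Finset.sum_const, nsmul_eq_mul]
    _ ≤ ∑ J ∈ 𝓙, (k : ℝ) * (k * (2 * E)) := by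
        refine Finset.sum_le_sum fun J hJ => ?_
        have : (J.card : ℝ) ≤ k := by exact_mod_cast (by simpa [𝓙] using hJ : J.card ≤ k)
        gcongr
    _ = 𝓙.card * ((k : ℝ) * (k * (2 * E))) := by rw [Finset.sum_const, nsmul_eq_mul]
    _ ≤ (p ^ k * (k + 1)) * ((k : ℝ) * (k * (2 * E))) := by
        gcongr
        exact card_filter_card_le p k hp
    _ = _ := by ring

/-- Positivity and continuity on a compact interval. On the whole line the second derivative may
tend to zero, which is why the curvature argument truncates the covariates. -/
lemma exists_pos_le_iteratedDeriv_two_cumulant {ν : Measure ℝ} (hν : GeneratesExpFamily ν)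
    (u : ℝ) : ∃ m : ℝ, 0 < m ∧ ∀ t, |t| ≤ u → m ≤ iteratedDeriv 2 (cumulant ν) t := by
  rcases lt_or_ge u 0 with hu | hu
  · exact ⟨1, one_pos, fun t ht => absurd (abs_nonneg t) (by linarith)⟩
  · obtain ⟨s, -, hs⟩ := (isCompact_Icc (a := -u) (b := u)).exists_isMinOn
      ⟨0, by simpa using hu⟩ (continuous_iteratedDeriv_cumulant hν 2).continuousOn
    exact ⟨_, iteratedDeriv_two_cumulant_pos hν s, fun t ht => hs (abs_le.1 ht)⟩

/-- Designs with bounded fourth moments have curvature in all sparse directions, up to an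
exponentially small probability. -/
theorem exists_measureReal_not_curved {ν : Measure ℝ} (hν : GeneratesExpFamily ν)
    {p : ℕ → ℕ} (hp : ∀ n, 1 ≤ p n) {q : ℕ}
    {μ : ∀ n, Measure (Fin (p n) → ℝ)} (hμ : ∀ n, IsProbabilityMeasure (μ n))
    {φ : ∀ n, Fin (p n) → ℝ} {Ω : ℕ → Type*} [∀ n, MeasurableSpace (Ω n)]
    {P : ∀ n, Measure (Ω n)} (hP : ∀ n, IsProbabilityMeasure (P n))
    {X : ∀ n, Fin n → Ω n → Fin (p n) → ℝ} {Y : ∀ n, Fin n → Ω n → ℝ}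
    (hXY : ∀ n, IsGLMSample (P n) ν (μ n) (φ n) (X n) (Y n)) (hB : SparseRegime q μ φ)
    {A : ℝ} (hI : ∀ n, ∀ j, Integrable (fun x : Fin (p n) → ℝ => x j ^ 4) (μ n))
    (hA : ∀ n, ∀ j, ∫ x, x j ^ 4 ∂(μ n) ≤ A) :
    ∃ c c₁ : ℝ, 0 < c ∧ 0 < c₁ ∧ ∀ n : ℕ, ∀ M : ℝ, 0 ≤ M →
      (P n).real {ω | (∀ i j, |X n i ω j| ≤ M) ∧
        ¬ ∀ J : Finset (Fin (p n)), J.card ≤ 2 * q → ∀ δ ∈ modelSpace J, M * (2 * q) * ‖δ‖ ≤ 1 →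
          c * n * ‖δ‖ ^ 2 ≤ tangentGap ν (fun i => X n i ω) (φ n) δ} ≤
        2 * (2 * q : ℕ) ^ 2 * ((2 * q : ℕ) + 1) * ((p n : ℝ) ^ (2 * q) * Real.exp (-(n * c₁))) := by
  obtain ⟨a, _, ha, _, hev⟩ := hB.eigenvalues
  obtain ⟨b, hb, hφb⟩ := hB.signal_bounded
  have hA0 : 0 ≤ A := (integral_nonneg fun x => by positivity).trans (hA 0 ⟨0, hp 0⟩)
  -- The level depends only on `q`, the moment bound and the eigenvalue bound. Therefore `c` and
  -- `c₁` depend neither on `n` nor on `M`.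
  set T : ℝ := Real.sqrt (48 * q ^ 3 * A / a) + 1 with hT
  have hT0 : 0 < T := by positivity
  have hTA : 48 * q ^ 3 * A ≤ a * T ^ 2 := by
    have h1 := Real.sq_sqrt (show 0 ≤ 48 * (q : ℝ) ^ 3 * A / a by positivity)
    have h2 := Real.sqrt_nonneg (48 * (q : ℝ) ^ 3 * A / a)
    have h3 : 48 * (q : ℝ) ^ 3 * A / a ≤ T ^ 2 := by rw [hT]; nlinarith
    rw [div_le_iff₀ ha] at h3
    linarith
  obtain ⟨m, hm, hmT⟩ := exists_pos_le_iteratedDeriv_two_cumulant hν (T * q * b + 1)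
  set ε : ℝ := a / (4 * ((2 * q) ^ 2 + 1)) with hε
  have hε0 : 0 < ε := by positivity
  have hεa : ε * (2 * q) ^ 2 ≤ a / 4 := by
    have : ε * (2 * q) ^ 2 = a / 4 * ((2 * q) ^ 2 / ((2 * q) ^ 2 + 1)) := by
      rw [hε]; field_simp
    rw [this]
    exact mul_le_of_le_one_right (by positivity) ((div_le_one (by positivity)).2 (by linarith))
  refine ⟨m * a / 8, ε ^ 2 / (2 * (T ^ 2) ^ 2), by positivity, by positivity, fun n M hM => ?_⟩
  have hPn := hP n
  have hμn := hμ n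
  refine le_trans (measureReal_mono ?_)
    ((hXY n).measureReal_not_concentrated hν (hp n) (2 * q) hT0 hε0.le)
  rintro ω ⟨h1, h2⟩
  push Not at h2
  obtain ⟨J, hJ, δ, hδ, hMδ, hlt⟩ := h2
  by_contra hnot
  refine hlt.not_ge (mul_sq_norm_le_tangentGap hν (μ := μ n) hJ hδ (hB.sparsity n) hT0
    ((norm_le_norm_toLp _).trans (hφb n)) hm.le hmT hM h1 hMδ hεa hε0.le ?_ fun j hj k hk => ?_)
  · exact truncated_second_moment_ge hJ ((Finset.card_union_le _ _).trans (by
      have := hB.sparsity n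
      omega)) ha.le hT0 (hI n) (hA n) hA0 hTA (hev n J hJ).1 hδ
  · by_contra hlt'
    exact hnot ⟨J, hJ, j, hj, k, hk, not_le.1 hlt'⟩

end CurvatureProbability

/-! ### Weights of random designs -/

section Weights

/-- The supremum of the third derivative of the cumulant function, in absolute value, over
`[-u, u]`. -/
noncomputable def thirdSup (ν : Measure ℝ) (u : ℝ) : ℝ :=
  sSup ((fun s => |iteratedDeriv 3 (cumulant ν) s|) '' Icc (-u) u)

variable {ν : Measure ℝ}

lemma bddAbove_third (hν : GeneratesExpFamily ν) (u : ℝ) :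
    BddAbove ((fun s => |iteratedDeriv 3 (cumulant ν) s|) '' Icc (-u) u) :=
  (isCompact_Icc.image (continuous_iteratedDeriv_cumulant hν 3).abs).bddAbove

lemma abs_third_le_thirdSup (hν : GeneratesExpFamily ν) {s u : ℝ} (h : |s| ≤ u) :
    |iteratedDeriv 3 (cumulant ν) s| ≤ thirdSup ν u :=
  le_csSup (bddAbove_third hν u) (mem_image_of_mem _ (abs_le.1 h))

lemma thirdSup_nonneg (ν : Measure ℝ) (u : ℝ) : 0 ≤ thirdSup ν u :=
  Real.sSup_nonneg (by rintro _ ⟨s, -, rfl⟩; exact abs_nonneg _)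

lemma monotone_thirdSup (hν : GeneratesExpFamily ν) : Monotone (thirdSup ν) := by
  intro u v huv
  refine Real.sSup_le ?_ (thirdSup_nonneg ν v)
  rintro _ ⟨s, hs, rfl⟩
  exact abs_third_le_thirdSup hν ((abs_le.2 hs).trans huv)

lemma exists_thirdSup_eq (hν : GeneratesExpFamily ν) {u : ℝ} (hu : 0 ≤ u) :
    ∃ s, |s| ≤ u ∧ thirdSup ν u = |iteratedDeriv 3 (cumulant ν) s| := by
  obtain ⟨s, hs, h⟩ := (isCompact_Icc (a := -u) (b := u)).exists_sSup_image_eq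
    ⟨0, by simpa using hu⟩ (continuous_iteratedDeriv_cumulant hν 3).abs.continuousOn
  exact ⟨s, abs_le.2 hs, h⟩

lemma iteratedDeriv_two_le_thirdSup (hν : GeneratesExpFamily ν) {t u : ℝ} (h : |t| ≤ u) :
    iteratedDeriv 2 (cumulant ν) t ≤ iteratedDeriv 2 (cumulant ν) 0 + u * thirdSup ν u :=
  iteratedDeriv_two_cumulant_le hν h fun _ hs => abs_third_le_thirdSup hν hs

/-- A bound of the second derivative of the cumulant function near `x ⬝ᵥ φ` in terms of the
covariates in the true model. -/
noncomputable def weight (ν : Measure ℝ) {p : ℕ} (φ : Fin p → ℝ) (t : ℝ) (x : Fin p → ℝ) : ℝ :=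
  iteratedDeriv 2 (cumulant ν) 0 + t * thirdSup ν t +
    ∑ k ∈ trueModel φ, t * |x k| * thirdSup ν (t * |x k|)

/-- If the true covariates are at most 1, then `|t| ≤ u` and the constant part suffices. Otherwise
`|t| ≤ u * |x k|` for the largest of them, and the summand of this `k` suffices. Summing over all
`k` avoids a maximum inside the integral. -/
lemma iteratedDeriv_two_le_weight (hν : GeneratesExpFamily ν) {p q : ℕ} {φ : Fin p → ℝ}
    (hφ : (trueModel φ).card ≤ q) {b : ℝ} (hb : ‖φ‖ ≤ b) {x : Fin p → ℝ} {t : ℝ}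
    (ht : |t - x ⬝ᵥ φ| ≤ 1) :
    iteratedDeriv 2 (cumulant ν) t ≤ weight ν φ (q * b + 1) x := by
  have hb0 : 0 ≤ b := (norm_nonneg _).trans hb
  set u : ℝ := q * b + 1 with hu
  have hu0 : 0 < u := by positivity
  have hterm : ∀ k ∈ trueModel φ, 0 ≤ u * |x k| * thirdSup ν (u * |x k|) := fun k _ =>
    mul_nonneg (by positivity) (thirdSup_nonneg _ _)
  have habs : |t| ≤ |x ⬝ᵥ φ| + 1 := by
    have := abs_sub_abs_le_abs_sub t (x ⬝ᵥ φ)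
    linarith
  have hw : ∀ w, 0 ≤ w → (∀ k ∈ trueModel φ, |x k| ≤ w) → |t| ≤ w * q * b + 1 := fun w hw0 hw =>
    habs.trans (add_le_add_left ((abs_dotProduct_le (mem_modelSpace_trueModel φ) hw0 hφ hw).trans
      (by gcongr)) 1)
  unfold weight
  by_cases hx : ∀ k ∈ trueModel φ, |x k| ≤ 1
  · have h1 : |t| ≤ u := by simpa [hu] using hw 1 zero_le_one hx
    have h2 := iteratedDeriv_two_le_thirdSup hν h1
    have h3 := Finset.sum_nonneg hterm
    linarith
  · push Not at hx
    obtain ⟨k₁, hk₁, hlt⟩ := hx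
    obtain ⟨k, hk, hmax⟩ := (trueModel φ).exists_max_image (fun k => |x k|) ⟨k₁, hk₁⟩
    have hk1 : 1 < |x k| := hlt.trans_le (hmax k₁ hk₁)
    have h1 : |t| ≤ u * |x k| := by
      have := hw |x k| (abs_nonneg _) hmax
      rw [hu]
      linarith
    have h2 := iteratedDeriv_two_le_thirdSup hν h1
    have h3 := Finset.single_le_sum hterm hk
    have h4 := mul_nonneg hu0.le (thirdSup_nonneg ν u)
    linarith

lemma weight_nonneg (hν : GeneratesExpFamily ν) {p : ℕ} (φ : Fin p → ℝ) {t : ℝ} (ht : 0 ≤ t)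
    (x : Fin p → ℝ) : 0 ≤ weight ν φ t x := by
  have h1 := (iteratedDeriv_two_cumulant_pos hν 0).le
  have h2 := mul_nonneg ht (thirdSup_nonneg ν t)
  have h3 : 0 ≤ ∑ k ∈ trueModel φ, t * |x k| * thirdSup ν (t * |x k|) :=
    Finset.sum_nonneg fun k _ => mul_nonneg (by positivity) (thirdSup_nonneg _ _)
  unfold weight
  linarith

lemma measurable_thirdSup_comp (hν : GeneratesExpFamily ν) {p : ℕ} (t : ℝ) (k : Fin p) :
    Measurable fun x : Fin p → ℝ => thirdSup ν (t * |x k|) := by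
  have h : Continuous fun x : Fin p → ℝ => t * |x k| := by fun_prop
  exact (monotone_thirdSup hν).measurable.comp h.measurable

lemma measurable_weight (hν : GeneratesExpFamily ν) {p : ℕ} (φ : Fin p → ℝ) (t : ℝ) :
    Measurable (weight ν φ t) := by
  refine measurable_const.add (Finset.measurable_sum _ fun k _ => ?_)
  have h : Continuous fun x : Fin p → ℝ => t * |x k| := by fun_prop
  exact h.measurable.mul (measurable_thirdSup_comp hν t k)

variable {n p : ℕ} {μ : Measure (Fin p → ℝ)} {Ω : Type*} [MeasurableSpace Ω]
  {P : Measure Ω} {φ : Fin p → ℝ} {X : Fin n → Ω → Fin p → ℝ} {Y : Fin n → Ω → ℝ}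

/-- Markov's inequality and a union bound over the sample. -/
lemma IsGLMSample.measureReal_exists_lt [IsProbabilityMeasure P] [IsProbabilityMeasure μ]
    (hν : GeneratesExpFamily ν) (h : IsGLMSample P ν μ φ X Y) {f : (Fin p → ℝ) → ℝ}
    (hf : Measurable f) (hf0 : ∀ x, 0 ≤ f x) (hI : Integrable f μ) {A v : ℝ} (hA : ∫ x, f x ∂μ ≤ A)
    (hv : 0 < v) : P.real {ω | ∃ i, v < f (X i ω)} ≤ n * (A / v) := by
  have hone : ∀ i, P.real {ω | v ≤ f (X i ω)} ≤ A / v := fun i => by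
    have hIi : Integrable (fun ω => f (X i ω)) P := by
      rw [← h.map_X hν i] at hI
      exact hI.comp_measurable (h.measurable_X i)
    have := mul_meas_ge_le_integral_of_nonneg (ae_of_all _ fun ω => hf0 (X i ω)) hIi v
    rw [h.integral_comp_X hν i hf] at this
    rw [le_div_iff₀ hv, mul_comm]
    exact this.trans hA
  have hsub : {ω | ∃ i, v < f (X i ω)} ⊆ ⋃ i ∈ (Finset.univ : Finset (Fin n)),
      {ω | v ≤ f (X i ω)} := by
    rintro ω ⟨i, hi⟩
    simp only [mem_iUnion]
    exact ⟨i, Finset.mem_univ _, hi.le⟩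
  calc _ ≤ P.real (⋃ i ∈ (Finset.univ : Finset (Fin n)), {ω | v ≤ f (X i ω)}) :=
        measureReal_mono hsub (measure_ne_top _ _)
    _ ≤ ∑ i, P.real {ω | v ≤ f (X i ω)} := measureReal_biUnion_finset_le _ _
    _ ≤ ∑ _i : Fin n, A / v := Finset.sum_le_sum fun i _ => hone i
    _ = _ := by simp

lemma exp_le_one_add_two_mul {t : ℝ} (h0 : 0 ≤ t) (h1 : t ≤ 1) : Real.exp t ≤ 1 + 2 * t := by
  have := (abs_le.1 (Real.abs_exp_sub_one_sub_id_le (x := t) (by rwa [abs_of_nonneg h0]))).2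
  nlinarith

/-- A Chernoff bound for bounded nonnegative functions of the covariates. -/
lemma IsGLMSample.measureReal_chernoff [IsProbabilityMeasure P] [IsProbabilityMeasure μ]
    (hν : GeneratesExpFamily ν) (h : IsGLMSample P ν μ φ X Y) {f : (Fin p → ℝ) → ℝ}
    (hf : Measurable f) {L m : ℝ} (hL : 0 < L) (hf0 : ∀ x, 0 ≤ f x) (hfL : ∀ x, f x ≤ L)
    (hm : ∫ x, f x ∂μ ≤ m) :
    P.real {ω | n * (2 * m + 1) ≤ ∑ i, f (X i ω)} ≤ Real.exp (-(n / L)) := by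
  have hexpm : Measurable fun x => Real.exp (1 / L * f x) := (hf.const_mul _).exp
  have hbd : ∀ x, 0 ≤ 1 / L * f x ∧ 1 / L * f x ≤ 1 := fun x => by
    rw [one_div, inv_mul_le_iff₀ hL, mul_one]
    exact ⟨mul_nonneg (by positivity) (hf0 x), hfL x⟩
  have hfI : Integrable f μ := Integrable.of_mem_Icc 0 L hf.aemeasurable
    (ae_of_all _ fun x => ⟨hf0 x, hfL x⟩)
  -- The exponent parameter `1 / L` keeps the argument of the exponential in `[0, 1]`, where it lies
  -- below `1 + 2t`; this explains `2 * m` in the threshold.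
  have hmgf : ∀ i, mgf (fun ω => f (X i ω)) P (1 / L) ≤ Real.exp (2 * m / L) := fun i => by
    rw [mgf, h.integral_comp_X hν i hexpm]
    calc ∫ x, Real.exp (1 / L * f x) ∂μ ≤ ∫ x, (1 + 2 * (1 / L * f x)) ∂μ := by
          refine integral_mono ?_ ?_ fun x => exp_le_one_add_two_mul (hbd x).1 (hbd x).2
          · exact Integrable.of_mem_Icc 0 (Real.exp 1) hexpm.aemeasurable
              (ae_of_all _ fun x => ⟨Real.exp_nonneg _, Real.exp_le_exp.2 (hbd x).2⟩)
          · exact (integrable_const _).add ((hfI.const_mul _).const_mul _)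
      _ = 1 + 2 * (1 / L * ∫ x, f x ∂μ) := by
          rw [integral_add (integrable_const _) ((hfI.const_mul _).const_mul _),
            integral_const_mul, integral_const_mul]
          simp
      _ ≤ 2 * m / L + 1 := by
          have : 1 / L * ∫ x, f x ∂μ ≤ 1 / L * m := by gcongr
          have e : 2 * m / L = 2 * (1 / L * m) := by ring
          linarith
      _ ≤ _ := Real.add_one_le_exp _
  have hind : iIndepFun (fun i ω => f (X i ω)) P := h.indep_X.comp (fun _ => f) fun _ => hf
  have hfm : ∀ i, Measurable fun ω => f (X i ω) := fun i => hf.comp (h.measurable_X i)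
  have hsum := hind.mgf_sum (t := 1 / L) hfm Finset.univ
  have hch := measure_ge_le_exp_mul_mgf (μ := P) (X := ∑ i, fun ω => f (X i ω)) (t := 1 / L)
    (n * (2 * m + 1)) (by positivity) (by
      refine Integrable.of_mem_Icc 0 (Real.exp n) ?_ (ae_of_all _ fun ω => ⟨Real.exp_nonneg _, ?_⟩)
      · simp only [Finset.sum_apply]
        exact ((Finset.measurable_sum _ fun i _ => hfm i).const_mul _).exp.aemeasurable
      · refine Real.exp_le_exp.2 ?_
        rw [Finset.sum_apply, Finset.mul_sum]
        calc ∑ i, 1 / L * f (X i ω) ≤ ∑ _i : Fin n, (1 : ℝ) :=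
              Finset.sum_le_sum fun i _ => (hbd _).2
          _ = n := by simp)
  rw [hsum] at hch
  simp only [Finset.sum_apply] at hch
  refine hch.trans ?_
  calc Real.exp (-(1 / L) * (n * (2 * m + 1))) * ∏ i, mgf (fun ω => f (X i ω)) P (1 / L)
      ≤ Real.exp (-(1 / L) * (n * (2 * m + 1))) * ∏ _i : Fin n, Real.exp (2 * m / L) := by
        gcongr with i
        · exact fun i _ => mgf_nonneg
        · exact hmgf i
    _ = Real.exp (-(n / L)) := by
        rw [Finset.prod_const, Finset.card_univ, Fintype.card_fin, ← Real.exp_nat_mul,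
          ← Real.exp_add]
        congr 1
        field_simp
        ring

end Weights

/-! ### Weights under moment conditions -/

section Moments

lemma pow_le_one_add_pow {y : ℝ} (hy : 0 ≤ y) {a b : ℕ} (hab : a ≤ b) : y ^ a ≤ 1 + y ^ b := by
  rcases le_or_gt y 1 with h | h
  · have h1 := pow_le_one₀ (n := a) hy h
    have h2 : 0 ≤ y ^ b := by positivity
    linarith
  · have := pow_le_pow_right₀ h.le hab
    linarith

/-- Since `ENNReal.ofReal` sends negative bounds to zero, the real bound is `max A 0`. -/
lemma integrable_and_integral_le_of_lintegral_le {α : Type*} [MeasurableSpace α] {μ : Measure α}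
    {f : α → ℝ} (hf : Measurable f) (hf0 : ∀ x, 0 ≤ f x) {A : ℝ}
    (h : ∫⁻ x, ENNReal.ofReal (f x) ∂μ ≤ ENNReal.ofReal A) :
    Integrable f μ ∧ ∫ x, f x ∂μ ≤ max A 0 := by
  have hI : Integrable f μ := by
    refine ⟨hf.aestronglyMeasurable, ?_⟩
    rw [hasFiniteIntegral_iff_ofReal (ae_of_all _ hf0)]
    exact h.trans_lt ENNReal.ofReal_lt_top
  refine ⟨hI, ?_⟩
  rw [integral_eq_lintegral_of_nonneg_ae (ae_of_all _ hf0) hf.aestronglyMeasurable]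
  refine (ENNReal.toReal_mono ENNReal.ofReal_ne_top h).trans (le_of_eq ?_)
  rw [ENNReal.toReal_ofReal']

/-- Bochner integral form of the moment bounds at scale `t`. -/
structure MomentBounds (ν : Measure ℝ) {p : ℕ} (μ : Measure (Fin p → ℝ)) (K : ℕ) (t A B : ℝ) :
    Prop where
  integrable_pow : ∀ j, Integrable (fun x : Fin p → ℝ => |x j| ^ (6 * K)) μ
  integral_pow_le : ∀ j, ∫ x, |x j| ^ (6 * K) ∂μ ≤ A
  integrable_third : ∀ j, Integrable (fun x : Fin p → ℝ => thirdSup ν (t * |x j|) ^ (2 * K)) μ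
  integral_third_le : ∀ j, ∫ x, thirdSup ν (t * |x j|) ^ (2 * K) ∂μ ≤ B

lemma MomentCovariates.exists_momentBounds {ν : Measure ℝ} (hν : GeneratesExpFamily ν)
    {p : ℕ → ℕ} {μ : ∀ n, Measure (Fin (p n) → ℝ)} {K : ℕ} (h : MomentCovariates ν μ K) {t : ℝ}
    (ht : 0 < t) : ∃ A B : ℝ, 0 ≤ A ∧ 0 ≤ B ∧ ∀ n, MomentBounds ν (μ n) K t A B := by
  obtain ⟨A, hA⟩ := h.moment
  obtain ⟨B, hB⟩ := h.third_deriv t ht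
  refine ⟨max A 0, max B 0, le_max_right _ _, le_max_right _ _, fun n => ?_⟩
  have h1 : ∀ j, Integrable (fun x : Fin (p n) → ℝ => |x j| ^ (6 * K)) (μ n) ∧
      ∫ x, |x j| ^ (6 * K) ∂(μ n) ≤ max A 0 := fun j =>
    integrable_and_integral_le_of_lintegral_le (by fun_prop) (fun x => by positivity) (hA n j)
  have h2 : ∀ j, Integrable (fun x : Fin (p n) → ℝ => thirdSup ν (t * |x j|) ^ (2 * K)) (μ n) ∧
      ∫ x, thirdSup ν (t * |x j|) ^ (2 * K) ∂(μ n) ≤ max B 0 := fun j => by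
    refine integrable_and_integral_le_of_lintegral_le ((measurable_thirdSup_comp hν t j).pow_const _)
      (fun x => pow_nonneg (thirdSup_nonneg _ _) _) ((lintegral_mono fun x => ?_).trans (hB n j))
    obtain ⟨s, hs, he⟩ := exists_thirdSup_eq hν (u := t * |x j|) (by positivity)
    rw [he]
    exact le_iSup₂ (f := fun θ (_ : θ ∈ {θ : ℝ | |θ| ≤ t * |x j|}) =>
      ENNReal.ofReal (|iteratedDeriv 3 (cumulant ν) θ| ^ (2 * K))) s hs
  exact ⟨fun j => (h1 j).1, fun j => (h1 j).2, fun j => (h2 j).1, fun j => (h2 j).2⟩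

variable {ν : Measure ℝ} {n p : ℕ} {μ : Measure (Fin p → ℝ)} {Ω : Type*} [MeasurableSpace Ω]
  {P : Measure Ω} {φ : Fin p → ℝ} {X : Fin n → Ω → Fin p → ℝ} {Y : Fin n → Ω → ℝ}
  {K : ℕ} {t A B : ℝ}

lemma MomentBounds.pow_four [IsProbabilityMeasure μ] (h : MomentBounds ν μ K t A B) (hK : 1 ≤ K)
    (j : Fin p) : Integrable (fun x : Fin p → ℝ => x j ^ 4) μ ∧ ∫ x, x j ^ 4 ∂μ ≤ 1 + A := by
  have hle : ∀ x : Fin p → ℝ, x j ^ 4 ≤ 1 + |x j| ^ (6 * K) := fun x => by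
    have h4 : x j ^ 4 = |x j| ^ 4 := (Even.pow_abs ⟨2, rfl⟩ _).symm
    rw [h4]
    exact pow_le_one_add_pow (abs_nonneg _) (by omega)
  have hdom : Integrable (fun x : Fin p → ℝ => 1 + |x j| ^ (6 * K)) μ :=
    (integrable_const _).add (h.integrable_pow j)
  have hI : Integrable (fun x : Fin p → ℝ => x j ^ 4) μ :=
    hdom.mono' ((measurable_pi_apply j).pow_const 4).aestronglyMeasurable (ae_of_all _ fun x => by
      rw [Real.norm_of_nonneg (by positivity)]; exact hle x)
  refine ⟨hI, (integral_mono hI hdom hle).trans ?_⟩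
  rw [integral_add (integrable_const _) (h.integrable_pow j)]
  have := h.integral_pow_le j
  simpa using this

/-- Young's inequality in the form `v g u² ≤ u⁴ v² + g²` and `u⁴ v² ≤ u⁶ + v⁶` separates the
factors, so sixth moments of the covariates and second moments of the third derivative suffice for
the mean. -/
lemma weight_mul_sq_le (hK : 1 ≤ K) (ht : 0 ≤ t)
    (h0 : 0 ≤ iteratedDeriv 2 (cumulant ν) 0 + t * thirdSup ν t) (x : Fin p → ℝ) (j : Fin p) :
    weight ν φ t x * x j ^ 2 ≤
      (iteratedDeriv 2 (cumulant ν) 0 + t * thirdSup ν t) * (1 + |x j| ^ (6 * K)) +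
        ∑ k ∈ trueModel φ, t * (3 + |x j| ^ (6 * K) + |x k| ^ (6 * K) +
          thirdSup ν (t * |x k|) ^ (2 * K)) := by
  have e2 : x j ^ 2 = |x j| ^ 2 := (sq_abs _).symm
  rw [weight, add_mul, Finset.sum_mul, e2]
  refine add_le_add ?_ (Finset.sum_le_sum fun k _ => ?_)
  · exact mul_le_mul_of_nonneg_left (pow_le_one_add_pow (abs_nonneg _) (by omega)) h0
  · set u := |x j|
    set v := |x k|
    set g := thirdSup ν (t * v)
    have hu : 0 ≤ u := abs_nonneg _
    have hv : 0 ≤ v := abs_nonneg _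
    have hg : 0 ≤ g := thirdSup_nonneg _ _
    have a1 : u ^ 6 ≤ 1 + u ^ (6 * K) := pow_le_one_add_pow hu (by omega)
    have a2 : v ^ 6 ≤ 1 + v ^ (6 * K) := pow_le_one_add_pow hv (by omega)
    have a3 : g ^ 2 ≤ 1 + g ^ (2 * K) := pow_le_one_add_pow hg (by omega)
    have a4 : u ^ 4 * v ^ 2 ≤ u ^ 6 + v ^ 6 := by
      rcases le_total u v with huv | huv
      · have : u ^ 4 * v ^ 2 ≤ v ^ 4 * v ^ 2 := by gcongr
        have h6 : 0 ≤ u ^ 6 := by positivity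
        nlinarith
      · have : u ^ 4 * v ^ 2 ≤ u ^ 4 * u ^ 2 := by gcongr
        have h6 : 0 ≤ v ^ 6 := by positivity
        nlinarith
    have a5 : v * g * u ^ 2 ≤ u ^ 4 * v ^ 2 + g ^ 2 := by
      nlinarith [sq_nonneg (u ^ 2 * v - g), sq_nonneg (u ^ 2 * v), sq_nonneg g]
    calc t * v * g * u ^ 2 = t * (v * g * u ^ 2) := by ring
      _ ≤ _ := by gcongr; linarith

/-- Moment bounds keep the covariates and the weights under control, with a failure probability in
which only the uniform bound of the covariates involves the dimension. -/
theorem IsGLMSample.measureReal_not_weighted [IsProbabilityMeasure P] [IsProbabilityMeasure μ]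
    (hν : GeneratesExpFamily ν) (h : IsGLMSample P ν μ φ X Y) {q : ℕ}
    (hφ : (trueModel φ).card ≤ q) (hmb : MomentBounds ν μ K t A B) (hK : 1 ≤ K) (ht : 0 ≤ t)
    (hA : 0 ≤ A) (hB : 0 ≤ B) {c₀ m C₀ s : ℝ}
    (hc₀ : c₀ = iteratedDeriv 2 (cumulant ν) 0 + t * thirdSup ν t)
    (hm : m = c₀ * (1 + A) + q * (t * (3 + A + A + B))) (hC₀ : C₀ = c₀ + q * t)
    (hs1 : s ≤ 1 / 6) (hn : 1 ≤ n) :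
    P.real {ω | ¬ ((∀ i j, |X i ω j| ≤ (n : ℝ) ^ (1 / 6 + s / 2)) ∧
        ∀ j, ∑ i, weight ν φ t (X i ω) * X i ω j ^ 2 ≤ (2 * m + 1) * n)} ≤
      p * (n * (A / (n : ℝ) ^ (K + 3 * K * s))) + q * (n * (A / (n : ℝ) ^ (K - 6 * K * s))) +
        q * (n * (B / (n : ℝ) ^ (K - 2 * K * s))) + p * Real.exp (-((n : ℝ) ^ s / C₀)) := by
  have hn1 : (1 : ℝ) ≤ n := by exact_mod_cast hn
  have hn0 : (0 : ℝ) < n := by linarith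
  have hc₀pos : 0 < c₀ := by
    have h1 := iteratedDeriv_two_cumulant_pos hν 0
    have h2 := mul_nonneg ht (thirdSup_nonneg ν t)
    rw [hc₀]; linarith
  have hC₀pos : 0 < C₀ := by rw [hC₀]; positivity
  have hpow : ∀ (e : ℝ) (l : ℕ), ((n : ℝ) ^ e) ^ l = (n : ℝ) ^ (e * l) := fun e l => by
    rw [Real.rpow_mul hn0.le, Real.rpow_natCast]
  have hx : ∀ (j : Fin p) (e : ℝ), P.real {ω | ∃ i, (n : ℝ) ^ e < |X i ω j|} ≤
      n * (A / (n : ℝ) ^ (e * (6 * K : ℕ))) := fun j e => by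
    have h1 := h.measureReal_exists_lt hν (f := fun x => |x j| ^ (6 * K)) (by fun_prop)
      (fun x => by positivity) (hmb.integrable_pow j) (hmb.integral_pow_le j)
      (v := (n : ℝ) ^ (e * (6 * K : ℕ))) (by positivity)
    refine (measureReal_mono ?_ (measure_ne_top _ _)).trans h1
    rintro ω ⟨i, hi⟩
    refine ⟨i, ?_⟩
    rw [← hpow]
    exact pow_lt_pow_left₀ hi (by positivity) (by omega)
  have hg : ∀ (j : Fin p) (e : ℝ), P.real {ω | ∃ i, (n : ℝ) ^ e < thirdSup ν (t * |X i ω j|)} ≤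
      n * (B / (n : ℝ) ^ (e * (2 * K : ℕ))) := fun j e => by
    have h1 := h.measureReal_exists_lt hν (f := fun x => thirdSup ν (t * |x j|) ^ (2 * K))
      ((measurable_thirdSup_comp hν t j).pow_const _)
      (fun x => pow_nonneg (thirdSup_nonneg _ _) _) (hmb.integrable_third j)
      (hmb.integral_third_le j) (v := (n : ℝ) ^ (e * (2 * K : ℕ))) (by positivity)
    refine (measureReal_mono ?_ (measure_ne_top _ _)).trans h1
    rintro ω ⟨i, hi⟩
    refine ⟨i, ?_⟩
    rw [← hpow]
    exact pow_lt_pow_left₀ hi (by positivity) (by omega)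
  -- The levels are `n ^ (1/6 + s/2)` for all covariates, `n ^ (1/6 - s)` for the true ones and `n ^
  -- (1/2 - s)` for the third derivatives. They bound a weight by `C₀ n ^ (2/3 - 2s)` and a summand
  -- by `L`, so truncation at `L` changes nothing on the good event and the Chernoff exponent is `n
  -- ^ s / C₀`.
  set L : ℝ := C₀ * (n : ℝ) ^ (1 - s) with hL
  have hL0 : 0 < L := by positivity
  let f : Fin p → (Fin p → ℝ) → ℝ := fun j x => min (weight ν φ t x * x j ^ 2) L
  have hfm : ∀ j, Measurable (f j) := fun j =>
    ((measurable_weight hν φ t).mul (by fun_prop)).min measurable_const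
  have hf0 : ∀ j x, 0 ≤ f j x := fun j x =>
    le_min (mul_nonneg (weight_nonneg hν φ ht x) (sq_nonneg _)) hL0.le
  have hfint : ∀ j, ∫ x, f j x ∂μ ≤ m := fun j => by
    have hI1 : Integrable (fun x : Fin p → ℝ => c₀ * (1 + |x j| ^ (6 * K))) μ :=
      ((integrable_const _).add (hmb.integrable_pow j)).const_mul _
    have hJ1 : Integrable (fun x : Fin p → ℝ => 3 + |x j| ^ (6 * K)) μ :=
      (integrable_const _).add (hmb.integrable_pow j)
    have hJ2 : ∀ k, Integrable (fun x : Fin p → ℝ => 3 + |x j| ^ (6 * K) + |x k| ^ (6 * K)) μ :=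
      fun k => hJ1.add (hmb.integrable_pow k)
    have hI2 : ∀ k, Integrable (fun x : Fin p → ℝ => t * (3 + |x j| ^ (6 * K) +
        |x k| ^ (6 * K) + thirdSup ν (t * |x k|) ^ (2 * K))) μ := fun k =>
      ((hJ2 k).add (hmb.integrable_third k)).const_mul _
    have hI3 : ∀ k, ∫ x, t * (3 + |x j| ^ (6 * K) +
        |x k| ^ (6 * K) + thirdSup ν (t * |x k|) ^ (2 * K)) ∂μ ≤ t * (3 + A + A + B) := fun k => by
      rw [integral_const_mul, integral_add (hJ2 k) (hmb.integrable_third k),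
        integral_add hJ1 (hmb.integrable_pow k),
        integral_add (integrable_const _) (hmb.integrable_pow j)]
      gcongr
      · simp
      · exact hmb.integral_pow_le j
      · exact hmb.integral_pow_le k
      · exact hmb.integral_third_le k
    calc ∫ x, f j x ∂μ ≤ ∫ x, (c₀ * (1 + |x j| ^ (6 * K)) +
          ∑ k ∈ trueModel φ, t * (3 + |x j| ^ (6 * K) + |x k| ^ (6 * K) +
          thirdSup ν (t * |x k|) ^ (2 * K))) ∂μ := by
          refine integral_mono (Integrable.of_mem_Icc 0 L (hfm j).aemeasurable
            (ae_of_all _ fun x => ⟨hf0 j x, min_le_right _ _⟩))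
            (hI1.add (integrable_finsetSum _ fun k _ => hI2 k)) fun x => ?_
          refine (min_le_left _ _).trans ?_
          rw [hc₀]
          exact weight_mul_sq_le hK ht (hc₀ ▸ hc₀pos.le) x j
      _ = c₀ * (1 + ∫ x, |x j| ^ (6 * K) ∂μ) + ∑ k ∈ trueModel φ, ∫ x, t * (3 + |x j| ^ (6 * K) +
          |x k| ^ (6 * K) + thirdSup ν (t * |x k|) ^ (2 * K)) ∂μ := by
          rw [integral_add hI1 (integrable_finsetSum _ fun k _ => hI2 k),
            integral_finsetSum _ fun k _ => hI2 k, integral_const_mul,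
            integral_add (integrable_const _) (hmb.integrable_pow j)]
          simp
      _ ≤ c₀ * (1 + A) + ∑ k ∈ trueModel φ, t * (3 + A + A + B) := by
          gcongr with k
          · exact hmb.integral_pow_le j
          · exact hI3 k
      _ = c₀ * (1 + A) + (trueModel φ).card * (t * (3 + A + A + B)) := by
          rw [Finset.sum_const, nsmul_eq_mul]
      _ ≤ c₀ * (1 + A) + q * (t * (3 + A + A + B)) := by gcongr
      _ = m := hm.symm
  have hch : ∀ j, P.real {ω | n * (2 * m + 1) ≤ ∑ i, f j (X i ω)} ≤
      Real.exp (-((n : ℝ) ^ s / C₀)) := fun j => by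
    refine (h.measureReal_chernoff hν (hfm j) hL0 (hf0 j) (fun x => min_le_right _ _)
      (hfint j)).trans (le_of_eq ?_)
    congr 2
    rw [hL, Real.rpow_sub hn0, Real.rpow_one]
    field_simp
  let S₁ : Set Ω := ⋃ j ∈ (Finset.univ : Finset (Fin p)),
    {ω | ∃ i, (n : ℝ) ^ (1 / 6 + s / 2) < |X i ω j|}
  let S₂ : Set Ω := ⋃ k ∈ trueModel φ, {ω | ∃ i, (n : ℝ) ^ (1 / 6 - s) < |X i ω k|}
  let S₃ : Set Ω := ⋃ k ∈ trueModel φ,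
    {ω | ∃ i, (n : ℝ) ^ (1 / 2 - s) < thirdSup ν (t * |X i ω k|)}
  let S₄ : Set Ω := ⋃ j ∈ (Finset.univ : Finset (Fin p)),
    {ω | n * (2 * m + 1) ≤ ∑ i, f j (X i ω)}
  have hsub : {ω | ¬ ((∀ i j, |X i ω j| ≤ (n : ℝ) ^ (1 / 6 + s / 2)) ∧
        ∀ j, ∑ i, weight ν φ t (X i ω) * X i ω j ^ 2 ≤ (2 * m + 1) * n)} ⊆
      ((S₁ ∪ S₂) ∪ S₃) ∪ S₄ := by
    intro ω hω
    by_contra hnot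
    simp only [S₁, S₂, S₃, S₄, mem_union, mem_iUnion, not_or, not_exists, mem_ofPred_eq,
      not_lt, not_le, Finset.mem_univ, forall_true_left] at hnot
    obtain ⟨⟨⟨h1, h2⟩, h3⟩, h4⟩ := hnot
    refine hω ⟨fun i j => h1 j i, fun j => ?_⟩
    have hle : ∀ i, weight ν φ t (X i ω) * X i ω j ^ 2 ≤ L := fun i => by
      have w1 : weight ν φ t (X i ω) ≤ C₀ * (n : ℝ) ^ (2 / 3 - 2 * s) := by
        have b1 : (1 : ℝ) ≤ (n : ℝ) ^ (2 / 3 - 2 * s) := Real.one_le_rpow hn1 (by linarith)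
        have b2 : (n : ℝ) ^ (2 / 3 - 2 * s) = (n : ℝ) ^ (1 / 6 - s) * (n : ℝ) ^ (1 / 2 - s) := by
          rw [← Real.rpow_add hn0]; congr 1; ring
        calc weight ν φ t (X i ω)
            ≤ c₀ + ∑ k ∈ trueModel φ, t * (n : ℝ) ^ (1 / 6 - s) * (n : ℝ) ^ (1 / 2 - s) := by
              rw [weight, hc₀]
              gcongr with k hk
              · exact thirdSup_nonneg _ _
              · exact h2 k hk i
              · exact h3 k hk i
          _ = c₀ + (trueModel φ).card * (t * (n : ℝ) ^ (2 / 3 - 2 * s)) := by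
              rw [Finset.sum_const, nsmul_eq_mul, b2]; ring
          _ ≤ c₀ * (n : ℝ) ^ (2 / 3 - 2 * s) + q * (t * (n : ℝ) ^ (2 / 3 - 2 * s)) := by
              gcongr
              exact le_mul_of_one_le_right hc₀pos.le b1
          _ = _ := by rw [hC₀]; ring
      have w2 : X i ω j ^ 2 ≤ (n : ℝ) ^ (1 / 3 + s) := by
        have b3 : (n : ℝ) ^ (1 / 3 + s) = ((n : ℝ) ^ (1 / 6 + s / 2)) ^ 2 := by
          rw [hpow]; congr 1; push_cast; ring
        rw [b3, ← sq_abs]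
        exact pow_le_pow_left₀ (abs_nonneg _) (h1 j i) 2
      calc weight ν φ t (X i ω) * X i ω j ^ 2
          ≤ C₀ * (n : ℝ) ^ (2 / 3 - 2 * s) * (n : ℝ) ^ (1 / 3 + s) := by gcongr
        _ = L := by
            rw [hL, mul_assoc, ← Real.rpow_add hn0]; congr 2; ring
    have h5 := (h4 j).le
    have h6 : ∑ i, f j (X i ω) = ∑ i, weight ν φ t (X i ω) * X i ω j ^ 2 :=
      Finset.sum_congr rfl fun i _ => min_eq_left (hle i)
    rw [h6] at h5
    linarith
  have hS₁ : P.real S₁ ≤ p * (n * (A / (n : ℝ) ^ (K + 3 * K * s))) := by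
    calc P.real S₁ ≤ ∑ j : Fin p, P.real {ω | ∃ i, (n : ℝ) ^ (1 / 6 + s / 2) < |X i ω j|} :=
          measureReal_biUnion_finset_le _ _
      _ ≤ ∑ _j : Fin p, n * (A / (n : ℝ) ^ (K + 3 * K * s)) := by
          refine Finset.sum_le_sum fun j _ => (hx j _).trans (le_of_eq ?_)
          congr 3; push_cast; ring
      _ = _ := by simp
  have hS₂ : P.real S₂ ≤ q * (n * (A / (n : ℝ) ^ (K - 6 * K * s))) := by
    calc P.real S₂ ≤ ∑ k ∈ trueModel φ, P.real {ω | ∃ i, (n : ℝ) ^ (1 / 6 - s) < |X i ω k|} :=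
          measureReal_biUnion_finset_le _ _
      _ ≤ ∑ _k ∈ trueModel φ, n * (A / (n : ℝ) ^ (K - 6 * K * s)) := by
          refine Finset.sum_le_sum fun j _ => (hx j _).trans (le_of_eq ?_)
          congr 3; push_cast; ring
      _ = (trueModel φ).card * (n * (A / (n : ℝ) ^ (K - 6 * K * s))) := by simp
      _ ≤ _ := by gcongr
  have hS₃ : P.real S₃ ≤ q * (n * (B / (n : ℝ) ^ (K - 2 * K * s))) := by
    calc P.real S₃ ≤ ∑ k ∈ trueModel φ,
          P.real {ω | ∃ i, (n : ℝ) ^ (1 / 2 - s) < thirdSup ν (t * |X i ω k|)} :=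
          measureReal_biUnion_finset_le _ _
      _ ≤ ∑ _k ∈ trueModel φ, n * (B / (n : ℝ) ^ (K - 2 * K * s)) := by
          refine Finset.sum_le_sum fun j _ => (hg j _).trans (le_of_eq ?_)
          congr 3; push_cast; ring
      _ = (trueModel φ).card * (n * (B / (n : ℝ) ^ (K - 2 * K * s))) := by simp
      _ ≤ _ := by gcongr
  have hS₄ : P.real S₄ ≤ p * Real.exp (-((n : ℝ) ^ s / C₀)) := by
    calc P.real S₄ ≤ ∑ j : Fin p, P.real {ω | n * (2 * m + 1) ≤ ∑ i, f j (X i ω)} :=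
          measureReal_biUnion_finset_le _ _
      _ ≤ ∑ _j : Fin p, Real.exp (-((n : ℝ) ^ s / C₀)) := Finset.sum_le_sum fun j _ => hch j
      _ = _ := by simp
  calc _ ≤ P.real (((S₁ ∪ S₂) ∪ S₃) ∪ S₄) := measureReal_mono hsub (measure_ne_top _ _)
    _ ≤ P.real ((S₁ ∪ S₂) ∪ S₃) + P.real S₄ := measureReal_union_le _ _
    _ ≤ P.real (S₁ ∪ S₂) + P.real S₃ + P.real S₄ := by gcongr; exact measureReal_union_le _ _
    _ ≤ P.real S₁ + P.real S₂ + P.real S₃ + P.real S₄ := by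
        gcongr; exact measureReal_union_le _ _
    _ ≤ _ := by gcongr

end Moments

/-! ### Regular designs with high probability -/

section Asymptotics

/-- Both `log n` and `log p` are `o(n)`: half of the exponential rate absorbs `D`, the other half
all powers of `n` and `p`. -/
lemma eventually_const_mul_pow_mul_exp_le {p : ℕ → ℕ} (hp : ∀ n, 1 ≤ p n)
    (hgrowth : (fun n => Real.log (p n)) =o[atTop] fun n : ℕ => (n : ℝ)) {c : ℝ} (hc : 0 < c)
    (D α β : ℝ) (k : ℕ) :
    ∀ᶠ n : ℕ in atTop, D * ((p n : ℝ) ^ k * Real.exp (-(n * c))) ≤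
      Real.exp (-(α * Real.log n + β * Real.log (p n))) := by
  set ε : ℝ := c / (2 * (k + |α| + |β| + 1)) with hε
  have hε0 : 0 < ε := by positivity
  have hlog : (fun n : ℕ => Real.log n) =o[atTop] fun n : ℕ => (n : ℝ) :=
    Real.isLittleO_log_id_atTop.comp_tendsto tendsto_natCast_atTop_atTop
  have hD : Tendsto (fun n : ℕ => Real.exp (c / 2 * n)) atTop atTop :=
    Real.tendsto_exp_atTop.comp (tendsto_natCast_atTop_atTop.const_mul_atTop (by positivity))
  filter_upwards [hgrowth.def hε0, hlog.def hε0, hD.eventually_ge_atTop D] with n h1 h2 h3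
  have hp0 : (0 : ℝ) < p n := by exact_mod_cast hp n
  have hn0 : (0 : ℝ) ≤ n := n.cast_nonneg
  have hL1 := log_natCast_nonneg n
  have hL2 := log_natCast_nonneg (p n)
  rw [Real.norm_of_nonneg hL2, Real.norm_of_nonneg hn0] at h1
  rw [Real.norm_of_nonneg hL1, Real.norm_of_nonneg hn0] at h2
  have e0 : (p n : ℝ) ^ k = Real.exp (k * Real.log (p n)) := by
    rw [Real.exp_nat_mul, Real.exp_log hp0]
  calc D * ((p n : ℝ) ^ k * Real.exp (-(n * c)))
      ≤ Real.exp (c / 2 * n) * ((p n : ℝ) ^ k * Real.exp (-(n * c))) := by gcongr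
    _ = Real.exp (c / 2 * n + (k * Real.log (p n) + -(n * c))) := by
        rw [e0, Real.exp_add, Real.exp_add]
    _ ≤ _ := by
        refine Real.exp_le_exp.2 ?_
        have a1 : α * Real.log n ≤ |α| * (ε * n) :=
          (mul_le_mul_of_nonneg_right (le_abs_self _) hL1).trans (by gcongr)
        have a2 : β * Real.log (p n) ≤ |β| * (ε * n) :=
          (mul_le_mul_of_nonneg_right (le_abs_self _) hL2).trans (by gcongr)
        have a3 : k * Real.log (p n) ≤ k * (ε * n) := by gcongr
        have a4 : (k + |α| + |β| + 1) * (ε * n) = c / 2 * n := by rw [hε]; field_simp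
        have a5 : 0 ≤ ε * n := by positivity
        linarith

lemma eventually_const_mul_rpow_le (D : ℝ) {e w b : ℝ} (h : e < w) (hb : 0 < b) :
    ∀ᶠ n : ℕ in atTop, D * (n : ℝ) ^ e ≤ b * (n : ℝ) ^ w := by
  have ht : Tendsto (fun n : ℕ => D * (n : ℝ) ^ (-(w - e))) atTop (𝓝 0) := by
    simpa using ((tendsto_rpow_neg_atTop (sub_pos.2 h)).comp
      tendsto_natCast_atTop_atTop).const_mul D
  filter_upwards [ht.eventually_le_const hb, eventually_gt_atTop 0] with n h1 h2
  have hn0 : (0 : ℝ) < n := by exact_mod_cast h2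
  calc D * (n : ℝ) ^ e = D * (n : ℝ) ^ (-(w - e)) * (n : ℝ) ^ w := by
        rw [mul_assoc, ← Real.rpow_add hn0]; congr 2; ring
    _ ≤ _ := by gcongr

lemma natCast_le_rpow_of_log_le {n p : ℕ} {k : ℝ} (hn : 0 < n) (hp : 0 < p)
    (h : Real.log p ≤ k * Real.log n) : (p : ℝ) ≤ (n : ℝ) ^ k := by
  have hn0 : (0 : ℝ) < n := by exact_mod_cast hn
  have hp0 : (0 : ℝ) < p := by exact_mod_cast hp
  rw [Real.rpow_def_of_pos hn0, ← Real.log_le_iff_le_exp hp0]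
  linarith

/-- As `p` is at most a power of `n`, the exponent `n ^ s` beats every multiple of `log n`; hence
`w` is arbitrary. -/
lemma eventually_mul_exp_neg_rpow_le {p : ℕ → ℕ} (hp : ∀ n, 1 ≤ p n) {k s C w b : ℝ}
    (hk : ∀ᶠ n : ℕ in atTop, Real.log (p n) ≤ k * Real.log n) (hs : 0 < s) (hC : 0 < C)
    (hb : 0 < b) :
    ∀ᶠ n : ℕ in atTop, p n * Real.exp (-((n : ℝ) ^ s / C)) ≤ b * (n : ℝ) ^ w := by
  set ε : ℝ := 1 / (C * (|k| + |w| + 1)) with hε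
  have hε0 : 0 < ε := by positivity
  have hlog : (fun n : ℕ => Real.log n) =o[atTop] fun n : ℕ => (n : ℝ) ^ s :=
    (isLittleO_log_rpow_atTop hs).comp_tendsto tendsto_natCast_atTop_atTop
  have hsm : ∀ᶠ n : ℕ in atTop, 1 * Real.exp (-(1 * Real.log n)) ≤ b :=
    (tendsto_const_mul_exp_neg_mul_log one_pos 1).eventually_le_const hb
  filter_upwards [hk, hlog.def hε0, hsm, eventually_gt_atTop 0] with n h1 h2 h3 h4
  have hn0 : (0 : ℝ) < n := by exact_mod_cast h4
  have hL1 := log_natCast_nonneg n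
  rw [Real.norm_of_nonneg hL1, Real.norm_of_nonneg (by positivity)] at h2
  have h5 := natCast_le_rpow_of_log_le h4 (hp n) h1
  rw [one_mul] at h3
  calc (p n : ℝ) * Real.exp (-((n : ℝ) ^ s / C))
      ≤ (n : ℝ) ^ k * Real.exp (-((n : ℝ) ^ s / C)) := by gcongr
    _ = Real.exp (Real.log n * k + -((n : ℝ) ^ s / C)) := by
        rw [Real.rpow_def_of_pos hn0, Real.exp_add]
    _ ≤ Real.exp (-(1 * Real.log n) + Real.log n * w) := by
        refine Real.exp_le_exp.2 ?_
        have a1 : Real.log n * k ≤ Real.log n * |k| := by gcongr; exact le_abs_self k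
        have a2 : -(Real.log n * w) ≤ Real.log n * |w| := by
          rw [← mul_neg]; gcongr; exact neg_le_abs w
        have a3 : (|k| + |w| + 1) * Real.log n ≤ (|k| + |w| + 1) * (ε * (n : ℝ) ^ s) := by gcongr
        have a4 : (|k| + |w| + 1) * (ε * (n : ℝ) ^ s) = (n : ℝ) ^ s / C := by rw [hε]; field_simp
        linarith
    _ = Real.exp (-(1 * Real.log n)) * (n : ℝ) ^ w := by
        rw [Real.exp_add, Real.rpow_def_of_pos hn0]
    _ ≤ _ := by gcongr

lemma tendsto_log_mul_div {p : ℕ → ℕ} (hp : ∀ n, 1 ≤ p n)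
    (hgrowth : (fun n => Real.log (p n)) =o[atTop] fun n : ℕ => (n : ℝ)) (A : ℝ) :
    Tendsto (fun n : ℕ => A * Real.sqrt (Real.log (n * p n) / n)) atTop (𝓝 0) := by
  have hlog : (fun n : ℕ => Real.log n) =o[atTop] fun n : ℕ => (n : ℝ) :=
    Real.isLittleO_log_id_atTop.comp_tendsto tendsto_natCast_atTop_atTop
  have h1 : Tendsto (fun n : ℕ => Real.log (n * p n) / n) atTop (𝓝 0) := by
    refine ((hlog.add hgrowth).tendsto_div_nhds_zero).congr' ?_
    filter_upwards [eventually_gt_atTop 0] with n hn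
    have hn0 : (n : ℝ) ≠ 0 := by exact_mod_cast hn.ne'
    have hp0 : (p n : ℝ) ≠ 0 := by exact_mod_cast (Nat.pos_iff_ne_zero.1 (hp n))
    rw [Real.log_mul hn0 hp0]
  simpa using (Real.continuous_sqrt.continuousAt.tendsto.comp h1).const_mul A

/-- For `p` polynomial in `n` the square of the product is of order `log n / n ^ (2/3 - s)`, so the
growing covariate bound still shrinks against the radius. -/
lemma tendsto_rpow_mul_sqrt {p : ℕ → ℕ} (hp : ∀ n, 1 ≤ p n) {k s : ℝ}
    (hk : ∀ᶠ n : ℕ in atTop, Real.log (p n) ≤ k * Real.log n) (hs : s < 2 / 3) :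
    Tendsto (fun n : ℕ => (n : ℝ) ^ (1 / 6 + s / 2) * Real.sqrt (Real.log (n * p n) / n)) atTop
      (𝓝 0) := by
  have h1 : Tendsto (fun n : ℕ => Real.sqrt ((1 + k) * (Real.log n / (n : ℝ) ^ (2 / 3 - s))))
      atTop (𝓝 0) := by
    have h2 : Tendsto (fun n : ℕ => Real.log n / (n : ℝ) ^ (2 / 3 - s)) atTop (𝓝 0) :=
      (isLittleO_log_rpow_atTop (by linarith)).tendsto_div_nhds_zero.comp
        tendsto_natCast_atTop_atTop
    simpa [Function.comp_def] using
      Real.continuous_sqrt.continuousAt.tendsto.comp (h2.const_mul (1 + k))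
  refine squeeze_zero' (Eventually.of_forall fun n => by positivity) ?_ h1
  filter_upwards [hk, eventually_gt_atTop 0] with n hn h0
  have hn0 : (0 : ℝ) < n := by exact_mod_cast h0
  have hp0 : (p n : ℝ) ≠ 0 := by exact_mod_cast (Nat.pos_iff_ne_zero.1 (hp n))
  have e1 : (n : ℝ) ^ (1 / 6 + s / 2) = Real.sqrt ((n : ℝ) ^ (1 / 3 + s)) := by
    rw [Real.sqrt_eq_rpow, ← Real.rpow_mul hn0.le]
    congr 1
    ring
  rw [e1, ← Real.sqrt_mul (by positivity)]
  refine Real.sqrt_le_sqrt ?_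
  have e2 : (n : ℝ) = (n : ℝ) ^ (1 / 3 + s) * (n : ℝ) ^ (2 / 3 - s) := by
    rw [← Real.rpow_add hn0]
    norm_num
  rw [Real.log_mul hn0.ne' hp0]
  calc (n : ℝ) ^ (1 / 3 + s) * ((Real.log n + Real.log (p n)) / n)
      ≤ (n : ℝ) ^ (1 / 3 + s) * (((1 + k) * Real.log n) / n) := by gcongr; linarith
    _ = _ := by
        nth_rewrite 3 [e2]
        field_simp

/-- The three parts of regularity of a design. -/
lemma regularDesign_of_weight {ν : Measure ℝ} (hν : GeneratesExpFamily ν) {n p q : ℕ}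
    {x : Fin n → Fin p → ℝ} {φ : Fin p → ℝ} (hφ : (trueModel φ).card ≤ q) {b M C c : ℝ}
    (hb : ‖φ‖ ≤ b) (h1 : ∀ i j, |x i j| ≤ M)
    (h2 : ∀ j, ∑ i, weight ν φ (q * b + 1) (x i) * x i j ^ 2 ≤ C * n)
    (h3 : ∀ J : Finset (Fin p), J.card ≤ 2 * q → ∀ δ ∈ modelSpace J, M * (2 * q) * ‖δ‖ ≤ 1 →
      c * n * ‖δ‖ ^ 2 ≤ tangentGap ν x φ δ) : RegularDesign ν x φ q M C c :=
  ⟨h1, ⟨fun i => weight ν φ (q * b + 1) (x i),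
    fun _ _ ht => iteratedDeriv_two_le_weight hν hφ hb ht, h2⟩, h3⟩

variable {ν : Measure ℝ} {p : ℕ → ℕ} {q : ℕ} {μ : ∀ n, Measure (Fin (p n) → ℝ)}
  {φ : ∀ n, Fin (p n) → ℝ} {Ω : ℕ → Type*} [∀ n, MeasurableSpace (Ω n)]
  {P : ∀ n, Measure (Ω n)} {X : ∀ n, Fin n → Ω n → Fin (p n) → ℝ}
  {Y : ∀ n, Fin n → Ω n → ℝ}

/-- Bounded covariates yield regular designs. -/
theorem BoundedCovariates.exists_regularDesign (hν : GeneratesExpFamily ν)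
    (hp : ∀ n, 1 ≤ p n) (hμ : ∀ n, IsProbabilityMeasure (μ n))
    (hP : ∀ n, IsProbabilityMeasure (P n))
    (hXY : ∀ n, IsGLMSample (P n) ν (μ n) (φ n) (X n) (Y n)) (hB : SparseRegime q μ φ)
    (hA : BoundedCovariates μ) :
    ∃ M C c : ℝ, 0 ≤ M ∧ 0 ≤ C ∧ 0 < c ∧ ∀ α β : ℝ, ∀ᶠ n : ℕ in atTop,
      (P n).real {ω | ¬ RegularDesign ν (fun i => X n i ω) (φ n) q M C c} ≤
        1 / 2 * ((n : ℝ) ^ (-α) * (p n : ℝ) ^ (-β)) := by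
  obtain ⟨A₀, hA₀⟩ := hA
  obtain ⟨b, hb, hφb⟩ := hB.signal_bounded
  set A := max A₀ 0 with hAdef
  have hA0 : 0 ≤ A := le_max_right _ _
  have hAx : ∀ n, ∀ᵐ x ∂(μ n), ∀ j, |x j| ≤ A := fun n => by
    rw [ae_all_iff]
    exact fun j => (hA₀ n j).mono fun x hx => hx.trans (le_max_left _ _)
  have h4 : ∀ n, ∀ j, Integrable (fun x : Fin (p n) → ℝ => x j ^ 4) (μ n) ∧
      ∫ x, x j ^ 4 ∂(μ n) ≤ A ^ 4 := fun n j => by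
    have hμn := hμ n
    have hle : ∀ᵐ x ∂(μ n), x j ^ 4 ∈ Icc 0 (A ^ 4) := (hAx n).mono fun x hx => by
      have : x j ^ 4 = |x j| ^ 4 := (Even.pow_abs ⟨2, rfl⟩ _).symm
      rw [this]
      exact ⟨by positivity, pow_le_pow_left₀ (abs_nonneg _) (hx j) 4⟩
    have hI := Integrable.of_mem_Icc 0 (A ^ 4)
      ((measurable_pi_apply j).pow_const 4).aemeasurable hle
    refine ⟨hI, (integral_mono_ae hI (integrable_const (A ^ 4))
      (hle.mono fun x hx => hx.2)).trans ?_⟩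
    simp
  obtain ⟨c, c₁, hc, hc₁, hcurv⟩ := exists_measureReal_not_curved hν hp hμ hP hXY hB
    (fun n j => (h4 n j).1) (fun n j => (h4 n j).2)
  set t : ℝ := q * b + 1 with ht
  have ht0 : 0 ≤ t := by positivity
  set W : ℝ := iteratedDeriv 2 (cumulant ν) 0 + t * thirdSup ν t +
    q * (t * A * thirdSup ν (t * A)) with hW
  have hW0 : 0 ≤ W := by
    have e1 := (iteratedDeriv_two_cumulant_pos hν 0).le
    have e2 := mul_nonneg ht0 (thirdSup_nonneg ν t)
    have e3 := mul_nonneg (mul_nonneg ht0 hA0) (thirdSup_nonneg ν (t * A))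
    positivity
  have hwt : ∀ n (x : Fin (p n) → ℝ), (∀ j, |x j| ≤ A) → weight ν (φ n) t x ≤ W := by
    intro n x hx
    have e0 : ∑ k ∈ trueModel (φ n), t * |x k| * thirdSup ν (t * |x k|) ≤
        ∑ _k ∈ trueModel (φ n), t * A * thirdSup ν (t * A) := by
      refine Finset.sum_le_sum fun k _ => ?_
      have e1 : t * |x k| ≤ t * A := by gcongr; exact hx k
      exact mul_le_mul e1 (monotone_thirdSup hν e1) (thirdSup_nonneg _ _) (by positivity)
    rw [Finset.sum_const, nsmul_eq_mul] at e0
    have e2 : ((trueModel (φ n)).card : ℝ) * (t * A * thirdSup ν (t * A)) ≤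
        q * (t * A * thirdSup ν (t * A)) := by
      have := mul_nonneg (mul_nonneg ht0 hA0) (thirdSup_nonneg ν (t * A))
      have hcard : ((trueModel (φ n)).card : ℝ) ≤ q := by exact_mod_cast hB.sparsity n
      gcongr
    rw [weight, hW]
    linarith
  refine ⟨A, W * A ^ 2, c, hA0, by positivity, hc, fun α β => ?_⟩
  -- Doubling the constant of the curvature bound yields the factor `1 / 2` in the conclusion.
  filter_upwards [eventually_const_mul_pow_mul_exp_le hp hB.growth hc₁
    (2 * (2 * (2 * q : ℕ) ^ 2 * ((2 * q : ℕ) + 1))) α β (2 * q), eventually_gt_atTop 0] with n hn h0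
  have hPn := hP n
  have hμn := hμ n
  rw [rpow_mul_rpow_eq_exp h0 (hp n)]
  have hae : ∀ᵐ ω ∂(P n), ∀ i j, |X n i ω j| ≤ A := by
    rw [ae_all_iff]
    intro i
    have h := hAx n
    rw [← (hXY n).map_X hν i] at h
    exact ae_of_ae_map ((hXY n).measurable_X i).aemeasurable h
  have hnull : (P n).real {ω | ¬ ∀ i j, |X n i ω j| ≤ A} = 0 := by
    rw [measureReal_def, ae_iff.1 hae, ENNReal.toReal_zero]
  have hsub : {ω | ¬ RegularDesign ν (fun i => X n i ω) (φ n) q A (W * A ^ 2) c} ⊆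
      {ω | ¬ ∀ i j, |X n i ω j| ≤ A} ∪ {ω | (∀ i j, |X n i ω j| ≤ A) ∧
        ¬ ∀ J : Finset (Fin (p n)), J.card ≤ 2 * q → ∀ δ ∈ modelSpace J, A * (2 * q) * ‖δ‖ ≤ 1 →
          c * n * ‖δ‖ ^ 2 ≤ tangentGap ν (fun i => X n i ω) (φ n) δ} := by
    intro ω hω
    by_cases hω1 : ∀ i j, |X n i ω j| ≤ A
    · right
      refine ⟨hω1, fun hω2 => hω (regularDesign_of_weight hν (hB.sparsity n)
        ((norm_le_norm_toLp _).trans (hφb n)) hω1 (fun j => ?_) hω2)⟩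
      calc ∑ i, weight ν (φ n) t (X n i ω) * X n i ω j ^ 2 ≤ ∑ _i : Fin n, W * A ^ 2 := by
            refine Finset.sum_le_sum fun i _ => ?_
            refine mul_le_mul (hwt n _ (hω1 i)) ?_ (sq_nonneg _) hW0
            rw [← sq_abs]
            exact pow_le_pow_left₀ (abs_nonneg _) (hω1 i j) 2
        _ = W * A ^ 2 * n := by simp; ring
    · exact Or.inl hω1
  have hfin := (measureReal_mono hsub (measure_ne_top (P n) _)).trans (measureReal_union_le _ _)
  rw [hnull, zero_add] at hfin
  have := hcurv n A hA0
  linarith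

/-- Moment conditions yield regular designs. -/
theorem MomentCovariates.exists_regularDesign (hν : GeneratesExpFamily ν)
    (hp : ∀ n, 1 ≤ p n) (hμ : ∀ n, IsProbabilityMeasure (μ n))
    (hP : ∀ n, IsProbabilityMeasure (P n))
    (hXY : ∀ n, IsGLMSample (P n) ν (μ n) (φ n) (X n) (Y n)) (hB : SparseRegime q μ φ)
    {K : ℕ} (hA : MomentCovariates ν μ K) (hK : 1 ≤ K) {s : ℝ} (hs0 : 0 < s) (hs1 : s ≤ 1 / 6) :
    ∃ C c : ℝ, 0 ≤ C ∧ 0 < c ∧ ∀ k w : ℝ,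
      (∀ᶠ n : ℕ in atTop, Real.log (p n) ≤ k * Real.log n) →
      1 - K + 6 * K * s < w → k + 1 - K - 3 * K * s < w → ∀ᶠ n : ℕ in atTop,
      (P n).real {ω | ¬ RegularDesign ν (fun i => X n i ω) (φ n) q ((n : ℝ) ^ (1 / 6 + s / 2)) C c}
        ≤ (n : ℝ) ^ w := by
  obtain ⟨b, hb, hφb⟩ := hB.signal_bounded
  set t : ℝ := q * b + 1 with ht
  have ht0 : 0 < t := by positivity
  obtain ⟨A, B, hA0, hB0, hmb⟩ := hA.exists_momentBounds hν ht0
  obtain ⟨c, c₁, hc, hc₁, hcurv⟩ := exists_measureReal_not_curved hν hp hμ hP hXY hB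
    (A := 1 + A) (fun n j => have := hμ n; ((hmb n).pow_four hK j).1)
    (fun n j => have := hμ n; ((hmb n).pow_four hK j).2)
  set c₀ : ℝ := iteratedDeriv 2 (cumulant ν) 0 + t * thirdSup ν t with hc₀
  have hc₀pos : 0 < c₀ := by
    have h1 := iteratedDeriv_two_cumulant_pos hν 0
    have h2 := mul_nonneg ht0.le (thirdSup_nonneg ν t)
    linarith
  set m : ℝ := c₀ * (1 + A) + q * (t * (3 + A + A + B)) with hm
  have hm0 : 0 ≤ m := by positivity
  refine ⟨2 * m + 1, c, by positivity, hc, fun k w hk hw1 hw2 => ?_⟩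
  have hKs : 0 < (K : ℝ) * s := mul_pos (by exact_mod_cast hK) hs0
  -- Five error terms, each at most `1 / 8` of `n ^ w`; the strict inequalities between exponents
  -- absorb the constants.
  filter_upwards [eventually_const_mul_pow_mul_exp_le hp hB.growth hc₁
      (8 * (2 * (2 * q : ℕ) ^ 2 * ((2 * q : ℕ) + 1))) (-w) 0 (2 * q),
    eventually_const_mul_rpow_le A hw2 (b := 1 / 8) (by norm_num),
    eventually_const_mul_rpow_le (q * A) hw1 (b := 1 / 8) (by norm_num),
    eventually_const_mul_rpow_le (q * B) (e := 1 - K + 2 * K * s) (w := w) (b := 1 / 8)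
      (by linarith) (by norm_num),
    eventually_mul_exp_neg_rpow_le hp (C := c₀ + q * t) (w := w) (b := 1 / 8) hk hs0
      (by positivity) (by norm_num), hk, eventually_gt_atTop 0] with n e1 e2 e3 e4 e5 hkn h0
  have hPn := hP n
  have hμn := hμ n
  have hn0 : (0 : ℝ) < n := by exact_mod_cast h0
  have hsub : {ω | ¬ RegularDesign ν (fun i => X n i ω) (φ n) q ((n : ℝ) ^ (1 / 6 + s / 2))
        (2 * m + 1) c} ⊆
      {ω | ¬ ((∀ i j, |X n i ω j| ≤ (n : ℝ) ^ (1 / 6 + s / 2)) ∧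
        ∀ j, ∑ i, weight ν (φ n) t (X n i ω) * X n i ω j ^ 2 ≤ (2 * m + 1) * n)} ∪
      {ω | (∀ i j, |X n i ω j| ≤ (n : ℝ) ^ (1 / 6 + s / 2)) ∧
        ¬ ∀ J : Finset (Fin (p n)), J.card ≤ 2 * q → ∀ δ ∈ modelSpace J,
          (n : ℝ) ^ (1 / 6 + s / 2) * (2 * q) * ‖δ‖ ≤ 1 →
          c * n * ‖δ‖ ^ 2 ≤ tangentGap ν (fun i => X n i ω) (φ n) δ} := by
    intro ω hω
    by_cases hω1 : (∀ i j, |X n i ω j| ≤ (n : ℝ) ^ (1 / 6 + s / 2)) ∧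
        ∀ j, ∑ i, weight ν (φ n) t (X n i ω) * X n i ω j ^ 2 ≤ (2 * m + 1) * n
    · exact Or.inr ⟨hω1.1, fun hω2 => hω (regularDesign_of_weight hν (hB.sparsity n)
        ((norm_le_norm_toLp _).trans (hφb n)) hω1.1 hω1.2 hω2)⟩
    · exact Or.inl hω1
  have f1 := (hXY n).measureReal_not_weighted hν (hB.sparsity n) (hmb n) hK ht0.le hA0 hB0
    hc₀ hm rfl hs1 h0
  have f2 := hcurv n ((n : ℝ) ^ (1 / 6 + s / 2)) (by positivity)
  have f3 := (measureReal_mono hsub (measure_ne_top (P n) _)).trans (measureReal_union_le _ _)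
  have g0 : ∀ D e : ℝ, n * (D / (n : ℝ) ^ e) = D * (n : ℝ) ^ (1 - e) := fun D e => by
    rw [Real.rpow_sub hn0, Real.rpow_one]
    ring
  have g1 : (p n : ℝ) * (n * (A / (n : ℝ) ^ (K + 3 * K * s))) ≤ 1 / 8 * (n : ℝ) ^ w := by
    refine le_trans ?_ e2
    rw [g0]
    calc (p n : ℝ) * (A * (n : ℝ) ^ (1 - (K + 3 * K * s)))
        ≤ (n : ℝ) ^ k * (A * (n : ℝ) ^ (1 - (K + 3 * K * s))) := by
          gcongr
          exact natCast_le_rpow_of_log_le h0 (hp n) hkn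
      _ = A * ((n : ℝ) ^ k * (n : ℝ) ^ (1 - (K + 3 * K * s))) := by ring
      _ = A * (n : ℝ) ^ (k + 1 - K - 3 * K * s) := by
          rw [← Real.rpow_add hn0]; congr 2; ring
  have g2 : (q : ℝ) * (n * (A / (n : ℝ) ^ (K - 6 * K * s))) ≤ 1 / 8 * (n : ℝ) ^ w := by
    refine le_trans (le_of_eq ?_) e3
    rw [g0, ← mul_assoc]
    congr 2; ring
  have g3 : (q : ℝ) * (n * (B / (n : ℝ) ^ (K - 2 * K * s))) ≤ 1 / 8 * (n : ℝ) ^ w := by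
    refine le_trans (le_of_eq ?_) e4
    rw [g0, ← mul_assoc]
    congr 2; ring
  have g5 : Real.exp (-(-w * Real.log n + 0 * Real.log (p n))) = (n : ℝ) ^ w := by
    rw [Real.rpow_def_of_pos hn0]; congr 1; ring
  rw [g5] at e1
  have hw0 : 0 ≤ (n : ℝ) ^ w := by positivity
  linarith

end Asymptotics

/-! ### Selection probabilities and consistency -/

lemma one_sub_le_measureReal {Ω : Type*} [MeasurableSpace Ω] {P : Measure Ω}
    [IsProbabilityMeasure P] {S : Ω → Prop} {r : ℝ} (h : P.real {ω | ¬ S ω} ≤ r) :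
    1 - r ≤ P.real {ω | S ω} := by
  have h1 := measureReal_union_le (μ := P) {ω | S ω} {ω | ¬ S ω}
  have h2 : {ω | S ω} ∪ {ω | ¬ S ω} = univ := by ext ω; simp [em]
  rw [h2, probReal_univ] at h1
  linarith

lemma StrictlySelects.selectsWithMargin {n p : ℕ} {ν : Measure ℝ} {x : Fin n → Fin p → ℝ}
    {y : Fin n → ℝ} {γ : ℝ} {q : ℕ} {Js : Finset (Fin p)} {m : ℝ}
    (h : StrictlySelects ν x y γ q Js m) : SelectsWithMargin ν x y γ q Js m :=
  ⟨h.1, fun J hJ hq => by linarith [h.2 J hJ hq]⟩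

lemma StrictlySelects.selects {n p : ℕ} {ν : Measure ℝ} {x : Fin n → Fin p → ℝ}
    {y : Fin n → ℝ} {γ : ℝ} {q : ℕ} {Js : Finset (Fin p)} {m : ℝ}
    (h : StrictlySelects ν x y γ q Js m) (hm : 0 ≤ m) : Selects ν x y γ q Js :=
  ⟨h.1, fun J hJ hq => by linarith [h.2 J hJ hq]⟩

/-- Every `γ` above the consistency threshold is admissible with some positive `α` and `β`. -/
lemma exists_admissibleScalars {p : ℕ → ℕ} {γ : ℝ}
    (hγ : kappa p ≠ 0 → 1 - invKappa p / 2 < γ) :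
    ∃ α β : ℝ, 0 < α ∧ 0 < β ∧ AdmissibleScalars p α β γ := by
  by_cases h0 : kappa p = 0
  · exact ⟨1 / 4, 1, by norm_num, by norm_num, fun _ => by norm_num, fun h => absurd h0 h⟩
  · have hg := hγ h0
    have hι := invKappa_nonneg p
    set ι := invKappa p
    set g := γ - (1 - ι / 2) with hgdef
    have hg0 : 0 < g := by linarith
    refine ⟨min (1 / 4) (g / (3 * (ι + 1))), g / 3, by positivity, by positivity,
      fun h => absurd h h0, fun _ => ⟨?_, Or.inl ?_⟩⟩
    · have h1 : min (1 / 4) (g / (3 * (ι + 1))) * ι ≤ g / (3 * (ι + 1)) * ι := by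
        gcongr; exact min_le_right _ _
      have h2 : g / (3 * (ι + 1)) * ι ≤ g / 3 := by
        rw [div_mul_eq_mul_div, div_le_div_iff₀ (by positivity) (by norm_num)]
        nlinarith
      change 1 - ι / 2 + g / 3 + _ < γ
      linarith
    · exact (min_le_left _ _).trans_lt (by norm_num)

lemma two_mul_toReal_kappa_lt {p : ℕ → ℕ} {K : ℕ} (h : 2 * kappa p < K) :
    kappa p ≠ ⊤ ∧ 2 * (kappa p).toReal < K := by
  have ht : kappa p ≠ ⊤ := by
    rintro ht
    simp [ht] at h
  refine ⟨ht, ?_⟩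
  have := (ENNReal.toReal_lt_toReal (ENNReal.mul_ne_top (by simp) ht) (by simp)).2 h
  simpa using this

/-- The strict bound `2κ < K` excludes `K = 0`. The resulting `1 - K ≤ -K / 2` compensates the
factor `n` from the union bound over the sample. -/
lemma MomentCovariates.two_le {ν : Measure ℝ} {p : ℕ → ℕ} {μ : ∀ n, Measure (Fin (p n) → ℝ)}
    {K : ℕ} (h : MomentCovariates ν μ K) : 2 ≤ K := by
  have h0 : K ≠ 0 := by
    rintro rfl
    simpa using h.two_kappa_lt
  obtain ⟨r, hr⟩ := h.even
  omega

/-! ### Error probabilities under each covariate condition -/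

section

variable {ν : Measure ℝ} {p : ℕ → ℕ} {q : ℕ} {μ : ∀ n, Measure (Fin (p n) → ℝ)}
  {φ : ∀ n, Fin (p n) → ℝ} {Ω : ℕ → Type*} [∀ n, MeasurableSpace (Ω n)]
  {P : ∀ n, Measure (Ω n)} {X : ∀ n, Fin n → Ω n → Fin (p n) → ℝ} {Y : ∀ n, Fin n → Ω n → ℝ}

/-- Irregular designs and large likelihood ratios each use half of the allowed error. -/
theorem BoundedCovariates.eventually_le_measureReal_strictlySelects (hν : GeneratesExpFamily ν)
    (hp : ∀ n, 1 ≤ p n) (hμ : ∀ n, IsProbabilityMeasure (μ n))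
    (hP : ∀ n, IsProbabilityMeasure (P n))
    (hXY : ∀ n, IsGLMSample (P n) ν (μ n) (φ n) (X n) (Y n)) (hB : SparseRegime q μ φ)
    (hA : BoundedCovariates μ) {α β γ : ℝ} (hadm : AdmissibleScalars p α β γ) :
    ∀ᶠ n : ℕ in atTop, 1 - (n : ℝ) ^ (-α) * (p n : ℝ) ^ (-β) ≤
      (P n).real {ω | StrictlySelects ν (fun i => X n i ω) (fun i => Y n i ω) γ q
        (trueModel (φ n)) (margin p α β γ n)} := by
  obtain ⟨M, C, c, hM, hC, hc, hreg⟩ := hA.exists_regularDesign hν hp hμ hP hXY hB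
  filter_upwards [hreg α β, eventually_measureReal_not_strictlySelects hν hp hμ hP hXY hB hadm
    (M := fun _ => M) (fun _ => hM) hC hc (tendsto_log_mul_div hp hB.growth M)] with n h1 h2
  have := hP n
  rcases h2 with h2 | h2
  · exact (sub_nonpos.2 h2).trans measureReal_nonneg
  · exact one_sub_le_measureReal (by linarith)

/-- Under the moment conditions of order `K`, designs fail to be regular with probability of order
`n ^ (-(K - 2κ) / 2)`, up to a term dominated by the error probability of the selection. -/
lemma MomentCovariates.exists_eventually_measureReal_not_regularDesign_le
    (hν : GeneratesExpFamily ν)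
    (hp : ∀ n, 1 ≤ p n) (hμ : ∀ n, IsProbabilityMeasure (μ n))
    (hP : ∀ n, IsProbabilityMeasure (P n))
    (hXY : ∀ n, IsGLMSample (P n) ν (μ n) (φ n) (X n) (Y n)) (hB : SparseRegime q μ φ)
    {K : ℕ} (hA : MomentCovariates ν μ K) {α β γ : ℝ} (hadm : AdmissibleScalars p α β γ) :
    ∃ (M : ℕ → ℝ) (C c : ℝ), (∀ n, 0 ≤ M n) ∧ 0 ≤ C ∧ 0 < c ∧
      Tendsto (fun n : ℕ => M n * Real.sqrt (Real.log (n * p n) / n)) atTop (𝓝 0) ∧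
      ∀ᶠ n : ℕ in atTop, (P n).real {ω | ¬ RegularDesign ν (fun i => X n i ω) (φ n) q (M n) C c} ≤
        (n : ℝ) ^ (-((K - 2 * (kappa p).toReal) / 2)) +
          1 / 2 * ((n : ℝ) ^ (-α) * (p n : ℝ) ^ (-β)) := by
  have hK2 := hA.two_le
  have hK2' : (2 : ℝ) ≤ K := by exact_mod_cast hK2
  obtain ⟨hκt, hκK⟩ := two_mul_toReal_kappa_lt hA.two_kappa_lt
  -- For `κ = 0` and `K = 2` the exponents `1 - K` and `-K / 2` coincide and leave no room for `6 *
  -- K * s`. The irregular designs are then charged to `n ^ (-α) * p ^ (-β)`, which decays slowly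
  -- because `α < 1 / 2`.
  by_cases h0 : kappa p = 0
  · obtain ⟨hα0, hα, hβ⟩ := hadm.1 h0
    set s : ℝ := 1 / (24 * K) with hs
    have hs0 : 0 < s := by positivity
    have hKs : K * s = 1 / 24 := by rw [hs]; field_simp
    have hs1 : s ≤ 1 / 24 := by nlinarith
    obtain ⟨C, c, hC, hc, hreg⟩ :=
      hA.exists_regularDesign hν hp hμ hP hXY hB (by omega) hs0 (by linarith)
    -- With `p ≤ n ^ k` this gives `p ^ (-β) ≥ n ^ (-1/8)`. The rate `-5/8` reached below is then
    -- sufficient, as `-5/8 < -α - 1/8`.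
    set k : ℝ := min (1 / 4) (1 / (8 * β)) with hk
    have hk0 : 0 < k := by positivity
    have hk4 : k ≤ 1 / 4 := min_le_left _ _
    have hkβ : k * β ≤ 1 / 8 := by
      calc k * β ≤ 1 / (8 * β) * β := by gcongr; exact min_le_right _ _
        _ = 1 / 8 := by field_simp
    have hlog := eventually_log_le_of_kappa_lt (p := p) (k := k) (by rw [h0]; simpa using hk0)
    refine ⟨_, C, c, fun n => by positivity, hC, hc,
      tendsto_rpow_mul_sqrt hp hlog (s := s) (by linarith), ?_⟩
    filter_upwards [hreg k (-5 / 8) hlog (by nlinarith) (by nlinarith), hlog,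
      eventually_const_mul_rpow_le 1 (e := -5 / 8) (w := -α + -(1 / 8)) (b := 1 / 2)
        (by linarith) (by norm_num), eventually_gt_atTop 0] with n h1 h2 h3 hn
    have hn0 : (0 : ℝ) < n := by exact_mod_cast hn
    have hn1 : (1 : ℝ) ≤ n := by exact_mod_cast hn
    have hp1 : (0 : ℝ) < p n := by exact_mod_cast hp n
    have h4 : (n : ℝ) ^ (-(1 / 8 : ℝ)) ≤ (p n : ℝ) ^ (-β) := by
      calc (n : ℝ) ^ (-(1 / 8 : ℝ)) ≤ (n : ℝ) ^ (k * -β) :=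
            Real.rpow_le_rpow_of_exponent_le hn1 (by linarith)
        _ = ((n : ℝ) ^ k) ^ (-β) := Real.rpow_mul hn0.le _ _
        _ ≤ _ := Real.rpow_le_rpow_of_nonpos hp1
            (natCast_le_rpow_of_log_le hn (hp n) h2) (by linarith)
    have h5 : (n : ℝ) ^ (-α + -(1 / 8)) ≤ (n : ℝ) ^ (-α) * (p n : ℝ) ^ (-β) := by
      rw [Real.rpow_add hn0]
      gcongr
    have h6 : 0 ≤ (n : ℝ) ^ (-((K - 2 * (kappa p).toReal) / 2)) := by positivity
    linarith
  · set κ := (kappa p).toReal with hκ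
    have hκ0 : 0 < κ := ENNReal.toReal_pos h0 hκt
    -- Then `6 * K * s ≤ κ / 2`, so `1 - K + 6 * K * s` stays strictly below `-K / 2 + κ`. The
    -- excess `K * s` in the bound of `log p` below is outweighed by the gain `3 * K * s` from the
    -- enlarged covariate bound.
    set s : ℝ := min (1 / 12) (κ / (12 * K)) with hs
    have hs0 : 0 < s := by positivity
    have hs1 : s ≤ 1 / 12 := min_le_left _ _
    have hKs : K * s ≤ κ / 12 := by
      calc K * s ≤ K * (κ / (12 * K)) := by gcongr; exact min_le_right _ _
        _ = κ / 12 := by field_simp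
    have hKs0 : 0 < K * s := by positivity
    obtain ⟨C, c, hC, hc, hreg⟩ :=
      hA.exists_regularDesign hν hp hμ hP hXY hB (by omega) hs0 (by linarith)
    have hlog := eventually_log_le_of_kappa_lt (p := p) (k := κ + K * s)
      (by rw [ENNReal.lt_ofReal_iff_toReal_lt hκt]; linarith)
    refine ⟨_, C, c, fun n => by positivity, hC, hc,
      tendsto_rpow_mul_sqrt hp hlog (s := s) (by linarith), ?_⟩
    filter_upwards [hreg (κ + K * s) (-((K - 2 * κ) / 2)) hlog (by nlinarith) (by nlinarith)]
      with n h1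
    have h6 : 0 ≤ (n : ℝ) ^ (-α) * (p n : ℝ) ^ (-β) := by positivity
    linarith

/-- Of the constant `4 * K ^ (K + 1)` only that it is at least one matters, because the exponents
leave room for all other constants. -/
theorem MomentCovariates.eventually_le_measureReal_strictlySelects (hν : GeneratesExpFamily ν)
    (hp : ∀ n, 1 ≤ p n) (hμ : ∀ n, IsProbabilityMeasure (μ n))
    (hP : ∀ n, IsProbabilityMeasure (P n))
    (hXY : ∀ n, IsGLMSample (P n) ν (μ n) (φ n) (X n) (Y n)) (hB : SparseRegime q μ φ)
    {K : ℕ} (hA : MomentCovariates ν μ K) {α β γ : ℝ} (hadm : AdmissibleScalars p α β γ) :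
    ∀ᶠ n : ℕ in atTop,
      1 - 4 * (K : ℝ) ^ (K + 1) * (n : ℝ) ^ (-((K - 2 * (kappa p).toReal) / 2))
          - (n : ℝ) ^ (-α) * (p n : ℝ) ^ (-β) ≤
        (P n).real {ω | StrictlySelects ν (fun i => X n i ω) (fun i => Y n i ω) γ q
          (trueModel (φ n)) (margin p α β γ n)} := by
  obtain ⟨M, C, c, hM, hC, hc, hMr, hreg⟩ :=
    hA.exists_eventually_measureReal_not_regularDesign_le hν hp hμ hP hXY hB hadm
  have hK : (1 : ℝ) ≤ 4 * (K : ℝ) ^ (K + 1) := by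
    have h1 : (1 : ℝ) ≤ K := by exact_mod_cast one_le_two.trans hA.two_le
    linarith [one_le_pow₀ h1 (n := K + 1)]
  filter_upwards [hreg, eventually_measureReal_not_strictlySelects hν hp hμ hP hXY hB hadm
    hM hC hc hMr] with n h1 h2
  have := hP n
  have h3 : 0 ≤ (n : ℝ) ^ (-((K - 2 * (kappa p).toReal) / 2)) := by positivity
  have h4 := le_mul_of_one_le_left h3 hK
  rcases h2 with h2 | h2
  · exact le_trans (by linarith) measureReal_nonneg
  · rw [sub_sub]
    exact one_sub_le_measureReal (by linarith)

/-- Consistency from a vanishing error probability. -/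
lemma tendsto_measureReal_selects (hp : ∀ n, 1 ≤ p n) (hP : ∀ n, IsProbabilityMeasure (P n))
    {α β γ : ℝ} (hα : 0 < α) (hβ : 0 < β) (hadm : AdmissibleScalars p α β γ) {e : ℕ → ℝ}
    (he : Tendsto e atTop (𝓝 0))
    (h : ∀ᶠ n : ℕ in atTop, 1 - e n - (n : ℝ) ^ (-α) * (p n : ℝ) ^ (-β) ≤
      (P n).real {ω | StrictlySelects ν (fun i => X n i ω) (fun i => Y n i ω) γ q
        (trueModel (φ n)) (margin p α β γ n)}) :
    Tendsto (fun n : ℕ => (P n).real {ω | Selects ν (fun i => X n i ω) (fun i => Y n i ω) γ q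
      (trueModel (φ n))}) atTop (𝓝 1) := by
  obtain ⟨_, _, _, _, hslack⟩ := hadm.exists_slack
  have ht : Tendsto (fun n : ℕ => 1 - e n - (n : ℝ) ^ (-α)) atTop (𝓝 1) := by
    simpa using (tendsto_const_nhds.sub he).sub
      ((tendsto_rpow_neg_atTop hα).comp tendsto_natCast_atTop_atTop)
  refine tendsto_of_tendsto_of_tendsto_of_le_of_le' ht tendsto_const_nhds ?_
    (Eventually.of_forall fun n => have := hP n; measureReal_le_one)
  filter_upwards [h, hslack] with n h1 h2
  have := hP n
  have h3 : (n : ℝ) ^ (-α) * (p n : ℝ) ^ (-β) ≤ (n : ℝ) ^ (-α) :=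
    mul_le_of_le_one_right (by positivity)
      (Real.rpow_le_one_of_one_le_of_nonpos (by exact_mod_cast hp n) (by linarith))
  exact (by linarith : _ ≤ _).trans (h1.trans (measureReal_mono fun ω hω => hω.selects h2.1))

end

end GLMSelection

theorem mainTheorem2
    (ν : Measure ℝ) (hν : GLMSelection.GeneratesExpFamily ν)
    (p : ℕ → ℕ) (hp : ∀ n, 1 ≤ p n) (q : ℕ)
    (μ : ∀ n, Measure (Fin (p n) → ℝ)) (hμ : ∀ n, IsProbabilityMeasure (μ n))
    (φ : ∀ n, Fin (p n) → ℝ)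
    (Ω : ℕ → Type*) [∀ n, MeasurableSpace (Ω n)]
    (P : ∀ n, Measure (Ω n)) (hP : ∀ n, IsProbabilityMeasure (P n))
    (X : ∀ n, Fin n → Ω n → Fin (p n) → ℝ) (Y : ∀ n, Fin n → Ω n → ℝ)
    (hXY : ∀ n, GLMSelection.IsGLMSample (P n) ν (μ n) (φ n) (X n) (Y n))
    (hB : GLMSelection.SparseRegime q μ φ) :
    (∀ α β γ : ℝ, GLMSelection.AdmissibleScalars p α β γ →
      (GLMSelection.BoundedCovariates μ →
        ∀ᶠ n : ℕ in atTop,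
          1 - (n : ℝ) ^ (-α) * (p n : ℝ) ^ (-β) ≤
            (P n).real {ω | GLMSelection.SelectsWithMargin ν (fun i => X n i ω)
              (fun i => Y n i ω) γ q (GLMSelection.trueModel (φ n))
              (GLMSelection.margin p α β γ n)}) ∧
      (∀ K : ℕ, GLMSelection.MomentCovariates ν μ K →
        ∀ᶠ n : ℕ in atTop,
          1 - 4 * (K : ℝ) ^ (K + 1) * (n : ℝ) ^ (-((K - 2 * (GLMSelection.kappa p).toReal) / 2))
              - (n : ℝ) ^ (-α) * (p n : ℝ) ^ (-β) ≤
            (P n).real {ω | GLMSelection.SelectsWithMargin ν (fun i => X n i ω)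
              (fun i => Y n i ω) γ q (GLMSelection.trueModel (φ n))
              (GLMSelection.margin p α β γ n)})) ∧
    ((GLMSelection.BoundedCovariates μ ∨ ∃ K : ℕ, GLMSelection.MomentCovariates ν μ K) →
      ∀ γ : ℝ, (GLMSelection.kappa p ≠ 0 → 1 - GLMSelection.invKappa p / 2 < γ) →
        Tendsto (fun n : ℕ => (P n).real {ω | GLMSelection.Selects ν (fun i => X n i ω)
          (fun i => Y n i ω) γ q (GLMSelection.trueModel (φ n))}) atTop (𝓝 1)) := by

  refine ⟨fun α β γ hadm => ⟨fun hA => ?_, fun K hA => ?_⟩, fun hA γ hγ => ?_⟩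
  · filter_upwards [hA.eventually_le_measureReal_strictlySelects hν hp hμ hP hXY hB hadm] with n h
    have := hP n
    exact h.trans (measureReal_mono fun ω hω => hω.selectsWithMargin)
  · filter_upwards [hA.eventually_le_measureReal_strictlySelects hν hp hμ hP hXY hB hadm] with n h
    have := hP n
    exact h.trans (measureReal_mono fun ω hω => hω.selectsWithMargin)
  · obtain ⟨α, β, hα, hβ, hadm⟩ := GLMSelection.exists_admissibleScalars hγ
    rcases hA with hA | ⟨K, hA⟩
    · refine GLMSelection.tendsto_measureReal_selects hp hP hα hβ hadm tendsto_const_nhds ?_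
      simpa only [sub_zero] using
        hA.eventually_le_measureReal_strictlySelects hν hp hμ hP hXY hB hadm
    · refine GLMSelection.tendsto_measureReal_selects hp hP hα hβ hadm ?_
        (hA.eventually_le_measureReal_strictlySelects hν hp hμ hP hXY hB hadm)
      have hK := (GLMSelection.two_mul_toReal_kappa_lt hA.two_kappa_lt).2
      simpa using ((tendsto_rpow_neg_atTop (half_pos (sub_pos.2 hK))).comp
        tendsto_natCast_atTop_atTop).const_mul (4 * (K : ℝ) ^ (K + 1))
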